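/- Let $\mathbf k$ be a field of characteristic zero and let $P=\Gamma(E)/(R)$ be a quadratic operad over $\mathbf k$ (for instance a quadratic Koszul operad), where $E=P(2)$ is a finite dimensional $\Sigma_2$-module in degree $0$ and $R\subset\Gamma(E)(3)$ is a $\Sigma_3$-submodule. Let $P^!=\Gamma(E^\vee)/(R^\perp)$, $E^\vee=E^\#\otimes\mathrm{sgn}_2$, be the quadratic dual operad ($\#$ denotes the linear dual), and let $\mathfrak s$ denote the operadic suspension, $\mathfrak sQ(n)=\uparrow^{n-1}Q(n)\otimes\mathrm{sgn}_n$ (so $\mathfrak s\mathcal{L}ie=\Lambda\mathcal{L}ie$). *The cochain complex.* For a $P$-algebra $\alpha:P\to\mathcal End_A$ put $C_P^{n-1}(A;A)=\mathfrak s(\mathcal End_A\otimes P^!)(n)^{\Sigma_n}$, with the pre-Lie product $f\circ g=\mathrm{Aver}(\sum_i f\circ_i g)$, where $\mathrm{Aver}$ is the average over the symmetric group. The *canonical element* $\chi\in\mathfrak s(P\otimes P^!)(2)$ corresponds to the identity of $P(2)$ under $P(2)\otimes P^!(2)\cong P(2)\otimes P(2)^\#\cong \mathrm{Lin}(P(2),P(2))$.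 The differential is $d_Pf=\mu\circ f-(-1)^{|f|}f\circ\mu$ with $\mu=\tfrac12\,\mathfrak s(\alpha\otimes\mathrm{id})(\chi)$ (for associative algebras $\mu$ is the multiplication). *Natural operations.* Let $B_P=\{B_P^*(n)\}_n$ be the spaces of natural $n$-linear operations on $C_P^*(A;A)$, that is, of families of multilinear maps, one for each $P$-algebra $A$, such that, in each fixed multidegree of the arguments, the family is a finite linear combination (independent of $A$) of operations $$U_{(T,\Phi)}(f_1,\dots,f_n)=\mathrm{Aver}\bigl(T(\phi_1,\dots,\phi_n)\otimes\Phi(q_1,\dots,q_n)\bigr),\qquad f_i=\textstyle\sum\phi_i\otimes q_i .$$ Here $T$ is a rooted tree with $n$ white vertices, decorated by the $\phi_i$, and with at least binary black vertices decorated by elements of $P$ (acting through $\alpha$); $T(\phi_1,\dots,\phi_n)$ is the composition along $T$, and $\Phi$ is a linear map between the corresponding components of $\mathfrak sP^!$. An operation $U$ has degree $d$ if it raises the total degree by $d$. The differential $\delta_P$ of $B_P$ is $$\delta_P(U)(f_1,\dots,f_n)=d_PU(f_1,\dots,f_n)-(-1)^{|U|}\sum_i(-1)^{|f_1|+\cdots+|f_{i-1}|}U(f_1,\dots,d_Pf_i,\dots,f_n).$$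 An element $t\in\mathfrak s(P\otimes P^!)(n)$ acts as the natural operation of degree $n-1$ $$\mathit{cup}(t)(f_1,\dots,f_n)=\mathrm{Aver}\bigl(\mathfrak s(\alpha\otimes \mathrm{id})(t)(f_1,\dots,f_n)\bigr).$$ Let $Z_P(n)=\{t\in\mathfrak s(P\otimes P^!)(n) : \delta_P(\mathit{cup}(t))=0\}$. **Proposition.** $Z_P$ is a suboperad of $\mathfrak s(P\otimes P^!)$ and contains $\chi$. There is a unique map of operads $L:\mathfrak s\mathcal{L}ie\to Z_P$ that sends the suspended Lie bracket $\mathfrak s\lambda\in\mathfrak s\mathcal{L}ie(2)$ to $\chi$. For every $n\neq1$ each element of $L(\mathfrak s\mathcal{L}ie(n))$ is $\delta_P$-cohomologous to zero in $B_P$: for every $x\in\mathfrak s\mathcal{L}ie(n)$ there is $U\in B_P^{n-2}(n)$ with $\delta_P(U)=\mathit{cup}(L(x))$. Moreover the pre-Lie product $\circ$ lies in $B_P^0(2)$, and with the above sign conventions $\mathit{cup}(\chi)=\delta_P(-\circ)$. -/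

import Mathlib

universe u

namespace CohOp

open scoped TensorProduct DirectSum

/-- Position, among the `r = m + n - 1` inputs of `f ∘_i g`, of the input `z` of `g`. -/
def inBlk {m n r : ℕ} (h : r + 1 = m + n) (i : Fin m) (z : Fin n) : Fin r :=
  ⟨i + z, by omega⟩

/-- Position, among the `r = m + n - 1` inputs of `f ∘_i g`, of the input `y ≠ i` of `f`. -/
def outBlk {m n r : ℕ} (h : r + 1 = m + n) (i y : Fin m) (hy : y ≠ i) : Fin r :=
  if hlt : y < i then ⟨y, by omega⟩
  else ⟨y + n - 1, by
    have : (y : ℕ) ≠ i := fun h' => hy (Fin.ext h')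
    omega⟩

theorem inBlk_val {m n r : ℕ} (h : r + 1 = m + n) (i : Fin m) (z : Fin n) :
    (inBlk h i z : ℕ) = i + z := rfl

theorem outBlk_val {m n r : ℕ} (h : r + 1 = m + n) (i y : Fin m) (hy : y ≠ i) :
    (outBlk h i y hy : ℕ) = if (y : ℕ) < i then (y : ℕ) else y + n - 1 := by
  simp only [outBlk, Fin.lt_def]
  split_ifs <;> rfl

/-- `ρ` is the block permutation `σ ∘_i τ`, characterized by `(f σ) ∘_i (g τ) = (f ∘_{σ i} g) ρ`
for multilinear maps. -/
def IsBlockPerm {m n r : ℕ} (h : r + 1 = m + n) (i : Fin m)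
    (σ : Equiv.Perm (Fin m)) (τ : Equiv.Perm (Fin n)) (ρ : Equiv.Perm (Fin r)) : Prop :=
  (∀ z, ρ (inBlk h i z) = inBlk h (σ i) (τ z)) ∧
    ∀ y (hy : y ≠ i), ρ (outBlk h i y hy) = outBlk h (σ i) (σ y) (σ.injective.ne hy)

theorem in_or_out {m n r : ℕ} (h : r + 1 = m + n) (i : Fin m) (x : Fin r) :
    (∃ z, x = inBlk h i z) ∨ ∃ y, ∃ hy : y ≠ i, x = outBlk h i y hy := by
  by_cases h1 : (x : ℕ) < i
  · refine Or.inr ⟨⟨x, by omega⟩, fun h' => by rw [← h'] at h1; simp at h1, ?_⟩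
    simp [outBlk, Fin.lt_def, h1]
  by_cases h2 : (x : ℕ) < i + n
  · exact Or.inl ⟨⟨x - i, by omega⟩, Fin.ext (by simp [inBlk]; omega)⟩
  · refine Or.inr ⟨⟨x + 1 - n, by omega⟩, fun h' => by rw [← h'] at h1 h2; simp at h1 h2; omega, ?_⟩
    have : ¬ ((x : ℕ) + 1 - n < i) := by omega
    simp only [outBlk, Fin.lt_def, this, dite_false]
    exact Fin.ext (by simp; omega)

/-- The permutation of `Fin r` moving the block `i, …, i + n - 1` to the front. -/
def blkFront (r i n : ℕ) (h : i + n ≤ r) : Equiv.Perm (Fin r) :=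
  Equiv.Perm.extendDomain (p := fun x : Fin r => (x : ℕ) < i + n) ((finRotate (i + n)) ^ n)
    { toFun := fun x => ⟨⟨x, by omega⟩, x.2⟩
      invFun := fun x => ⟨x.1, x.2⟩
      left_inv := fun _ => rfl
      right_inv := fun _ => rfl }

theorem finRotate_pow_val (N n : ℕ) (x : Fin N) :
    (((finRotate N) ^ n) x : ℕ) = (x + n) % N := by
  induction n with
  | zero => simp [Nat.mod_eq_of_lt x.2]
  | succ n ih =>
    rw [pow_succ', Equiv.Perm.mul_apply]
    obtain _ | N := N
    · exact x.elim0
    rw [finRotate_apply, Fin.val_add, ih, Fin.val_one', ← Nat.add_mod, add_assoc]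

theorem sign_blkFront (r i n : ℕ) (h : i + n ≤ r) :
    Equiv.Perm.sign (blkFront r i n h) = (-1) ^ (i * n) := by
  rw [blkFront, Equiv.Perm.sign_extendDomain, map_pow, sign_finRotate, ← pow_mul]
  obtain _ | n := n
  · simp
  · have : (i + (n + 1) - 1) * (n + 1) = i * (n + 1) + n * (n + 1) := by
      rw [← add_assoc, Nat.add_sub_cancel]; ring
    rw [this, pow_add, (Nat.even_mul_succ_self n).neg_one_pow, mul_one]

theorem blkFront_val (r i n : ℕ) (h : i + n ≤ r) (x : Fin r) :
    (blkFront r i n h x : ℕ) =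
      if (x : ℕ) < i then x + n else if (x : ℕ) < i + n then x - i else x := by
  by_cases hx : (x : ℕ) < i + n
  · rw [blkFront, Equiv.Perm.extendDomain_apply_subtype (p := fun x : Fin r => (x : ℕ) < i + n) _ _ hx]
    simp only [Equiv.coe_fn_symm_mk, Equiv.coe_fn_mk]
    rw [finRotate_pow_val]
    simp only
    split_ifs with h1
    · exact Nat.mod_eq_of_lt (by omega)
    · rw [show (x : ℕ) + n = (x - i) + (i + n) by omega, Nat.add_mod_right]
      exact Nat.mod_eq_of_lt (by omega)
  · rw [blkFront, Equiv.Perm.extendDomain_apply_not_subtype (p := fun x : Fin r => (x : ℕ) < i + n) _ _ hx]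
    have : ¬ (x : ℕ) < i := by omega
    simp [hx, this]

theorem sign_block {m n r : ℕ} {h : r + 1 = m + n} {i : Fin m}
    {σ : Equiv.Perm (Fin m)} {τ : Equiv.Perm (Fin n)} {ρ : Equiv.Perm (Fin r)}
    (hρ : IsBlockPerm h i σ τ ρ) :
    Equiv.Perm.sign ρ = Equiv.Perm.sign σ * Equiv.Perm.sign τ *
      (-1) ^ (((i : ℕ) + (σ i : ℕ)) * (n + 1)) := by
  obtain _ | m := m
  · exact i.elim0
  obtain rfl : r = n + m := by omega
  set σ' : Equiv.Perm (Fin (m + 1)) := Fin.cycleRange (σ i) * σ * (Fin.cycleRange i)⁻¹ with hσ'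
  have hσ0 : σ' 0 = 0 := by
    simp [hσ', Fin.cycleRange_self]
  obtain ⟨⟨p, e⟩, he⟩ := (Equiv.Perm.decomposeFin (n := m)).symm.surjective σ'
  have hp : p = 0 := by
    have := Equiv.Perm.decomposeFin_symm_apply_zero p e
    rw [he, hσ0] at this; exact this.symm
  subst hp
  have hes : ∀ x : Fin m, σ' x.succ = (e x).succ := by
    intro x; rw [← he]; simp
  have hsg : Equiv.Perm.sign e = Equiv.Perm.sign σ * (-1) ^ ((i : ℕ) + (σ i : ℕ)) := by
    have h1 : Equiv.Perm.sign σ' = Equiv.Perm.sign e := by rw [← he]; simp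
    rw [← h1, hσ']
    simp only [map_mul, map_inv, Fin.sign_cycleRange, pow_add]
    simp only [Int.units_inv_eq_self]
    ac_rfl
  have key : blkFront (n + m) (σ i) n (by omega) * ρ =
      (finSumFinEquiv.permCongr (Equiv.Perm.sumCongr τ e)) * blkFront (n + m) i n (by omega) := by
    have hin : ∀ (j : Fin (m + 1)) (z : Fin n) (hj : (j : ℕ) + n ≤ n + m),
        blkFront (n + m) j n hj (inBlk h j z) = finSumFinEquiv (Sum.inl z) := by
      intro j z hj
      apply Fin.ext
      rw [blkFront_val]
      simp [inBlk]
    have hout : ∀ (j : Fin (m + 1)) (w : Fin m) (hj : (j : ℕ) + n ≤ n + m),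
        blkFront (n + m) j n hj (outBlk h j (j.succAbove w) (Fin.succAbove_ne j w)) =
          finSumFinEquiv (Sum.inr w) := by
      intro j w hj
      apply Fin.ext
      rw [blkFront_val]
      by_cases hw : (w : ℕ) < j
      · have hs : j.succAbove w = w.castSucc := Fin.succAbove_of_castSucc_lt _ _ hw
        have hlt : w.castSucc < j := hw
        simp [outBlk, hs, hlt, hw, add_comm]
      · have hs : j.succAbove w = w.succ :=
          Fin.succAbove_of_le_castSucc _ _ (by simpa [Fin.le_def] using hw)
        have hlt : ¬ w.succ < j := by simp [Fin.lt_def]; omega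
        have h1 : ¬ ((w : ℕ) + 1 + n - 1 < j) := by omega
        have h2 : ¬ ((w : ℕ) + 1 + n - 1 < j + n) := by omega
        simp only [outBlk, hs, hlt, dite_false, Fin.val_succ, h1, h2, if_false]
        simp; omega
    have hσe : ∀ w : Fin m, σ (i.succAbove w) = (σ i).succAbove (e w) := by
      intro w
      apply (Fin.cycleRange (σ i)).injective
      rw [Fin.cycleRange_succAbove, ← hes, hσ']
      simp only [Equiv.Perm.mul_apply]
      congr 2
      rw [eq_comm, Equiv.Perm.inv_eq_iff_eq, Fin.cycleRange_succAbove]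
    ext1 x
    simp only [Equiv.Perm.mul_apply]
    rcases in_or_out h i x with ⟨z, rfl⟩ | ⟨y, hy, rfl⟩
    · rw [hρ.1, hin, hin]; simp
    · obtain ⟨w, rfl⟩ := Fin.exists_succAbove_eq hy
      rw [hρ.2, hout]
      have : outBlk h (σ i) (σ (i.succAbove w)) (σ.injective.ne hy) =
          outBlk h (σ i) ((σ i).succAbove (e w)) (Fin.succAbove_ne _ _) := by
        congr 1; exact hσe w
      rw [this, hout]; simp
  have := congrArg Equiv.Perm.sign key
  simp only [map_mul, sign_blkFront, Equiv.Perm.sign_permCongr, Equiv.Perm.sign_sumCongr, hsg] at this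
  have h2 : Equiv.Perm.sign ρ = (-1) ^ ((σ i : ℕ) * n) * ((-1) ^ ((σ i : ℕ) * n) * Equiv.Perm.sign ρ) := by
    rw [← mul_assoc, ← pow_add, ← two_mul, pow_mul]; simp
  rw [h2, this]
  rw [add_mul, pow_add, mul_add, mul_add, pow_add, pow_add, pow_add]
  simp only [mul_one]
  ac_rfl

/-! ### Operads -/

/-- An operad in graded `k`-vector spaces whose arity `n` component is concentrated in the single
degree `deg n` (so `deg = 0` gives operads in vector spaces), in terms of right actions of the
symmetric groups, partial compositions `∘_i` (inputs are numbered from `0`) and a unit. -/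
structure Operad (k : Type u) [Field k] (deg : ℕ → ℤ) where
  obj : ℕ → Type u
  [addCommGroup : ∀ n, AddCommGroup (obj n)]
  [module : ∀ n, Module k (obj n)]
  one : obj 1
  act : ∀ {n : ℕ}, Equiv.Perm (Fin n) → obj n →ₗ[k] obj n
  comp : ∀ {m n r : ℕ}, r + 1 = m + n → Fin m → (obj m →ₗ[k] obj n →ₗ[k] obj r)
  act_one : ∀ {n : ℕ} (f : obj n), act 1 f = f
  act_mul : ∀ {n : ℕ} (σ τ : Equiv.Perm (Fin n)) (f : obj n), act (σ * τ) f = act τ (act σ f)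
  one_comp : ∀ {n : ℕ} (h : n + 1 = 1 + n) (f : obj n), comp h 0 one f = f
  comp_one : ∀ {n : ℕ} (h : n + 1 = n + 1) (i : Fin n) (f : obj n), comp h i f one = f
  comp_seq : ∀ {m n l r s t : ℕ} (h₁ : r + 1 = m + n) (h₂ : t + 1 = r + l) (h₃ : s + 1 = n + l)
    (h₄ : t + 1 = m + s) (i : Fin m) (j : Fin n) (f : obj m) (g : obj n) (g' : obj l),
    comp h₂ (inBlk h₁ i j) (comp h₁ i f g) g' = comp h₄ i f (comp h₃ j g g')
  comp_par : ∀ {m n l r s t : ℕ} (h₁ : r + 1 = m + n) (h₂ : t + 1 = r + l) (h₃ : s + 1 = m + l)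
    (h₄ : t + 1 = s + n) (i j : Fin m) (hij : i < j) (f : obj m) (g : obj n) (g' : obj l),
    comp h₂ (outBlk h₁ i j hij.ne') (comp h₁ i f g) g' =
      (deg n * deg l).negOnePow • comp h₄ (outBlk h₃ j i hij.ne) (comp h₃ j f g') g
  comp_act : ∀ {m n r : ℕ} (h : r + 1 = m + n) (i : Fin m) (σ : Equiv.Perm (Fin m))
    (τ : Equiv.Perm (Fin n)) (ρ : Equiv.Perm (Fin r)), IsBlockPerm h i σ τ ρ →
    ∀ (f : obj m) (g : obj n), comp h i (act σ f) (act τ g) = act ρ (comp h (σ i) f g)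

attribute [instance] Operad.addCommGroup Operad.module

/-- Operads in vector spaces. -/
abbrev Operad₀ (k : Type u) [Field k] := Operad k (fun _ => 0)

variable {k : Type u} [Field k] {deg : ℕ → ℤ}

/-- Morphisms of operads. -/
@[ext]
structure OperadHom (P Q : Operad k deg) where
  map : ∀ n, P.obj n →ₗ[k] Q.obj n
  map_one : map 1 P.one = Q.one
  map_act : ∀ {n : ℕ} (σ : Equiv.Perm (Fin n)) (f : P.obj n), map n (P.act σ f) = Q.act σ (map n f)
  map_comp : ∀ {m n r : ℕ} (h : r + 1 = m + n) (i : Fin m) (f : P.obj m) (g : P.obj n),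
    map r (P.comp h i f g) = Q.comp h i (map m f) (map n g)

/-- Suboperads. -/
structure Suboperad (P : Operad k deg) where
  carrier : ∀ n, Submodule k (P.obj n)
  one_mem : P.one ∈ carrier 1
  act_mem : ∀ {n : ℕ} (σ : Equiv.Perm (Fin n)) (f : P.obj n), f ∈ carrier n → P.act σ f ∈ carrier n
  comp_mem : ∀ {m n r : ℕ} (h : r + 1 = m + n) (i : Fin m) (f : P.obj m) (g : P.obj n),
    f ∈ carrier m → g ∈ carrier n → P.comp h i f g ∈ carrier r

/-- A suboperad as an operad. -/
def Suboperad.toOperad {P : Operad k deg} (S : Suboperad P) : Operad k deg where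
  obj n := S.carrier n
  one := ⟨P.one, S.one_mem⟩
  act σ := (P.act σ).restrict (S.act_mem σ)
  comp h i := LinearMap.mk₂ k (fun f g => ⟨P.comp h i f g, S.comp_mem h i f g f.2 g.2⟩)
    (fun _ _ _ => Subtype.ext (by simp)) (fun _ _ _ => Subtype.ext (by simp))
    (fun _ _ _ => Subtype.ext (by simp)) (fun _ _ _ => Subtype.ext (by simp))
  act_one f := Subtype.ext (P.act_one _)
  act_mul σ τ f := Subtype.ext (P.act_mul σ τ _)
  one_comp h f := Subtype.ext (P.one_comp h _)
  comp_one h i f := Subtype.ext (P.comp_one h i _)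
  comp_seq h₁ h₂ h₃ h₄ i j f g g' := Subtype.ext (P.comp_seq h₁ h₂ h₃ h₄ i j _ _ _)
  comp_par h₁ h₂ h₃ h₄ i j hij f g g' := Subtype.ext <| by
    have := P.comp_par h₁ h₂ h₃ h₄ i j hij f.1 g.1 g'.1
    rcases Int.units_eq_one_or (deg _ * deg _).negOnePow with h | h <;> rw [h] at this ⊢ <;>
      simpa using this
  comp_act h i σ τ ρ hρ f g := Subtype.ext (P.comp_act h i σ τ ρ hρ _ _)

/-! ### Ideals and quotients -/

/-- Membership in the operadic ideal generated by `S`. -/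
inductive InIdeal (P : Operad k deg) (S : ∀ n, Set (P.obj n)) : ∀ n, P.obj n → Prop
  | of {n : ℕ} (f : P.obj n) (hf : f ∈ S n) : InIdeal P S n f
  | zero (n : ℕ) : InIdeal P S n 0
  | add {n : ℕ} (f g : P.obj n) : InIdeal P S n f → InIdeal P S n g → InIdeal P S n (f + g)
  | smul {n : ℕ} (c : k) (f : P.obj n) : InIdeal P S n f → InIdeal P S n (c • f)
  | act {n : ℕ} (σ : Equiv.Perm (Fin n)) (f : P.obj n) : InIdeal P S n f → InIdeal P S n (P.act σ f)
  | comp_left {m n r : ℕ} (h : r + 1 = m + n) (i : Fin m) (f : P.obj m) (g : P.obj n) :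
      InIdeal P S m f → InIdeal P S r (P.comp h i f g)
  | comp_right {m n r : ℕ} (h : r + 1 = m + n) (i : Fin m) (f : P.obj m) (g : P.obj n) :
      InIdeal P S n g → InIdeal P S r (P.comp h i f g)

/-- The operadic ideal generated by `S`. -/
def Operad.ideal (P : Operad k deg) (S : ∀ n, Set (P.obj n)) (n : ℕ) : Submodule k (P.obj n) where
  carrier := {f | InIdeal P S n f}
  zero_mem' := .zero n
  add_mem' := fun {f g} hf hg => .add f g hf hg
  smul_mem' := fun c f hf => .smul c f hf

/-- Partial composition on a quotient by an operadic ideal. -/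
def Operad.quotComp (P : Operad k deg) (S : ∀ n, Set (P.obj n)) {m n r : ℕ} (h : r + 1 = m + n)
    (i : Fin m) :
    (P.obj m ⧸ P.ideal S m) →ₗ[k] (P.obj n ⧸ P.ideal S n) →ₗ[k] (P.obj r ⧸ P.ideal S r) :=
  (P.ideal S m).liftQ
    { toFun := fun f => (P.ideal S n).mapQ (P.ideal S r) (P.comp h i f)
        (fun g hg => InIdeal.comp_right h i f g hg)
      map_add' := fun f f' => by
        refine Submodule.linearMap_qext _ (LinearMap.ext fun g => ?_)
        exact congrArg Submodule.Quotient.mk (LinearMap.map_add₂ (P.comp h i) f f' g)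
      map_smul' := fun c f => by
        refine Submodule.linearMap_qext _ (LinearMap.ext fun g => ?_)
        exact congrArg Submodule.Quotient.mk (LinearMap.map_smul₂ (P.comp h i) c f g) }
    (fun f hf => by
      rw [LinearMap.mem_ker]
      refine Submodule.linearMap_qext _ (LinearMap.ext fun g => ?_)
      exact (Submodule.Quotient.mk_eq_zero _).2 (InIdeal.comp_left h i f g hf))

/-- The quotient of an operad by the operadic ideal generated by `S`. -/
def Operad.quot (P : Operad k deg) (S : ∀ n, Set (P.obj n)) : Operad k deg where
  obj n := P.obj n ⧸ P.ideal S n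
  one := Submodule.Quotient.mk P.one
  act σ := (P.ideal S _).mapQ (P.ideal S _) (P.act σ) (fun f hf => InIdeal.act σ f hf)
  comp h i := P.quotComp S h i
  act_one f := by
    induction f using Submodule.Quotient.induction_on with | _ f =>
    exact congrArg _ (P.act_one f)
  act_mul σ τ f := by
    induction f using Submodule.Quotient.induction_on with | _ f =>
    exact congrArg _ (P.act_mul σ τ f)
  one_comp h f := by
    induction f using Submodule.Quotient.induction_on with | _ f =>
    exact congrArg _ (P.one_comp h f)
  comp_one h i f := by
    induction f using Submodule.Quotient.induction_on with | _ f =>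
    exact congrArg _ (P.comp_one h i f)
  comp_seq h₁ h₂ h₃ h₄ i j f g g' := by
    induction f using Submodule.Quotient.induction_on with | _ f =>
    induction g using Submodule.Quotient.induction_on with | _ g =>
    induction g' using Submodule.Quotient.induction_on with | _ g' =>
    exact congrArg _ (P.comp_seq h₁ h₂ h₃ h₄ i j f g g')
  comp_par h₁ h₂ h₃ h₄ i j hij f g g' := by
    induction f using Submodule.Quotient.induction_on with | _ f =>
    induction g using Submodule.Quotient.induction_on with | _ g =>
    induction g' using Submodule.Quotient.induction_on with | _ g' =>
    exact congrArg _ (P.comp_par h₁ h₂ h₃ h₄ i j hij f g g')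
  comp_act h i σ τ ρ hρ f g := by
    induction f using Submodule.Quotient.induction_on with | _ f =>
    induction g using Submodule.Quotient.induction_on with | _ g =>
    exact congrArg _ (P.comp_act h i σ τ ρ hρ f g)

/-! ### Free operads on binary generators -/

/-- Formal operadic expressions in binary operations from `E`. -/
inductive OTerm (k E : Type u) : ℕ → Type u
  | zero (n : ℕ) : OTerm k E n
  | add {n : ℕ} : OTerm k E n → OTerm k E n → OTerm k E n
  | smul {n : ℕ} : k → OTerm k E n → OTerm k E n
  | one : OTerm k E 1
  | gen : E → OTerm k E 2
  | act {n : ℕ} : Equiv.Perm (Fin n) → OTerm k E n → OTerm k E n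
  | comp {m n r : ℕ} : r + 1 = m + n → Fin m → OTerm k E m → OTerm k E n → OTerm k E r

/-- The congruence on formal expressions generated by the axioms of a `k`-linear operad, by
linearity of `e ↦ gen e`, and by the requirement that the transposition acts on `E` as `τ`. -/
inductive OTerm.Rel {E : Type u} [AddCommGroup E] [Module k E] (τ : E →ₗ[k] E) :
    ∀ {n : ℕ}, OTerm k E n → OTerm k E n → Prop
  | refl {n : ℕ} (x : OTerm k E n) : Rel τ x x
  | symm {n : ℕ} {x y : OTerm k E n} : Rel τ x y → Rel τ y x
  | trans {n : ℕ} {x y z : OTerm k E n} : Rel τ x y → Rel τ y z → Rel τ x z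
  | add_congr {n : ℕ} {x x' y y' : OTerm k E n} :
      Rel τ x x' → Rel τ y y' → Rel τ (.add x y) (.add x' y')
  | smul_congr {n : ℕ} (c : k) {x x' : OTerm k E n} : Rel τ x x' → Rel τ (.smul c x) (.smul c x')
  | act_congr {n : ℕ} (σ : Equiv.Perm (Fin n)) {x x' : OTerm k E n} :
      Rel τ x x' → Rel τ (.act σ x) (.act σ x')
  | comp_congr {m n r : ℕ} (h : r + 1 = m + n) (i : Fin m) {x x' : OTerm k E m}
      {y y' : OTerm k E n} : Rel τ x x' → Rel τ y y' → Rel τ (.comp h i x y) (.comp h i x' y')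
  | add_assoc {n : ℕ} (x y z : OTerm k E n) : Rel τ (.add (.add x y) z) (.add x (.add y z))
  | add_comm {n : ℕ} (x y : OTerm k E n) : Rel τ (.add x y) (.add y x)
  | zero_add {n : ℕ} (x : OTerm k E n) : Rel τ (.add (.zero n) x) x
  | smul_add {n : ℕ} (c : k) (x y : OTerm k E n) :
      Rel τ (.smul c (.add x y)) (.add (.smul c x) (.smul c y))
  | add_smul {n : ℕ} (c d : k) (x : OTerm k E n) :
      Rel τ (.smul (c + d) x) (.add (.smul c x) (.smul d x))
  | mul_smul {n : ℕ} (c d : k) (x : OTerm k E n) : Rel τ (.smul (c * d) x) (.smul c (.smul d x))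
  | one_smul {n : ℕ} (x : OTerm k E n) : Rel τ (.smul 1 x) x
  | zero_smul {n : ℕ} (x : OTerm k E n) : Rel τ (.smul 0 x) (.zero n)
  | gen_add (e e' : E) : Rel τ (.gen (e + e')) (.add (.gen e) (.gen e'))
  | gen_smul (c : k) (e : E) : Rel τ (.gen (c • e)) (.smul c (.gen e))
  | gen_swap (e : E) : Rel τ (.gen (τ e)) (.act (Equiv.swap 0 1) (.gen e))
  | act_add {n : ℕ} (σ : Equiv.Perm (Fin n)) (x y : OTerm k E n) :
      Rel τ (.act σ (.add x y)) (.add (.act σ x) (.act σ y))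
  | act_smul {n : ℕ} (σ : Equiv.Perm (Fin n)) (c : k) (x : OTerm k E n) :
      Rel τ (.act σ (.smul c x)) (.smul c (.act σ x))
  | comp_add_left {m n r : ℕ} (h : r + 1 = m + n) (i : Fin m) (x x' : OTerm k E m)
      (y : OTerm k E n) : Rel τ (.comp h i (.add x x') y) (.add (.comp h i x y) (.comp h i x' y))
  | comp_smul_left {m n r : ℕ} (h : r + 1 = m + n) (i : Fin m) (c : k) (x : OTerm k E m)
      (y : OTerm k E n) : Rel τ (.comp h i (.smul c x) y) (.smul c (.comp h i x y))
  | comp_add_right {m n r : ℕ} (h : r + 1 = m + n) (i : Fin m) (x : OTerm k E m)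
      (y y' : OTerm k E n) : Rel τ (.comp h i x (.add y y')) (.add (.comp h i x y) (.comp h i x y'))
  | comp_smul_right {m n r : ℕ} (h : r + 1 = m + n) (i : Fin m) (c : k) (x : OTerm k E m)
      (y : OTerm k E n) : Rel τ (.comp h i x (.smul c y)) (.smul c (.comp h i x y))
  | act_one {n : ℕ} (x : OTerm k E n) : Rel τ (.act 1 x) x
  | act_mul {n : ℕ} (σ ρ : Equiv.Perm (Fin n)) (x : OTerm k E n) :
      Rel τ (.act (σ * ρ) x) (.act ρ (.act σ x))
  | one_comp {n : ℕ} (h : n + 1 = 1 + n) (x : OTerm k E n) : Rel τ (.comp h 0 .one x) x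
  | comp_one {n : ℕ} (h : n + 1 = n + 1) (i : Fin n) (x : OTerm k E n) : Rel τ (.comp h i x .one) x
  | comp_seq {m n l r s t : ℕ} (h₁ : r + 1 = m + n) (h₂ : t + 1 = r + l) (h₃ : s + 1 = n + l)
      (h₄ : t + 1 = m + s) (i : Fin m) (j : Fin n) (x : OTerm k E m) (y : OTerm k E n)
      (z : OTerm k E l) :
      Rel τ (.comp h₂ (inBlk h₁ i j) (.comp h₁ i x y) z) (.comp h₄ i x (.comp h₃ j y z))
  | comp_par {m n l r s t : ℕ} (h₁ : r + 1 = m + n) (h₂ : t + 1 = r + l) (h₃ : s + 1 = m + l)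
      (h₄ : t + 1 = s + n) (i j : Fin m) (hij : i < j) (x : OTerm k E m) (y : OTerm k E n)
      (z : OTerm k E l) :
      Rel τ (.comp h₂ (outBlk h₁ i j hij.ne') (.comp h₁ i x y) z)
        (.comp h₄ (outBlk h₃ j i hij.ne) (.comp h₃ j x z) y)
  | comp_act {m n r : ℕ} (h : r + 1 = m + n) (i : Fin m) (σ : Equiv.Perm (Fin m))
      (ρ : Equiv.Perm (Fin n)) (π : Equiv.Perm (Fin r)) (hπ : IsBlockPerm h i σ ρ π)
      (x : OTerm k E m) (y : OTerm k E n) :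
      Rel τ (.comp h i (.act σ x) (.act ρ y)) (.act π (.comp h (σ i) x y))

section Free

variable {E : Type u} [AddCommGroup E] [Module k E] (τ : E →ₗ[k] E)

/-- Formal expressions modulo the operad axioms. -/
def FreeObj (n : ℕ) : Type u := Quot (fun x y : OTerm k E n => OTerm.Rel τ x y)

instance (n : ℕ) : Zero (FreeObj τ n) := ⟨Quot.mk _ (.zero n)⟩

instance (n : ℕ) : Add (FreeObj τ n) :=
  ⟨Quot.map₂ .add (fun _ _ _ h => .add_congr (.refl _) h) (fun _ _ _ h => .add_congr h (.refl _))⟩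

instance (n : ℕ) : Neg (FreeObj τ n) :=
  ⟨Quot.map (.smul (-1)) (fun _ _ h => .smul_congr _ h)⟩

instance (n : ℕ) : AddCommGroup (FreeObj τ n) where
  nsmul := nsmulRec
  zsmul := zsmulRec
  add_assoc := by rintro ⟨x⟩ ⟨y⟩ ⟨z⟩; exact Quot.sound (.add_assoc x y z)
  zero_add := by rintro ⟨x⟩; exact Quot.sound (.zero_add x)
  add_zero := by rintro ⟨x⟩; exact Quot.sound (.trans (.add_comm _ _) (.zero_add x))
  add_comm := by rintro ⟨x⟩ ⟨y⟩; exact Quot.sound (.add_comm x y)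
  neg_add_cancel := by
    rintro ⟨x⟩
    refine Quot.sound (.trans (.add_congr (.refl _) (.symm (.one_smul x))) ?_)
    refine .trans (.symm (.add_smul _ _ _)) ?_
    rw [neg_add_cancel]
    exact .zero_smul x

instance (n : ℕ) : Module k (FreeObj τ n) where
  smul c := Quot.map (.smul c) (fun _ _ h => .smul_congr _ h)
  one_smul := by rintro ⟨x⟩; exact Quot.sound (.one_smul x)
  mul_smul := by rintro c d ⟨x⟩; exact Quot.sound (.mul_smul c d x)
  smul_zero := by
    intro c
    refine Quot.sound (.trans (.smul_congr c (.symm (.zero_smul (.zero n)))) ?_)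
    refine .trans (.symm (.mul_smul _ _ _)) ?_
    rw [mul_zero]
    exact .zero_smul _
  smul_add := by rintro c ⟨x⟩ ⟨y⟩; exact Quot.sound (.smul_add c x y)
  add_smul := by rintro c d ⟨x⟩; exact Quot.sound (.add_smul c d x)
  zero_smul := by rintro ⟨x⟩; exact Quot.sound (.zero_smul x)

/-- The free operad `Γ(E)` on the `Σ₂`-module `E` (with the transposition acting by `τ`) placed in
arity two. -/
def freeOperad : Operad₀ k where
  obj := FreeObj τ
  one := Quot.mk _ .one
  act σ :=
    { toFun := Quot.map (.act σ) (fun _ _ h => .act_congr σ h)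
      map_add' := by rintro ⟨x⟩ ⟨y⟩; exact Quot.sound (.act_add σ x y)
      map_smul' := by rintro c ⟨x⟩; exact Quot.sound (.act_smul σ c x) }
  comp h i := LinearMap.mk₂ k
    (Quot.map₂ (.comp h i) (fun _ _ _ h' => .comp_congr h i (.refl _) h')
      (fun _ _ _ h' => .comp_congr h i h' (.refl _)))
    (by rintro ⟨x⟩ ⟨y⟩ ⟨z⟩; exact Quot.sound (.comp_add_left h i x y z))
    (by rintro c ⟨x⟩ ⟨y⟩; exact Quot.sound (.comp_smul_left h i c x y))
    (by rintro ⟨x⟩ ⟨y⟩ ⟨z⟩; exact Quot.sound (.comp_add_right h i x y z))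
    (by rintro c ⟨x⟩ ⟨y⟩; exact Quot.sound (.comp_smul_right h i c x y))
  act_one := by rintro n ⟨x⟩; exact Quot.sound (.act_one x)
  act_mul := by rintro n σ ρ ⟨x⟩; exact Quot.sound (.act_mul σ ρ x)
  one_comp := by rintro n h ⟨x⟩; exact Quot.sound (.one_comp h x)
  comp_one := by rintro n h i ⟨x⟩; exact Quot.sound (.comp_one h i x)
  comp_seq := by
    rintro m n l r s t h₁ h₂ h₃ h₄ i j ⟨x⟩ ⟨y⟩ ⟨z⟩
    exact Quot.sound (.comp_seq h₁ h₂ h₃ h₄ i j x y z)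
  comp_par := by
    rintro m n l r s t h₁ h₂ h₃ h₄ i j hij ⟨x⟩ ⟨y⟩ ⟨z⟩
    simp only [mul_zero, Int.negOnePow_zero, one_smul]
    exact Quot.sound (.comp_par h₁ h₂ h₃ h₄ i j hij x y z)
  comp_act := by
    rintro m n r h i σ ρ π hπ ⟨x⟩ ⟨y⟩
    exact Quot.sound (.comp_act h i σ ρ π hπ x y)

/-- The inclusion of the generators. -/
def freeGen : E →ₗ[k] (freeOperad τ).obj 2 where
  toFun e := Quot.mk _ (.gen e)
  map_add' e e' := Quot.sound (.gen_add e e')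
  map_smul' c e := Quot.sound (.gen_smul c e)

/-- The identification of `E ⊗ E ⊕ E ⊗ E ⊕ E ⊗ E` with `Γ(E)(3)`: the summand `u` is sent to the
`u`-th cyclic rotation of the composites `e ∘_1 e'`. -/
def freeThree : (Fin 3 → E ⊗[k] E) →ₗ[k] (freeOperad τ).obj 3 :=
  ∑ u : Fin 3, (freeOperad τ).act ((finRotate 3) ^ (u : ℕ)) ∘ₗ
    TensorProduct.lift (((freeOperad τ).comp (m := 2) (n := 2) (r := 3) rfl 0).compl₁₂
      (freeGen τ) (freeGen τ)) ∘ₗ LinearMap.proj u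

end Free

/-! ### Hadamard products and suspensions -/

/-- The Hadamard product `P ⊗ Q` of operads. -/
def hadamard (P Q : Operad₀ k) : Operad₀ k where
  obj n := P.obj n ⊗[k] Q.obj n
  one := P.one ⊗ₜ Q.one
  act σ := TensorProduct.map (P.act σ) (Q.act σ)
  comp h i := TensorProduct.map₂ (P.comp h i) (Q.comp h i)
  act_one f := by
    induction f with
    | zero => simp
    | add f g hf hg => rw [map_add, hf, hg]
    | tmul p q => simp [P.act_one, Q.act_one]
  act_mul σ τ f := by
    induction f with
    | zero => simp
    | add f g hf hg => simp only [map_add, hf, hg]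
    | tmul p q => simp [P.act_mul, Q.act_mul]
  one_comp h f := by
    induction f with
    | zero => simp
    | add f g hf hg => rw [map_add, hf, hg]
    | tmul p q => simp [P.one_comp, Q.one_comp]
  comp_one h i f := by
    induction f with
    | zero => simp
    | add f g hf hg => rw [LinearMap.map_add₂, hf, hg]
    | tmul p q => simp [P.comp_one, Q.comp_one]
  comp_seq h₁ h₂ h₃ h₄ i j f g g' := by
    induction f with
    | zero => simp
    | add f f' hf hf' => simp only [map_add, LinearMap.add_apply, hf, hf']
    | tmul p q =>
      induction g with
      | zero => simp
      | add g f' hf hf' => simp only [map_add, LinearMap.add_apply, hf, hf']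
      | tmul p' q' =>
        induction g' with
        | zero => simp
        | add g f' hf hf' => simp only [map_add, hf, hf']
        | tmul p'' q'' =>
          simp only [TensorProduct.map₂_apply_tmul, TensorProduct.map_tmul, P.comp_seq h₁ h₂ h₃ h₄ i j,
            Q.comp_seq h₁ h₂ h₃ h₄ i j]
  comp_par h₁ h₂ h₃ h₄ i j hij f g g' := by
    have hP := P.comp_par h₁ h₂ h₃ h₄ i j hij
    have hQ := Q.comp_par h₁ h₂ h₃ h₄ i j hij
    simp only [mul_zero, Int.negOnePow_zero, one_smul] at hP hQ ⊢
    induction f with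
    | zero => simp
    | add f f' hf hf' => simp only [map_add, LinearMap.add_apply, hf, hf']
    | tmul p q =>
      induction g with
      | zero => simp
      | add g f' hf hf' => simp only [map_add, LinearMap.add_apply, hf, hf']
      | tmul p' q' =>
        induction g' with
        | zero => simp
        | add g f' hf hf' => simp only [map_add, LinearMap.add_apply, hf, hf']
        | tmul p'' q'' => simp only [TensorProduct.map₂_apply_tmul, TensorProduct.map_tmul, hP, hQ]
  comp_act h i σ τ ρ hρ f g := by
    induction f with
    | zero => simp
    | add f f' hf hf' => simp only [map_add, LinearMap.add_apply, hf, hf']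
    | tmul p q =>
      induction g with
      | zero => simp
      | add g f' hf hf' => simp only [map_add, hf, hf']
      | tmul p' q' =>
        simp only [TensorProduct.map₂_apply_tmul, TensorProduct.map_tmul,
          P.comp_act h i σ τ ρ hρ, Q.comp_act h i σ τ ρ hρ]

theorem negOnePow_smul_map {V W : Type u} [AddCommGroup V] [Module k V] [AddCommGroup W]
    [Module k W] (s : ℤˣ) (f : V →ₗ[k] W) (v : V) : f (s • v) = s • f v := by
  rcases Int.units_eq_one_or s with rfl | rfl <;> simp

theorem sign_smul_eq {V : Type u} [AddCommGroup V] {a b : ℤ} (h : Even (a - b)) (v : V) :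
    a.negOnePow • v = b.negOnePow • v := by
  rw [(Int.negOnePow_eq_iff a b).2 h]

/-- The operadic suspension: the arity `n` component is placed in degree `n - 1` and tensored with
the signum representation. -/
def susp (P : Operad₀ k) : Operad k (fun n => (n : ℤ) - 1) where
  obj := P.obj
  one := P.one
  act σ := Equiv.Perm.sign σ • P.act σ
  comp {m n r} h i := ((i : ℤ) * ((n : ℤ) - 1)).negOnePow • P.comp h i
  act_one f := by simp [P.act_one]
  act_mul σ τ f := by
    simp only [LinearMap.smul_apply, P.act_mul, map_mul, negOnePow_smul_map, smul_smul]
    rw [mul_comm]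
  one_comp h f := by simp [P.one_comp]
  comp_one h i f := by simp [P.comp_one]
  comp_seq {m n l r s t} h₁ h₂ h₃ h₄ i j f g g' := by
    simp only [LinearMap.smul_apply, negOnePow_smul_map, smul_smul,
      P.comp_seq h₁ h₂ h₃ h₄ i j, ← Int.negOnePow_add]
    refine sign_smul_eq ?_ _
    have h3 : (s : ℤ) = n + l - 1 := by omega
    have h5 : ((inBlk h₁ i j : Fin r) : ℤ) = i + j := by simp [inBlk]
    rw [h3, h5]
    ring_nf
    simp
  comp_par {m n l r s t} h₁ h₂ h₃ h₄ i j hij f g g' := by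
    have hP := P.comp_par h₁ h₂ h₃ h₄ i j hij
    simp only [mul_zero, Int.negOnePow_zero, one_smul] at hP
    simp only [LinearMap.smul_apply, negOnePow_smul_map, smul_smul, hP, ← Int.negOnePow_add]
    refine sign_smul_eq ?_ _
    have h5 : ((outBlk h₁ i j hij.ne' : Fin r) : ℤ) = j + n - 1 := by
      have : ¬ j < i := not_lt.2 hij.le
      have h0 : (i : ℕ) < j := hij
      simp only [outBlk, this, dite_false]
      omega
    have h6 : ((outBlk h₃ j i hij.ne : Fin s) : ℤ) = i := by simp [outBlk, hij]
    rw [h5, h6]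
    ring_nf
    simp
  comp_act {m n r} h i σ τ ρ hρ f g := by
    simp only [LinearMap.smul_apply, negOnePow_smul_map, smul_smul, P.comp_act h i σ τ ρ hρ]
    congr 1
    rw [sign_block hρ]
    have e : ∀ a : ℕ, ((-1 : ℤˣ)) ^ a = ((a : ℤ)).negOnePow := fun a => by
      rw [Int.negOnePow_def, zpow_natCast]
    have e' : (((i : ℤ) * ((n : ℤ) - 1)).negOnePow) =
        ((((i : ℕ) + (σ i : ℕ)) * (n + 1) : ℕ) : ℤ).negOnePow *
          (((σ i : ℕ) : ℤ) * ((n : ℤ) - 1)).negOnePow := by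
      rw [← Int.negOnePow_add, Int.negOnePow_eq_iff]
      push_cast
      ring_nf
      exact ⟨-((i : ℕ) : ℤ) - ((σ i : ℕ) : ℤ) * n, by ring⟩
    rw [e, e']
    ac_rfl

/-! ### Endomorphism operads -/

section End

variable {A : Type u}

/-- The arguments fed to `f` in `f ∘_i g`, given the value `b` of `g`. -/
def insertArg {m n r : ℕ} (h : r + 1 = m + n) (i : Fin m) (b : A) (x : Fin r → A) : Fin m → A :=
  fun y => if hy : y = i then b else x (outBlk h i y hy)

theorem insertArg_self {m n r : ℕ} (h : r + 1 = m + n) (i : Fin m) (b : A) (x : Fin r → A) :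
    insertArg h i b x i = b := by simp [insertArg]

theorem insertArg_ne {m n r : ℕ} (h : r + 1 = m + n) (i : Fin m) (b : A) (x : Fin r → A)
    (y : Fin m) (hy : y ≠ i) : insertArg h i b x y = x (outBlk h i y hy) := by simp [insertArg, hy]

theorem inBlk_ne_outBlk {m n r : ℕ} (h : r + 1 = m + n) (i : Fin m) (z : Fin n) (y : Fin m)
    (hy : y ≠ i) : inBlk h i z ≠ outBlk h i y hy := by
  intro h'
  have h1 := congrArg Fin.val h'
  have h0 : (y : ℕ) ≠ i := fun h' => hy (Fin.ext h')
  simp only [inBlk, outBlk, Fin.lt_def] at h1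
  split_ifs at h1 <;> simp at h1 <;> omega

theorem inBlk_injective {m n r : ℕ} (h : r + 1 = m + n) (i : Fin m) :
    Function.Injective (inBlk h i) := by
  intro z z' hz
  have := congrArg Fin.val hz
  simp only [inBlk] at this
  exact Fin.ext (by omega)

theorem outBlk_injective {m n r : ℕ} (h : r + 1 = m + n) (i y y' : Fin m) (hy : y ≠ i)
    (hy' : y' ≠ i) (he : outBlk h i y hy = outBlk h i y' hy') : y = y' := by
  have h1 := congrArg Fin.val he
  have h0 : (y : ℕ) ≠ i := fun h' => hy (Fin.ext h')
  have h2 : (y' : ℕ) ≠ i := fun h' => hy' (Fin.ext h')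
  simp only [outBlk, Fin.lt_def] at h1
  split_ifs at h1 <;> simp at h1 <;> exact Fin.ext (by omega)

theorem insertArg_update_in {m n r : ℕ} (h : r + 1 = m + n) (i : Fin m) (b : A) (x : Fin r → A)
    (z : Fin n) (a : A) :
    insertArg h i b (Function.update x (inBlk h i z) a) = insertArg h i b x := by
  funext y
  by_cases hy : y = i
  · simp [insertArg, hy]
  · simp [insertArg, hy, (inBlk_ne_outBlk h i z y hy).symm]

theorem insertArg_update_out {m n r : ℕ} (h : r + 1 = m + n) (i : Fin m) (b : A) (x : Fin r → A)
    (y : Fin m) (hy : y ≠ i) (a : A) :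
    insertArg h i b (Function.update x (outBlk h i y hy) a) =
      Function.update (insertArg h i b x) y a := by
  funext y'
  by_cases hy' : y' = i
  · subst hy'; simp [insertArg, hy.symm]
  · by_cases hyy : y' = y
    · subst hyy; simp [insertArg, hy']
    · have : outBlk h i y' hy' ≠ outBlk h i y hy := fun he => hyy (outBlk_injective h i _ _ _ _ he)
      simp [insertArg, hy', hyy, this]

theorem insertArg_eq_update {m n r : ℕ} (h : r + 1 = m + n) (i : Fin m) (b c : A) (x : Fin r → A) :
    insertArg h i b x = Function.update (insertArg h i c x) i b := by
  funext y
  by_cases hy : y = i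
  · subst hy; simp [insertArg]
  · simp [insertArg, hy]

theorem inArg_update_in {m n r : ℕ} (h : r + 1 = m + n) (i : Fin m) (x : Fin r → A)
    (z : Fin n) (a : A) :
    (fun w => Function.update x (inBlk h i z) a (inBlk h i w)) =
      Function.update (fun w => x (inBlk h i w)) z a := by
  funext w
  by_cases hw : w = z
  · subst hw; simp
  · simp [hw, (inBlk_injective h i).ne hw]

theorem inArg_update_out {m n r : ℕ} (h : r + 1 = m + n) (i : Fin m) (x : Fin r → A)
    (y : Fin m) (hy : y ≠ i) (a : A) :
    (fun w => Function.update x (outBlk h i y hy) a (inBlk h i w)) = fun w => x (inBlk h i w) := by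
  funext w
  simp [inBlk_ne_outBlk h i w y hy]

variable [AddCommGroup A] [Module k A]

/-- The partial composition `f ∘_i g` of multilinear maps. -/
def endComp {m n r : ℕ} (h : r + 1 = m + n) (i : Fin m)
    (f : MultilinearMap k (fun _ : Fin m => A) A) (g : MultilinearMap k (fun _ : Fin n => A) A) :
    MultilinearMap k (fun _ : Fin r => A) A where
  toFun x := f (insertArg h i (g fun z => x (inBlk h i z)) x)
  map_update_add' {dec} x p a b := by
    rw [Subsingleton.elim dec (instDecidableEqFin r)]
    rcases in_or_out h i p with ⟨z, rfl⟩ | ⟨y, hy, rfl⟩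
    · simp only [inArg_update_in, insertArg_update_in, g.map_update_add]
      rw [insertArg_eq_update h i _ 0 x, f.map_update_add, ← insertArg_eq_update,
        ← insertArg_eq_update]
    · simp only [inArg_update_out, insertArg_update_out, f.map_update_add]
  map_update_smul' {dec} x p c a := by
    rw [Subsingleton.elim dec (instDecidableEqFin r)]
    rcases in_or_out h i p with ⟨z, rfl⟩ | ⟨y, hy, rfl⟩
    · simp only [inArg_update_in, insertArg_update_in, g.map_update_smul]
      rw [insertArg_eq_update h i _ 0 x, f.map_update_smul, ← insertArg_eq_update]
    · simp only [inArg_update_out, insertArg_update_out, f.map_update_smul]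

variable (k A) in
/-- The endomorphism operad of a vector space. -/
def endOperad : Operad₀ k where
  obj n := MultilinearMap k (fun _ : Fin n => A) A
  one := MultilinearMap.ofSubsingleton k A A (0 : Fin 1) LinearMap.id
  act σ := (MultilinearMap.domDomCongrLinearEquiv k k A A σ⁻¹).toLinearMap
  comp h i := LinearMap.mk₂ k (endComp h i)
    (fun f f' g => by ext x; simp [endComp])
    (fun c f g => by ext x; simp [endComp])
    (fun f g g' => by
      ext x
      simp only [endComp, MultilinearMap.coe_mk, add_apply]
      rw [insertArg_eq_update h i _ 0 x, f.map_update_add, ← insertArg_eq_update,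
        ← insertArg_eq_update])
    (fun c f g => by
      ext x
      simp only [endComp, MultilinearMap.coe_mk, smul_apply]
      rw [insertArg_eq_update h i _ 0 x, f.map_update_smul, ← insertArg_eq_update])
  act_one f := by ext x; simp
  act_mul σ τ f := by ext x; simp
  one_comp h f := by
    ext x
    simp only [LinearMap.mk₂_apply, endComp, MultilinearMap.coe_mk,
      MultilinearMap.ofSubsingleton_apply_apply, LinearMap.id_apply, insertArg_self]
    congr 1
    funext z
    exact congrArg x (Fin.ext (by simp [inBlk_val]))
  comp_one h i f := by
    ext x
    simp only [LinearMap.mk₂_apply, endComp, MultilinearMap.coe_mk,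
      MultilinearMap.ofSubsingleton_apply_apply, LinearMap.id_apply]
    congr 1
    funext y
    by_cases hy : y = i
    · subst hy; rw [insertArg_self]; rfl
    · rw [insertArg_ne _ _ _ _ _ hy]
      refine congrArg x (Fin.ext ?_)
      rw [outBlk_val]
      split_ifs <;> simp
  comp_seq {m n l r s t} h₁ h₂ h₃ h₄ i j f g g' := by
    ext x
    simp only [LinearMap.mk₂_apply, endComp, MultilinearMap.coe_mk]
    have pin : ∀ z : Fin l, inBlk h₂ (inBlk h₁ i j) z = inBlk h₄ i (inBlk h₃ j z) := by
      intro z; apply Fin.ext; simp [inBlk_val, add_assoc]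
    have pmid : ∀ (z : Fin n) (hz : z ≠ j) (hz' : inBlk h₁ i z ≠ inBlk h₁ i j),
        outBlk h₂ (inBlk h₁ i j) (inBlk h₁ i z) hz' = inBlk h₄ i (outBlk h₃ j z hz) := by
      intro z hz hz'
      have h0 : (z : ℕ) ≠ j := fun h' => hz (Fin.ext h')
      apply Fin.ext
      by_cases hlt : (z : ℕ) < j
      · simp only [inBlk_val, outBlk_val, add_lt_add_iff_left, if_pos hlt]
      · simp only [inBlk_val, outBlk_val, add_lt_add_iff_left, if_neg hlt]
        omega
    have pout : ∀ (y : Fin m) (hy : y ≠ i) (hy' : outBlk h₁ i y hy ≠ inBlk h₁ i j),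
        outBlk h₂ (inBlk h₁ i j) (outBlk h₁ i y hy) hy' = outBlk h₄ i y hy := by
      intro y hy hy'
      have h0 : (y : ℕ) ≠ i := fun h' => hy (Fin.ext h')
      apply Fin.ext
      simp only [inBlk_val, outBlk_val]
      split_ifs <;> omega
    congr 1
    funext y
    by_cases hy : y = i
    · subst hy
      simp only [insertArg_self]
      congr 1
      funext z
      by_cases hz : z = j
      · subst hz
        simp only [insertArg_self]
        congr 1
        funext w
        exact congrArg x (pin w)
      · have hz' : inBlk h₁ y z ≠ inBlk h₁ y j := (inBlk_injective h₁ y).ne hz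
        rw [insertArg_ne _ _ _ _ _ hz, insertArg_ne _ _ _ _ _ hz']
        exact congrArg x (pmid z hz hz')
    · have hy' : outBlk h₁ i y hy ≠ inBlk h₁ i j := (inBlk_ne_outBlk h₁ i j y hy).symm
      rw [insertArg_ne _ _ _ _ _ hy, insertArg_ne _ _ _ _ _ hy, insertArg_ne _ _ _ _ _ hy']
      exact congrArg x (pout y hy hy')
  comp_par {m n l r s t} h₁ h₂ h₃ h₄ i j hij f g g' := by
    ext x
    have hij' : (i : ℕ) < j := hij
    simp only [mul_zero, Int.negOnePow_zero, one_smul, LinearMap.mk₂_apply, endComp,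
      MultilinearMap.coe_mk]
    have p1 : ∀ z : Fin n, inBlk h₁ i z ≠ outBlk h₁ i j hij.ne' := fun z => inBlk_ne_outBlk _ _ _ _ _
    have p2 : ∀ z : Fin l, inBlk h₃ j z ≠ outBlk h₃ j i hij.ne := fun z => inBlk_ne_outBlk _ _ _ _ _
    have p3 : ∀ z : Fin n, outBlk h₂ (outBlk h₁ i j hij.ne') (inBlk h₁ i z) (p1 z) =
        inBlk h₄ (outBlk h₃ j i hij.ne) z := by
      intro z
      apply Fin.ext
      simp only [inBlk_val, outBlk_val]
      split_ifs <;> omega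
    have p4 : ∀ z : Fin l, outBlk h₄ (outBlk h₃ j i hij.ne) (inBlk h₃ j z) (p2 z) =
        inBlk h₂ (outBlk h₁ i j hij.ne') z := by
      intro z
      apply Fin.ext
      simp only [inBlk_val, outBlk_val]
      split_ifs <;> omega
    have p5 : ∀ (y : Fin m) (hi : y ≠ i) (hj : y ≠ j)
        (h5 : outBlk h₁ i y hi ≠ outBlk h₁ i j hij.ne')
        (h6 : outBlk h₃ j y hj ≠ outBlk h₃ j i hij.ne),
        outBlk h₂ (outBlk h₁ i j hij.ne') (outBlk h₁ i y hi) h5 =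
          outBlk h₄ (outBlk h₃ j i hij.ne) (outBlk h₃ j y hj) h6 := by
      intro y hi hj h5 h6
      have h0 : (y : ℕ) ≠ i := fun h' => hi (Fin.ext h')
      have h0' : (y : ℕ) ≠ j := fun h' => hj (Fin.ext h')
      apply Fin.ext
      simp only [outBlk_val]
      split_ifs <;> omega
    congr 1
    funext y
    by_cases hi : y = i
    · subst hi
      rw [insertArg_self, insertArg_ne _ _ _ _ _ hij.ne, insertArg_self]
      congr 1
      funext z
      rw [insertArg_ne _ _ _ _ _ (p1 z)]
      exact congrArg x (p3 z)
    · by_cases hj : y = j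
      · subst hj
        rw [insertArg_self, insertArg_ne _ _ _ _ _ hij.ne', insertArg_self]
        congr 1
        funext z
        rw [insertArg_ne _ _ _ _ _ (p2 z)]
        exact congrArg x (p4 z).symm
      · have h5 : outBlk h₁ i y hi ≠ outBlk h₁ i j hij.ne' :=
          fun he => hj (outBlk_injective _ _ _ _ _ _ he)
        have h6 : outBlk h₃ j y hj ≠ outBlk h₃ j i hij.ne :=
          fun he => hi (outBlk_injective _ _ _ _ _ _ he)
        rw [insertArg_ne _ _ _ _ _ hi, insertArg_ne _ _ _ _ _ hj, insertArg_ne _ _ _ _ _ h5,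
          insertArg_ne _ _ _ _ _ h6]
        exact congrArg x (p5 y hi hj h5 h6)
  comp_act {m n r} h i σ τ ρ hρ f g := by
    ext x
    change f (fun y => insertArg h i (g fun z => x (inBlk h i (τ⁻¹ z))) x (σ⁻¹ y)) =
      f (insertArg h (σ i) (g fun z => x (ρ⁻¹ (inBlk h (σ i) z))) fun p => x (ρ⁻¹ p))
    congr 1
    funext y
    obtain ⟨w, rfl⟩ := σ.surjective y
    rw [show σ⁻¹ (σ w) = w from σ.symm_apply_apply w]
    by_cases hw : w = i
    · subst hw
      rw [insertArg_self, insertArg_self]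
      congr 1
      funext z
      obtain ⟨v, rfl⟩ := τ.surjective z
      rw [← hρ.1]
      exact congrArg x ((congrArg (inBlk h w) (τ.symm_apply_apply v)).trans
        (ρ.symm_apply_apply _).symm)
    · rw [insertArg_ne _ _ _ _ _ hw, insertArg_ne _ _ _ _ _ (σ.injective.ne hw), ← hρ.2 w hw]
      exact congrArg x (ρ.symm_apply_apply _).symm

end End

/-! ### Quadratic operads and their duals -/

/-- Quadratic data: a finite dimensional `Σ₂`-module `E`, the transposition acting by `τ`, together
with a `Σ₃`-submodule `R` of `Γ(E)(3) ≅ E ⊗ E ⊕ E ⊗ E ⊕ E ⊗ E` (stability is required under the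
cyclic rotation and under the transposition of the first two inputs, which generate `Σ₃`). -/
structure QuadraticData (k : Type u) [Field k] where
  E : Type u
  [addCommGroup : AddCommGroup E]
  [module : Module k E]
  [finite : Module.Finite k E]
  τ : E →ₗ[k] E
  τ_τ : ∀ e, τ (τ e) = e
  R : Submodule k (Fin 3 → E ⊗[k] E)
  rot_mem : ∀ t ∈ R, (fun u => t (u + 1)) ∈ R
  swap_mem : ∀ t ∈ R, (fun u => LinearMap.lTensor E τ (t (-u))) ∈ R

attribute [instance] QuadraticData.addCommGroup QuadraticData.module QuadraticData.finite

namespace QuadraticData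

variable (D : QuadraticData k)

/-- The relations, in arity three of the free operad. -/
def relations : ∀ n, Set ((freeOperad D.τ).obj n)
  | 3 => freeThree D.τ '' D.R
  | _ => ∅

/-- The quadratic operad `P = Γ(E)/(R)`. -/
def operad : Operad₀ k := (freeOperad D.τ).quot D.relations

/-- The generators `E → P(2)`. -/
def gen : D.E →ₗ[k] D.operad.obj 2 := ((freeOperad D.τ).ideal D.relations 2).mkQ ∘ₗ freeGen D.τ

/-- The pairing of `Γ(E^∨)(3)` with `Γ(E)(3)`. -/
def pairing (s : Fin 3 → Module.Dual k D.E ⊗[k] Module.Dual k D.E) (t : Fin 3 → D.E ⊗[k] D.E) : k :=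
  ∑ u, TensorProduct.dualDistrib k D.E D.E (s u) (t u)

/-- The quadratic data of the quadratic dual operad `P^! = Γ(E^∨)/(R^⊥)`, `E^∨ = E^# ⊗ sgn₂`. -/
def dual : QuadraticData k where
  E := Module.Dual k D.E
  τ := -(D.τ.dualMap)
  τ_τ e := by ext x; simp [D.τ_τ]
  R :=
    { carrier := {s | ∀ t ∈ D.R, D.pairing s t = 0}
      zero_mem' := fun t _ => by simp [pairing]
      add_mem' := fun {s s'} hs hs' t ht => by
        have h1 := hs t ht
        have h2 := hs' t ht
        simp only [pairing] at h1 h2 ⊢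
        simp [Finset.sum_add_distrib, h1, h2]
      smul_mem' := fun c s hs t ht => by
        have h1 := hs t ht
        simp only [pairing] at h1 ⊢
        simp [← Finset.mul_sum, h1] }
  rot_mem s hs t ht := by
    have h := hs _ (D.rot_mem _ (D.rot_mem _ ht))
    rw [← h]
    simp only [pairing, Fin.sum_univ_three, show (0 : Fin 3) + 1 = 1 from rfl,
      show (1 : Fin 3) + 1 = 2 from rfl, show (2 : Fin 3) + 1 = 0 from rfl]
    ring
  swap_mem s hs t ht := by
    have h := hs _ (D.swap_mem _ ht)
    have key : ∀ (a : Module.Dual k D.E ⊗[k] Module.Dual k D.E) (b : D.E ⊗[k] D.E),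
        TensorProduct.dualDistrib k D.E D.E (LinearMap.lTensor _ (-(D.τ.dualMap)) a) b =
          -TensorProduct.dualDistrib k D.E D.E a (LinearMap.lTensor _ D.τ b) := by
      intro a b
      induction a with
      | zero => simp
      | add a a' ha ha' => simp only [map_add, LinearMap.add_apply, ha, ha', neg_add]
      | tmul φ ψ =>
        induction b with
        | zero => simp
        | add b b' hb hb' => simp only [map_add, hb, hb', neg_add]
        | tmul e e' => rw [LinearMap.lTensor_tmul]; simp
    simp only [pairing, key] at h ⊢
    simp only [Fin.sum_univ_three, show -(0 : Fin 3) = 0 from rfl, show -(1 : Fin 3) = 2 from rfl,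
      show -(2 : Fin 3) = 1 from rfl] at h ⊢
    linear_combination -h

/-- The operad `𝔰(P ⊗ P^!)`. -/
def suspHadamard : Operad k (fun n => (n : ℤ) - 1) := susp (hadamard D.operad D.dual.operad)

/-- The canonical element: the image of the identity under
`Lin(E, E) ≅ E^# ⊗ E ≅ E ⊗ E^∨ → P(2) ⊗ P^!(2)`. -/
noncomputable def canonical : D.suspHadamard.obj 2 :=
  TensorProduct.map D.gen D.dual.gen
    (TensorProduct.comm k (Module.Dual k D.E) D.E
      ((dualTensorHomEquiv k D.E D.E).symm LinearMap.id))

end QuadraticData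

variable (k) in
/-- The quadratic data of `Lie`: one antisymmetric operation `λ` with
`λ ∘_1 λ + (λ ∘_1 λ) c + (λ ∘_1 λ) c² = 0`, where `c` is the cyclic rotation. -/
def lieData : QuadraticData k where
  E := k
  τ := -LinearMap.id
  τ_τ e := by simp
  R := Submodule.span k {fun _ => 1 ⊗ₜ 1}
  rot_mem t ht := by
    obtain ⟨c, rfl⟩ := Submodule.mem_span_singleton.1 ht
    exact Submodule.mem_span_singleton.2 ⟨c, rfl⟩
  swap_mem t ht := by
    obtain ⟨c, rfl⟩ := Submodule.mem_span_singleton.1 ht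
    refine Submodule.mem_span_singleton.2 ⟨-c, ?_⟩
    funext u
    simp

variable (k) in
/-- The suspension `𝔰Lie` (also written `ΛLie`). -/
def suspLie : Operad k (fun n => (n : ℤ) - 1) := susp (lieData k).operad

variable (k) in
/-- The suspended Lie bracket `𝔰λ ∈ 𝔰Lie(2)`. -/
def suspBracket : (suspLie k).obj 2 := (lieData k).gen (1 : k)

/-! ### Full compositions and invariants -/

/-- `a 0 + ⋯ + a (j - 1)`. -/
def partialSum {n : ℕ} (a : Fin n → ℕ) : ℕ → ℕ
  | 0 => 0
  | j + 1 => partialSum a j + if h : j < n then a ⟨j, h⟩ else 0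

/-- The total arity `a 0 + ⋯ + a (n - 1)`. -/
def totalArity {n : ℕ} (a : Fin n → ℕ) : ℕ := (n - n) + partialSum a n

/-- The element `t(f 0, …, f (j - 1), 1, …, 1)`. -/
def Operad.partialComp (O : Operad k deg) {n : ℕ} (a : Fin n → ℕ) (t : O.obj n)
    (f : ∀ i, O.obj (a i)) : ∀ j, j ≤ n → O.obj ((n - j) + partialSum a j)
  | 0, _ => t
  | j + 1, hj =>
    O.comp (m := (n - j) + partialSum a j) (n := a ⟨j, hj⟩)
      (by simp only [partialSum, dif_pos (show j < n from hj)]; omega)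
      ⟨partialSum a j, by omega⟩ (O.partialComp a t f j (by omega)) (f ⟨j, hj⟩)

theorem Operad.partialComp_congr (O : Operad k deg) {n : ℕ} (a : Fin n → ℕ) (t : O.obj n)
    (f f' : ∀ i, O.obj (a i)) : ∀ (j : ℕ) (hj : j ≤ n), (∀ i : Fin n, (i : ℕ) < j → f i = f' i) →
      O.partialComp a t f j hj = O.partialComp a t f' j hj
  | 0, _, _ => rfl
  | j + 1, hj, h => by
    rw [partialComp, partialComp, partialComp_congr O a t f f' j (by omega)
      (fun i hi => h i (by omega)), h ⟨j, hj⟩ (by simp)]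

theorem Operad.partialComp_add (O : Operad k deg) {n : ℕ} (a : Fin n → ℕ) (t : O.obj n)
    (f : ∀ i, O.obj (a i)) (p : Fin n) (x y : O.obj (a p)) : ∀ (j : ℕ) (hj : j ≤ n), (p : ℕ) < j →
      O.partialComp a t (Function.update f p (x + y)) j hj =
        O.partialComp a t (Function.update f p x) j hj +
          O.partialComp a t (Function.update f p y) j hj
  | 0, _, h => by omega
  | j + 1, hj, h => by
    simp only [partialComp]
    by_cases hp : (p : ℕ) = j
    · have hc : ∀ v w, O.partialComp a t (Function.update f p v) j (by omega) =
          O.partialComp a t (Function.update f p w) j (by omega) := fun v w =>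
        O.partialComp_congr a t _ _ j _ fun i hi => by
          have : i ≠ p := fun h' => by rw [h'] at hi; omega
          simp [this]
      obtain rfl : p = ⟨j, hj⟩ := Fin.ext hp
      rw [hc (x + y) 0, hc x 0, hc y 0]
      simp
    · have hne : (⟨j, hj⟩ : Fin n) ≠ p := fun h' => hp (by rw [← h'])
      rw [partialComp_add O a t f p x y j (by omega) (by omega)]
      simp [hne]

theorem Operad.partialComp_smul (O : Operad k deg) {n : ℕ} (a : Fin n → ℕ) (t : O.obj n)
    (f : ∀ i, O.obj (a i)) (p : Fin n) (c : k) (x : O.obj (a p)) :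
    ∀ (j : ℕ) (hj : j ≤ n), (p : ℕ) < j →
      O.partialComp a t (Function.update f p (c • x)) j hj =
        c • O.partialComp a t (Function.update f p x) j hj
  | 0, _, h => by omega
  | j + 1, hj, h => by
    simp only [partialComp]
    by_cases hp : (p : ℕ) = j
    · have hc : ∀ v w, O.partialComp a t (Function.update f p v) j (by omega) =
          O.partialComp a t (Function.update f p w) j (by omega) := fun v w =>
        O.partialComp_congr a t _ _ j _ fun i hi => by
          have : i ≠ p := fun h' => by rw [h'] at hi; omega
          simp [this]
      obtain rfl : p = ⟨j, hj⟩ := Fin.ext hp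
      rw [hc (c • x) 0, hc x 0]
      simp
    · have hne : (⟨j, hj⟩ : Fin n) ≠ p := fun h' => hp (by rw [← h'])
      rw [partialComp_smul O a t f p c x j (by omega) (by omega)]
      simp [hne]

/-- The full operadic composition `(f 0, …, f (n - 1)) ↦ t(f 0, …, f (n - 1))`. -/
def Operad.fullComp (O : Operad k deg) {n : ℕ} (a : Fin n → ℕ) (t : O.obj n) :
    MultilinearMap k (fun i => O.obj (a i)) (O.obj (totalArity a)) where
  toFun f := O.partialComp a t f n le_rfl
  map_update_add' {dec} f p x y := by
    rw [Subsingleton.elim dec (instDecidableEqFin n)]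
    exact O.partialComp_add a t f p x y n le_rfl p.2
  map_update_smul' {dec} f p c x := by
    rw [Subsingleton.elim dec (instDecidableEqFin n)]
    exact O.partialComp_smul a t f p c x n le_rfl p.2

/-- The invariants `O(n)^{Σ_n}`. -/
def Operad.invariants (O : Operad k deg) (n : ℕ) : Submodule k (O.obj n) where
  carrier := {f | ∀ σ, O.act σ f = f}
  zero_mem' σ := map_zero _
  add_mem' hf hg σ := by rw [map_add, hf σ, hg σ]
  smul_mem' c f hf σ := by rw [map_smul, hf σ]

/-- The averaging map `O(n) → O(n)^{Σ_n}`. -/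
def Operad.aver (O : Operad k deg) (n : ℕ) : O.obj n →ₗ[k] O.invariants n :=
  LinearMap.codRestrict (O.invariants n)
    (((n.factorial : k)⁻¹) • ∑ σ : Equiv.Perm (Fin n), O.act σ)
    (fun f τ => by
      simp only [LinearMap.smul_apply, LinearMap.sum_apply, map_smul, map_sum, ← O.act_mul]
      congr 1
      exact Fintype.sum_equiv (Equiv.mulRight τ) _ _ fun σ => rfl)

/-! ### The cochain complex and natural operations -/

namespace QuadraticData

variable (D : QuadraticData k)

/-- Algebras over the operad `P` of `D`: a vector space `A` with a morphism `α : P → End_A`. -/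
structure Alg where
  A : Type u
  [addCommGroup : AddCommGroup A]
  [module : Module k A]
  α : OperadHom D.operad (endOperad k A)

attribute [instance] Alg.addCommGroup Alg.module

variable {D}

namespace Alg

variable (X : D.Alg)

/-- The multilinear map `α(p)`. -/
def op {b : ℕ} (p : D.operad.obj b) : MultilinearMap k (fun _ : Fin b => X.A) X.A := X.α.map b p

/-- The operad `𝔰(End_A ⊗ P^!)`. Its arity `a` component is
`Lin(A^{⊗ a}, A) ⊗ P^!(a) ⊗ sgn_a ≅ Lin((↓A)^{⊗ a}, ↓A) ⊗ P^!(a)`, placed in degree `a - 1`. -/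
def convOperad : Operad k (fun n => (n : ℤ) - 1) :=
  susp (hadamard (endOperad k X.A) D.dual.operad)

/-- The morphism `𝔰(α ⊗ id)`, in arity `n`. -/
def structureMap (n : ℕ) : D.suspHadamard.obj n →ₗ[k] X.convOperad.obj n :=
  TensorProduct.map (X.α.map n) LinearMap.id

/-- The component `C_P^{a-1}(A;A) = [Lin((↓A)^{⊗ a}, ↓A) ⊗ P^!(a)]^{Σ_a}` of the operadic cochain
complex. (Arity `a = 0` is included for convenience; `P^!(0) = 0`.) -/
abbrev Cochain (a : ℕ) : Type u := X.convOperad.invariants a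

/-- The graded vector space `C_P^*(A;A)`, graded by arity; arity `a` has degree `a - 1`. -/
abbrev Complex : Type u := ⨁ a : ℕ, X.Cochain a

/-- The operator `f ↦ (-1)^{|f|} f`. -/
noncomputable def parity : X.Complex →ₗ[k] X.Complex :=
  DirectSum.toModule k ℕ _ fun a => ((a : ℤ) - 1).negOnePow • DirectSum.lof k ℕ (fun a => X.Cochain a) a

/-- The pre-Lie product `f ∘ g = Aver (∑_i f ∘_i g)` of homogeneous cochains. -/
noncomputable def preLieHom (a b : ℕ) : X.Cochain a →ₗ[k] X.Cochain b →ₗ[k] X.Cochain (a + b - 1) :=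
  ((∑ i : Fin a, X.convOperad.comp (r := a + b - 1) (by have := i.pos; omega) i).compr₂
    (X.convOperad.aver (a + b - 1))).compl₁₂ (X.convOperad.invariants a).subtype
    (X.convOperad.invariants b).subtype

/-- The pre-Lie product on `C_P^*(A;A)`. -/
noncomputable def preLie : X.Complex →ₗ[k] X.Complex →ₗ[k] X.Complex :=
  DirectSum.toModule k ℕ _ fun a => LinearMap.flip <|
    DirectSum.toModule k ℕ _ fun b => LinearMap.flip <|
      (X.preLieHom a b).compr₂ (DirectSum.lof k ℕ (fun a => X.Cochain a) (a + b - 1))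

/-- The one-cochain given by the structure operations of the algebra: half of the image of the
canonical element. (For associative algebras this is the multiplication.) -/
noncomputable def structureCochain : X.Complex :=
  DirectSum.lof k ℕ (fun a => X.Cochain a) 2
    ((2 : k)⁻¹ • X.convOperad.aver 2 (X.structureMap 2 D.canonical))

/-- The differential `d_P f = [μ, f] = μ ∘ f - (-1)^{|f|} f ∘ μ`, where `μ` is the structure
cochain and `[-,-]` the intrinsic bracket. -/
noncomputable def d : X.Complex →ₗ[k] X.Complex :=
  X.preLie X.structureCochain - (X.preLie.flip X.structureCochain) ∘ₗ X.parity

end Alg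

variable (D)

/-- Families of `n`-linear operations on `C_P^*(A;A)`, one for each `P`-algebra `A`. -/
abbrev Operation (n : ℕ) : Type (u + 1) :=
  ∀ X : D.Alg, MultilinearMap k (fun _ : Fin n => X.Complex) X.Complex

variable {D}

/-- The differential `δ_P U` of an operation `U` of degree `e`:
`(δ_P U)(f_1, …, f_n) = d_P U(f_1, …, f_n)
  - (-1)^e ∑_i (-1)^{|f_1| + ⋯ + |f_{i-1}|} U(f_1, …, d_P f_i, …, f_n)`. -/
noncomputable def Operation.delta {n : ℕ} (e : ℤ) (U : D.Operation n) : D.Operation n := fun X =>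
  X.d.compMultilinearMap (U X) -
    e.negOnePow • ∑ i : Fin n, (U X).compLinearMap fun j =>
      if j < i then X.parity else if j = i then X.d else LinearMap.id

variable (D)

/-- The cup product operation of `t ∈ 𝔰(P ⊗ P^!)(n)`:
`t(f_1, …, f_n) = Aver (𝔰(α ⊗ id)(t)(f_1, …, f_n))`. -/
noncomputable def cup {n : ℕ} (t : D.suspHadamard.obj n) : D.Operation n := fun X =>
  MultilinearMap.fromDirectSumEquiv (R := k) (κ := fun _ : Fin n => ℕ) fun a : Fin n → ℕ =>
    (DirectSum.lof k ℕ (fun a => X.Cochain a) (totalArity a) ∘ₗ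
      X.convOperad.aver (totalArity a)).compMultilinearMap
      ((X.convOperad.fullComp a (X.structureMap n t)).compLinearMap
        fun i => (X.convOperad.invariants (a i)).subtype)

/-- The pre-Lie product as a binary operation. -/
noncomputable def preLieOperation : D.Operation 2 := fun X =>
  MultilinearMap.mk' (fun f => X.preLie (f 0) (f 1))
    (by
      intro m i x y
      fin_cases i <;> simp)
    (by
      intro m i c x
      fin_cases i <;> simp)

end QuadraticData

/-- Rooted trees whose white vertices are labelled by `i : Fin n` and have arity `a i`, whose black
vertices are at least binary and decorated by elements of `P`, and whose input legs are labelled by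
`Fin N`. The inputs of each vertex are linearly ordered. -/
inductive NatTree (P : ℕ → Type u) {n : ℕ} (a : Fin n → ℕ) (N : ℕ) : Type u
  | leg (l : Fin N) : NatTree P a N
  | white (i : Fin n) (c : Fin (a i) → NatTree P a N) : NatTree P a N
  | black (b : ℕ) (hb : 2 ≤ b) (p : P b) (c : Fin b → NatTree P a N) : NatTree P a N

namespace NatTree

variable {P : ℕ → Type u} {n : ℕ} {a : Fin n → ℕ} {N : ℕ}

/-- The number of input legs labelled `l`. -/
def legCount (l : Fin N) : NatTree P a N → ℕ
  | leg l' => if l' = l then 1 else 0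
  | white _ c => ∑ z, (c z).legCount l
  | black _ _ _ c => ∑ z, (c z).legCount l

/-- The number of white vertices labelled `i`. -/
def whiteCount (i : Fin n) : NatTree P a N → ℕ
  | leg _ => 0
  | white i' c => (if i' = i then 1 else 0) + ∑ z, (c z).whiteCount i
  | black _ _ _ c => ∑ z, (c z).whiteCount i

/-- Each label in `Fin N` occurs on exactly one input leg and each label in `Fin n` occurs on
exactly one white vertex. -/
def IsLinear (T : NatTree P a N) : Prop :=
  (∀ l, T.legCount l = 1) ∧ ∀ i, T.whiteCount i = 1

/-- The composition along the tree, with the white vertices decorated by `φ i` and the black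
vertices by `α p`, evaluated at `x`. -/
def eval {A : Type u} (α : ∀ b, P b → (Fin b → A) → A) (φ : ∀ i, (Fin (a i) → A) → A)
    (x : Fin N → A) : NatTree P a N → A
  | leg l => x l
  | white i c => φ i fun z => (c z).eval α φ x
  | black b _ p c => α b p fun z => (c z).eval α φ x

end NatTree

namespace QuadraticData

variable (D : QuadraticData k)

/-- The natural operations `U_{(T,Φ)}` from cochains of arities `a i` to cochains of arity `N`:
`U(f_1, …, f_n) = Aver (Ũ(f_1, …, f_n))`, where `Ũ` is the multilinear map with
`Ũ(φ_1 ⊗ q_1, …, φ_n ⊗ q_n) = T(φ_1, …, φ_n) ⊗ Φ(q_1, …, q_n)`. -/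
def treeOperations {n : ℕ} (a : Fin n → ℕ) (N : ℕ) :
    Set (∀ X : D.Alg, MultilinearMap k (fun i => X.Cochain (a i)) (X.Cochain N)) :=
  {V | ∃ T : NatTree D.operad.obj a N, T.IsLinear ∧
    ∃ Φ : MultilinearMap k (fun i => D.dual.operad.obj (a i)) (D.dual.operad.obj N),
    ∀ X : D.Alg, ∃ W : MultilinearMap k (fun i => X.convOperad.obj (a i)) (X.convOperad.obj N),
      (∀ (φ : ∀ i, MultilinearMap k (fun _ : Fin (a i) => X.A) X.A)
        (q : ∀ i, D.dual.operad.obj (a i)),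
        ∃ ψ : MultilinearMap k (fun _ : Fin N => X.A) X.A,
          (∀ x, ψ x = T.eval (fun _ p => X.op p) (fun i => φ i) x) ∧
          W (fun i => φ i ⊗ₜ[k] q i) = ψ ⊗ₜ[k] Φ q) ∧
      ∀ f, V X f = X.convOperad.aver N (W fun i => (f i : X.convOperad.obj (a i)))}

/-- The component of an operation from cochains of arities `a i` to cochains of arity `N`. -/
def component {n : ℕ} (a : Fin n → ℕ) (N : ℕ) : D.Operation n →ₗ[k]
    (∀ X : D.Alg, MultilinearMap k (fun i => X.Cochain (a i)) (X.Cochain N)) where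
  toFun U X := (DirectSum.component k ℕ (fun a => X.Cochain a) N).compMultilinearMap
    ((U X).compLinearMap fun i => DirectSum.lof k ℕ (fun a => X.Cochain a) (a i))
  map_add' U U' := by ext; simp
  map_smul' c U := by ext; simp

open scoped Classical in
/-- The space `B_P^e(n)` of natural `n`-linear operations of degree `e`: on cochains of fixed
arities `a i`, hence of degrees `a i - 1`, such an operation takes values in degree
`∑ i, (a i - 1) + e` and is a linear combination of operations `U_{(T,Φ)}`. -/
noncomputable def naturalOperations (n : ℕ) (e : ℤ) : Submodule k (D.Operation n) :=
  ⨅ (a : Fin n → ℕ) (N : ℕ), (if (N : ℤ) - 1 = ∑ i, ((a i : ℤ) - 1) + e then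
    Submodule.span k (D.treeOperations a N) else ⊥).comap (D.component a N)

end QuadraticData

end CohOp

/-!
In characteristic zero the invariants `𝔰(End_A ⊗ P^!)(n)^{Σ_n}` may be replaced by coinvariants:
every cochain is the class `Alg.cls` of an unsymmetrized element, and the pre-Lie product and the cup
products of classes are computed on arbitrary representatives (`Alg.preLie_cls`, `cup_cons_cls`).
In this form all identities reduce to the axioms of a partial composition operad.

*The canonical element.* In `P ⊗ P^!` the three composites in the Jacobi identity of `χ` add up to the
image of the canonical element of `V ⊗ V^#`, where `V = Γ(E)(3)`, and that element vanishes in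
`V/R ⊗ V^#/R^⊥` (`canonical₀_jacobi`). As `χ` is moreover antisymmetric (`canonical₀_swap`), the
universal property of the quadratic operad `Lie` gives the morphism `L` (`lieHom`), which is
determined by its value on the bracket (`hom_suspLie_ext`). In the cochain complex, `μ = χ/2` satisfies `μ ∘ μ = 0`, and
`d² = 0` follows because the associator of `∘`, being the sum of the parallel insertions, is graded
symmetric in its last two arguments (`Alg.preLie_right_symm`).

*The null-homotopy.* The cup product of `χ` is the associator of `μ` with its two arguments,
`cup(χ)(f, g) = (μ ∘ f) ∘ g - μ ∘ (f ∘ g)` (`cup_canonical`). In `δ_P(∘)` the terms in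
which `μ` is not the leftmost factor cancel by right symmetry, which leaves `cup(χ) = -δ_P(∘)`
(`cup_canonical_eq_neg_delta`). In particular `χ` is closed.

*Closed and exact elements.* The map `cup` turns insertion into the first input into substitution of
operations (`cup_comp_zero`), and adjacent transpositions into the exchange of arguments with the
Koszul sign (`isSwap_cup`). The differential `δ_P` is a derivation for the former when the outer
operation is closed (`delta_compZero`), and commutes with the latter (`IsSwap.delta`). Since these two
kinds of operations generate all partial compositions and permutations, the closed elements form a
suboperad, which contains `χ` and hence the image of `L`. The Lie operad is spanned in arities `n ≠ 1`
by renumbered composites `y ∘_i λ` (`mem_span_isElementary`), and for `t = L(y)` closed, `cup(t ∘_0 χ)`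
is up to sign the boundary of `cup(t)(f_1 ∘ f_2, f_3, …)` (`comp_canonical_mem_exact`).

*Naturality.* It remains to see that these operations are natural. They are full compositions of an
element of `P ⊗ P^!` with the arguments, and full compositions graft the arguments one by one, as new
white vertices, on the legs of trees, beginning with a single black vertex (`constant_mem`,
`insertLast_mem`, `exists_partialComp_preLie`). Renumbering the white vertices shows that natural
operations are stable under the exchange of arguments (`swap_mem_naturalOperations`).
-/

namespace CohOp

open scoped TensorProduct DirectSum

variable {k : Type u} [Field k] {deg : ℕ → ℤ}

/-! ### Block permutations -/

/-- The block permutation `σ ∘_i τ` in the equivariance axiom exists: its values are prescribed on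
the inputs inside and outside the inserted block, and these exhaust the inputs. -/
theorem exists_isBlockPerm {m n r : ℕ} (h : r + 1 = m + n) (i : Fin m)
    (σ : Equiv.Perm (Fin m)) (τ : Equiv.Perm (Fin n)) : ∃ ρ, IsBlockPerm h i σ τ ρ := by
  have key : ∀ x : Fin r, ∃ y : Fin r, (∀ z, x = inBlk h i z → y = inBlk h (σ i) (τ z)) ∧
      ∀ w (hw : w ≠ i), x = outBlk h i w hw → y = outBlk h (σ i) (σ w) (σ.injective.ne hw) := by
    intro x
    rcases in_or_out h i x with ⟨z, rfl⟩ | ⟨w, hw, rfl⟩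
    · refine ⟨inBlk h (σ i) (τ z), fun z' hz => ?_, fun w hw e => ?_⟩
      · rw [inBlk_injective h i hz]
      · exact absurd e (inBlk_ne_outBlk h i z w hw)
    · refine ⟨outBlk h (σ i) (σ w) (σ.injective.ne hw), fun z' hz => ?_, fun w' hw' e => ?_⟩
      · exact absurd hz.symm (inBlk_ne_outBlk h i z' w hw)
      · obtain rfl := outBlk_injective h i w w' hw hw' e
        rfl
  choose F hin hout using key
  have hF : Function.Injective F := by
    intro x x' e
    rcases in_or_out h i x with ⟨z, rfl⟩ | ⟨w, hw, rfl⟩ <;>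
      rcases in_or_out h i x' with ⟨z', rfl⟩ | ⟨w', hw', rfl⟩
    · rw [hin _ z rfl, hin _ z' rfl] at e
      rw [τ.injective (inBlk_injective h _ e)]
    · rw [hin _ z rfl, hout _ w' hw' rfl] at e
      exact absurd e (inBlk_ne_outBlk _ _ _ _ _)
    · rw [hin _ z' rfl, hout _ w hw rfl] at e
      exact absurd e.symm (inBlk_ne_outBlk _ _ _ _ _)
    · rw [hout _ w hw rfl, hout _ w' hw' rfl] at e
      obtain rfl := σ.injective (outBlk_injective h _ _ _ _ _ e)
      rfl
  exact ⟨Equiv.ofBijective F (Finite.injective_iff_bijective.1 hF),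
    fun z => hin _ z rfl, fun y hy => hout _ y hy rfl⟩

theorem outBlk_congr {m n r : ℕ} (h : r + 1 = m + n) {i i' y y' : Fin m} (hi : i = i')
    (hy : y = y') (hne : y ≠ i) (hne' : y' ≠ i') : outBlk h i y hne = outBlk h i' y' hne' := by
  subst hi hy; rfl

/-- An input beyond the inserted block comes from an input of the outer operation. -/
theorem exists_outBlk_of_le {m n r : ℕ} (h : r + 1 = m + n) (i : Fin m) (x : Fin r)
    (hx : (i : ℕ) + n ≤ x) : ∃ y, ∃ hy : y ≠ i, x = outBlk h i y hy ∧ (y : ℕ) = x + 1 - n := by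
  have hne : (⟨x + 1 - n, by omega⟩ : Fin m) ≠ i := fun e => by
    have := congrArg Fin.val e
    simp only at this
    omega
  refine ⟨⟨x + 1 - n, by omega⟩, hne, Fin.ext ?_, rfl⟩
  rw [outBlk_val]
  simp only
  split_ifs <;> omega

/-- If `σ` fixes all inputs from position `P ≤ i` on, then so does `σ ∘_i 1`. -/
theorem IsBlockPerm.fixes_of_left {m n r : ℕ} {h : r + 1 = m + n} {i : Fin m}
    {σ : Equiv.Perm (Fin m)} {ρ : Equiv.Perm (Fin r)} (hρ : IsBlockPerm h i σ 1 ρ) {P : ℕ}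
    (hP : P ≤ i) (hσ : ∀ x : Fin m, P ≤ x → σ x = x) (x : Fin r) (hx : P ≤ x) : ρ x = x := by
  have hi := hσ i hP
  rcases in_or_out h i x with ⟨z, rfl⟩ | ⟨y, hy, rfl⟩
  · rw [hρ.1, hi]; rfl
  · have hy' : P ≤ y := by
      rw [outBlk_val] at hx
      split_ifs at hx with h1
      · exact hx
      · omega
    rw [hρ.2 y hy]
    exact outBlk_congr h hi (hσ y hy') _ _

/-- The block permutation `1 ∘_0 τ` only moves the inputs of the first block. -/
theorem IsBlockPerm.fixes_of_right {m n r : ℕ} {h : r + 1 = m + n} {i : Fin m} (hi : (i : ℕ) = 0)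
    {τ : Equiv.Perm (Fin n)} {ρ : Equiv.Perm (Fin r)} (hρ : IsBlockPerm h i 1 τ ρ)
    (x : Fin r) (hx : n ≤ x) : ρ x = x := by
  obtain ⟨y, hy, rfl, -⟩ := exists_outBlk_of_le h i x (by omega)
  exact hρ.2 y hy

/-! ### Elements agreeing up to a sign and a permutation of the first inputs -/

namespace Operad

variable (O : Operad k deg)

/-- `u` and `v` agree up to the sign `s` and a permutation of inputs that fixes all inputs from
position `P` on. The arities of `u` and `v` need only be propositionally equal. -/
def Sim (P : ℕ) (s : ℤˣ) {r r' : ℕ} (u : O.obj r) (v : O.obj r') : Prop :=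
  ∃ (h : r' = r) (ρ : Equiv.Perm (Fin r)), (∀ x : Fin r, P ≤ x → ρ x = x) ∧
    u = s • O.act ρ (h ▸ v)

variable {O}

theorem Sim.refl (P : ℕ) {r : ℕ} (u : O.obj r) : O.Sim P 1 u u :=
  ⟨rfl, 1, fun _ _ => rfl, by simp [O.act_one]⟩

theorem Sim.mono {P P' : ℕ} {s : ℤˣ} {r r' : ℕ} {u : O.obj r} {v : O.obj r'} (h : O.Sim P s u v)
    (hP : P ≤ P') : O.Sim P' s u v := by
  obtain ⟨h, ρ, hρ, e⟩ := h
  exact ⟨h, ρ, fun x hx => hρ x (hP.trans hx), e⟩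

theorem units_smul_linear {V W : Type*} [AddCommGroup V] [Module k V] [AddCommGroup W]
    [Module k W] (s : ℤˣ) (f : V →ₗ[k] W) (v : V) : f (s • v) = s • f v := by
  rcases Int.units_eq_one_or s with rfl | rfl <;> simp

theorem units_smul_mem_iff {V : Type*} [AddCommGroup V] [Module k V] (p : Submodule k V) (s : ℤˣ)
    {v : V} : s • v ∈ p ↔ v ∈ p := by
  rcases Int.units_eq_one_or s with rfl | rfl
  · rw [one_smul]
  · rw [Units.neg_smul, one_smul, neg_mem_iff]

theorem units_smul_linear₂ {V W U : Type*} [AddCommGroup V] [Module k V] [AddCommGroup W]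
    [Module k W] [AddCommGroup U] [Module k U] (s : ℤˣ) (f : V →ₗ[k] W →ₗ[k] U) (v : V) (w : W) :
    f (s • v) w = s • f v w := by
  rcases Int.units_eq_one_or s with rfl | rfl <;> simp

theorem Sim.trans {P : ℕ} {s s' : ℤˣ} {r r' r'' : ℕ} {u : O.obj r} {v : O.obj r'} {w : O.obj r''}
    (h : O.Sim P s u v) (h' : O.Sim P s' v w) : O.Sim P (s * s') u w := by
  obtain ⟨rfl, ρ, hρ, rfl⟩ := h
  obtain ⟨rfl, ρ', hρ', rfl⟩ := h'
  refine ⟨rfl, ρ' * ρ, fun x hx => ?_, ?_⟩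
  · rw [Equiv.Perm.mul_apply, hρ x hx, hρ' x hx]
  · simp only [units_smul_linear, smul_smul, O.act_mul]

theorem act_comp (O : Operad k deg) {m n r : ℕ} (h : r + 1 = m + n) (i : Fin m)
    (σ : Equiv.Perm (Fin m)) (u : O.obj m) (f : O.obj n) :
    ∃ ρ, IsBlockPerm h i σ 1 ρ ∧ O.comp h i (O.act σ u) f = O.act ρ (O.comp h (σ i) u f) := by
  obtain ⟨ρ, hρ⟩ := exists_isBlockPerm h i σ 1
  refine ⟨ρ, hρ, ?_⟩
  rw [← O.comp_act h i σ 1 ρ hρ, O.act_one]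

theorem comp_act_right (O : Operad k deg) {m n r : ℕ} (h : r + 1 = m + n) (i : Fin m)
    (τ : Equiv.Perm (Fin n)) (u : O.obj m) (f : O.obj n) :
    ∃ ρ, IsBlockPerm h i 1 τ ρ ∧ O.comp h i u (O.act τ f) = O.act ρ (O.comp h i u f) := by
  obtain ⟨ρ, hρ⟩ := exists_isBlockPerm h i 1 τ
  refine ⟨ρ, hρ, ?_⟩
  have := O.comp_act h i 1 τ ρ hρ u f
  rwa [O.act_one] at this

/-- Insertions behind position `P` preserve agreement up to a permutation of the inputs before
`P`. -/
theorem Sim.comp {P : ℕ} {s : ℤˣ} {m m' n n' r r' : ℕ} {u : O.obj m} {v : O.obj m'}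
    (H : O.Sim P s u v) (h : r + 1 = m + n) (h' : r' + 1 = m' + n') (i : Fin m) (i' : Fin m')
    (hi : (i : ℕ) = i') (hP : P ≤ i) {f : O.obj n} {f' : O.obj n'} (hn : n = n') (hf : HEq f f') :
    O.Sim P s (O.comp h i u f) (O.comp h' i' v f') := by
  obtain ⟨rfl, ρ, hρ, rfl⟩ := H
  subst hn
  obtain rfl := eq_of_heq hf
  obtain rfl : r = r' := by omega
  obtain rfl := Fin.ext hi
  obtain ⟨ρ', hρ', e⟩ := O.act_comp h i ρ v f
  refine ⟨rfl, ρ', hρ'.fixes_of_left hP hρ, ?_⟩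
  rw [units_smul_linear₂, e, hρ i hP]

end Operad

/-! ### Classes of operad elements in the complex of invariants -/

namespace Operad

variable (O : Operad k deg)

/-- The class of `f ∈ O(n)` in `⨁ O(a)^{Σ_a}`: its average, placed in arity `n`. -/
noncomputable def cls (n : ℕ) : O.obj n →ₗ[k] ⨁ a, O.invariants a :=
  DirectSum.lof k ℕ (fun a => O.invariants a) n ∘ₗ O.aver n

theorem aver_val {n : ℕ} (f : O.obj n) :
    (O.aver n f : O.obj n) = ((n.factorial : k)⁻¹) • ∑ σ : Equiv.Perm (Fin n), O.act σ f := by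
  change (((n.factorial : k)⁻¹) • ∑ σ : Equiv.Perm (Fin n), O.act σ) f = _
  rw [LinearMap.smul_apply, LinearMap.sum_apply]

theorem aver_act {n : ℕ} (σ : Equiv.Perm (Fin n)) (f : O.obj n) :
    O.aver n (O.act σ f) = O.aver n f := by
  refine Subtype.ext ?_
  simp only [aver_val, ← O.act_mul]
  congr 1
  exact Fintype.sum_equiv (Equiv.mulLeft σ) _ _ fun _ => rfl

theorem cls_act {n : ℕ} (σ : Equiv.Perm (Fin n)) (f : O.obj n) :
    O.cls n (O.act σ f) = O.cls n f := by
  simp only [cls, LinearMap.comp_apply, aver_act]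

variable {O} in
theorem Sim.cls_eq {P : ℕ} {s : ℤˣ} {r r' : ℕ} {u : O.obj r} {v : O.obj r'} (h : O.Sim P s u v) :
    O.cls r u = s • O.cls r' v := by
  obtain ⟨rfl, ρ, -, rfl⟩ := h
  rw [units_smul_linear, cls_act]

theorem cls_comp_congr {m n r r' : ℕ} (h : r + 1 = m + n) (h' : r' + 1 = m + n) (i : Fin m)
    (f : O.obj m) (g : O.obj n) : O.cls r (O.comp h i f g) = O.cls r' (O.comp h' i f g) := by
  obtain rfl : r = r' := by omega
  rfl

section CharZero

variable [CharZero k]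

/-- A linear map that is constant on orbits does not see averages. -/
theorem apply_aver {M : Type*} [AddCommGroup M] [Module k M] {n : ℕ} (ℓ : O.obj n →ₗ[k] M)
    (hℓ : ∀ σ f, ℓ (O.act σ f) = ℓ f) (f : O.obj n) : ℓ (O.aver n f : O.obj n) = ℓ f := by
  simp only [aver_val, map_smul, map_sum, hℓ, Finset.sum_const, Finset.card_univ,
    Fintype.card_perm, Fintype.card_fin]
  rw [← Nat.cast_smul_eq_nsmul k, smul_smul, inv_mul_cancel₀, one_smul]
  exact_mod_cast n.factorial_ne_zero

theorem aver_coe {n : ℕ} (x : O.invariants n) : O.aver n (x : O.obj n) = x := by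
  refine Subtype.ext ?_
  rw [aver_val]
  rw [Finset.sum_congr rfl fun σ _ => x.2 σ]
  simp only [Finset.sum_const, Finset.card_univ, Fintype.card_perm, Fintype.card_fin]
  rw [← Nat.cast_smul_eq_nsmul k, smul_smul, inv_mul_cancel₀, one_smul]
  exact_mod_cast n.factorial_ne_zero

theorem cls_coe {n : ℕ} (x : O.invariants n) :
    O.cls n (x : O.obj n) = DirectSum.lof k ℕ (fun a => O.invariants a) n x := by
  rw [cls, LinearMap.comp_apply, aver_coe]

end CharZero

/-! ### Full compositions -/

theorem partialComp_step {n : ℕ} (a : Fin n → ℕ) (t : O.obj n) (f : ∀ i, O.obj (a i)) (j : ℕ)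
    (hj : j + 1 ≤ n) :
    O.partialComp a t f (j + 1) hj =
      O.comp (m := (n - j) + partialSum a j) (n := a ⟨j, hj⟩)
        (by simp only [partialSum, dif_pos (show j < n from hj)]; omega)
        ⟨partialSum a j, by omega⟩ (O.partialComp a t f j (by omega)) (f ⟨j, hj⟩) := rfl

theorem partialSum_succ {n : ℕ} (a : Fin n → ℕ) (j : ℕ) (hj : j < n) :
    partialSum a (j + 1) = partialSum a j + a ⟨j, hj⟩ := by
  rw [partialSum, dif_pos hj]

variable {O} in
/-- Agreement of two full compositions at some stage persists when the same elements are inserted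
afterwards. -/
theorem Sim.partialComp {n n' : ℕ} {a : Fin n → ℕ} {a' : Fin n' → ℕ} {t : O.obj n} {t' : O.obj n'}
    {f : ∀ i, O.obj (a i)} {f' : ∀ i, O.obj (a' i)} {P : ℕ} {s : ℤˣ} {j j' : ℕ} {hj : j ≤ n}
    {hj' : j' ≤ n'} (H : O.Sim P s (O.partialComp a t f j hj) (O.partialComp a' t' f' j' hj'))
    (hP : P ≤ partialSum a j) (hs : partialSum a j = partialSum a' j')
    (hf : ∀ d (hd : j + d < n) (hd' : j' + d < n'),
      a ⟨j + d, hd⟩ = a' ⟨j' + d, hd'⟩ ∧ HEq (f ⟨j + d, hd⟩) (f' ⟨j' + d, hd'⟩)) :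
    ∀ d (hd : j + d ≤ n) (hd' : j' + d ≤ n'),
      partialSum a (j + d) = partialSum a' (j' + d) ∧ P ≤ partialSum a (j + d) ∧
      O.Sim P s (O.partialComp a t f (j + d) hd) (O.partialComp a' t' f' (j' + d) hd')
  | 0, _, _ => ⟨hs, hP, H⟩
  | d + 1, hd, hd' => by
    obtain ⟨e, hPd, ih⟩ := Sim.partialComp H hP hs hf d (by omega) (by omega)
    obtain ⟨ha, hfd⟩ := hf d (by omega) (by omega)
    refine ⟨?_, ?_, ?_⟩
    · rw [← add_assoc, ← add_assoc, partialSum_succ _ _ (by omega), partialSum_succ _ _ (by omega),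
        e, ha]
    · rw [← add_assoc, partialSum_succ _ _ (by omega)]
      omega
    · exact ih.comp _ _ _ _ e hPd ha hfd

theorem cls_partialComp_eq {n : ℕ} (a : Fin n → ℕ) (t : O.obj n) (f : ∀ i, O.obj (a i)) (N : ℕ)
    (h : N ≤ n) (hN : N = n) :
    O.cls _ (O.partialComp a t f N h) = O.cls _ (O.fullComp a t f) := by
  subst hN
  rfl

/-- Permuting the inputs of the first argument of a full composition permutes the inputs of the
result. -/
theorem cls_fullComp_act_zero {m : ℕ} (a : Fin (m + 1) → ℕ) (t : O.obj (m + 1))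
    (f : ∀ i, O.obj (a i)) (τ : Equiv.Perm (Fin (a 0))) (g : O.obj (a 0)) :
    O.cls _ (O.fullComp a t (Function.update f 0 (O.act τ g))) =
      O.cls _ (O.fullComp a t (Function.update f 0 g)) := by
  have h1 : O.Sim (partialSum a 1) 1
      (O.partialComp a t (Function.update f 0 (O.act τ g)) 1 (by omega))
      (O.partialComp a t (Function.update f 0 g) 1 (by omega)) := by
    rw [partialComp_step, partialComp_step]
    have e : ∀ x : O.obj (a 0), Function.update f 0 x (⟨0, by omega⟩ : Fin (m + 1)) = x :=
      fun x => Function.update_self _ _ _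
    rw [e, e]
    obtain ⟨ρ, hρ, e⟩ := O.comp_act_right (m := m + 1) (n := a 0)
      (r := (m + 1 - (0 + 1)) + partialSum a (0 + 1))
      (by rw [partialSum_succ _ _ (by omega)]; simp [partialSum]; omega) 0 τ t g
    refine ⟨rfl, ρ, fun x hx => hρ.fixes_of_right rfl x ?_, ?_⟩
    · have e0 : partialSum a 1 = a 0 := by
        rw [partialSum_succ _ _ (by omega)]
        simp [partialSum]
      omega
    · rw [one_smul]
      exact e
  have h2 := Sim.partialComp h1 le_rfl rfl (fun d hd hd' => ⟨rfl, by
    have : (⟨1 + d, hd⟩ : Fin (m + 1)) ≠ 0 := fun e => by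
      have := congrArg Fin.val e
      simp at this
    rw [Function.update_of_ne this, Function.update_of_ne this]⟩) m (by omega) (by omega)
  have h3 := h2.2.2.cls_eq
  rw [one_smul] at h3
  rwa [cls_partialComp_eq _ _ _ _ _ _ (by omega), cls_partialComp_eq _ _ _ _ _ _ (by omega)] at h3

/-- Full compositions into a composite `t ∘_0 s`: the first `l` arguments may be inserted into `s`
beforehand. The data `a'`, `f'` of the outer composition are compared by `HEq` because their
arities agree only propositionally. -/
theorem cls_fullComp_comp_zero {l m : ℕ} (h : l + m + 1 = m + 1 + l) (t : O.obj (m + 1))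
    (s : O.obj l) (a : Fin (l + m) → ℕ) (f : ∀ i, O.obj (a i)) (a' : Fin (m + 1) → ℕ)
    (f' : ∀ i, O.obj (a' i)) (h0 : a' 0 = totalArity fun i => a (Fin.castAdd m i))
    (hf0 : HEq (f' 0) (O.fullComp _ s fun i => f (Fin.castAdd m i)))
    (hs : ∀ i : Fin m, a' i.succ = a (Fin.natAdd l i))
    (hfs : ∀ i : Fin m, HEq (f' i.succ) (f (Fin.natAdd l i))) :
    O.cls _ (O.fullComp a (O.comp h 0 t s) f) = O.cls _ (O.fullComp a' t f') := by
  have hps : ∀ j, j ≤ l → partialSum a j = partialSum (fun i : Fin l => a (Fin.castAdd m i)) j := by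
    intro j
    induction j with
    | zero => intro; rfl
    | succ j ih =>
      intro hj
      rw [partialSum_succ _ _ (by omega), partialSum_succ _ _ (by omega), ih (by omega)]
      rfl
  -- By `comp_seq`, the first `j` insertions into `t ∘_0 s` take place inside `s`.
  have h1 : ∀ j (hj : j ≤ l), ∀ r (hr : r + 1 = (m + 1) +
      ((l - j) + partialSum (fun i : Fin l => a (Fin.castAdd m i)) j)),
      O.Sim 0 1 (O.partialComp a (O.comp h 0 t s) f j (by omega))
        (O.comp (r := r) hr 0 t
          (O.partialComp (fun i : Fin l => a (Fin.castAdd m i)) s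
            (fun i => f (Fin.castAdd m i)) j hj)) := by
    intro j
    induction j with
    | zero =>
      intro _ r hr
      obtain rfl : r = l + m := by simp only [partialSum] at hr; omega
      exact Sim.refl _ _
    | succ j ih =>
      intro hj r hr
      have hr' := hr
      rw [partialSum_succ _ _ (by omega)] at hr'
      have e := ih (by omega) (l + m - j + partialSum a j) (by rw [hps j (by omega)]; omega)
      rw [partialComp_step, partialComp_step]
      have e2 := O.comp_seq
        (r := l + m - j + partialSum a j) (t := r)
        (by rw [hps j (by omega)]; omega)
        (by rw [hps j (by omega)]; omega)
        (by rw [partialSum_succ _ _ (by omega)]; omega) hr 0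
        ⟨partialSum (fun i : Fin l => a (Fin.castAdd m i)) j, by omega⟩ t
        (O.partialComp (fun i : Fin l => a (Fin.castAdd m i)) s
            (fun i => f (Fin.castAdd m i)) j (by omega)) (f (Fin.castAdd m ⟨j, hj⟩))
      rw [← e2]
      refine e.comp _ _ _ _ ?_ (by omega) rfl HEq.rfl
      simp only [inBlk_val, Fin.val_zero, zero_add]
      exact hps j (by omega)
  have hta : totalArity (fun i : Fin l => a (Fin.castAdd m i)) =
      partialSum (fun i : Fin l => a (Fin.castAdd m i)) l := by
    simp [totalArity]
  have hP1 : partialSum a' 1 = a' 0 := by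
    rw [partialSum_succ _ _ (by omega)]
    simp [partialSum]
  -- After `l` insertions, `s` is filled, and this is the first insertion into `t`.
  have h2 : O.Sim 0 1 (O.partialComp a (O.comp h 0 t s) f l (by omega))
      (O.partialComp a' t f' 1 (by omega)) := by
    have e1 := h1 l le_rfl (m + 1 - 1 + partialSum a' 1) (by rw [hP1, h0, totalArity]; omega)
    have e2 : O.Sim 0 1 (O.comp (r := m + 1 - 1 + partialSum a' 1)
          (by rw [hP1, h0, totalArity]; omega) 0 t
          (O.partialComp (fun i : Fin l => a (Fin.castAdd m i)) s
            (fun i => f (Fin.castAdd m i)) l le_rfl)) (O.partialComp a' t f' 1 (by omega)) :=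
      (Sim.refl 0 t).comp _ _ _ _ rfl (by omega) h0.symm hf0.symm
    exact (e1.trans e2)
  have h3 := Sim.partialComp h2 (by omega) (by rw [hP1, h0, hta]; exact hps l le_rfl)
    (fun d hd hd' => by
      have : (⟨1 + d, hd'⟩ : Fin (m + 1)) = Fin.succ ⟨d, by omega⟩ := Fin.ext (by simp; omega)
      rw [this]
      exact ⟨(hs ⟨d, by omega⟩).symm, (hfs ⟨d, by omega⟩).symm⟩) m (by omega) (by omega)
  have h4 := h3.2.2.cls_eq
  rw [one_smul] at h4
  rwa [cls_partialComp_eq _ _ _ _ _ _ (by omega), cls_partialComp_eq _ _ _ _ _ _ (by omega)] at h4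

end Operad

end CohOp

namespace CohOp

open scoped TensorProduct DirectSum

variable {k : Type u} [Field k] {deg : ℕ → ℤ}

namespace Operad

variable (O : Operad k deg)

/-! ### Adjacent transpositions in full compositions -/

/-- `u` is obtained from `v` by exchanging the inputs `p` and `p + 1`. -/
def SwapRel (p : ℕ) {r r' : ℕ} (u : O.obj r) (v : O.obj r') : Prop :=
  ∃ (h : r' = r) (x y : Fin r), (x : ℕ) = p ∧ (y : ℕ) = p + 1 ∧
    u = O.act (Equiv.swap x y) (h ▸ v)

variable {O}

theorem SwapRel.congr_pos {p p' : ℕ} (hp : p = p') {r r' : ℕ} {u : O.obj r} {v : O.obj r'}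
    (h : O.SwapRel p u v) : O.SwapRel p' u v := hp ▸ h

/-- Insertion in front of two exchanged inputs shifts their position. -/
theorem SwapRel.comp {p : ℕ} {m m' n n' r r' : ℕ} {u : O.obj m} {v : O.obj m'}
    (H : O.SwapRel p u v) (h : r + 1 = m + n) (h' : r' + 1 = m' + n') (i : Fin m) (i' : Fin m')
    (hi : (i : ℕ) = i') (hp : (i : ℕ) < p) {f : O.obj n} {f' : O.obj n'} (hn : n = n')
    (hf : HEq f f') :
    O.SwapRel (p + n - 1) (O.comp h i u f) (O.comp h' i' v f') := by
  obtain ⟨rfl, x, y, hx, hy, rfl⟩ := H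
  subst hn
  obtain rfl := eq_of_heq hf
  obtain rfl : r = r' := by omega
  obtain rfl := Fin.ext hi
  have hxi : x ≠ i := fun e => by subst e; omega
  have hyi : y ≠ i := fun e => by subst e; omega
  have hsi : Equiv.swap x y i = i := Equiv.swap_apply_of_ne_of_ne hxi.symm hyi.symm
  have hb : IsBlockPerm h i (Equiv.swap x y) 1
      (Equiv.swap (outBlk h i x hxi) (outBlk h i y hyi)) := by
    refine ⟨fun z => ?_, fun w hw => ?_⟩
    · rw [Equiv.swap_apply_of_ne_of_ne (inBlk_ne_outBlk _ _ _ _ _) (inBlk_ne_outBlk _ _ _ _ _), hsi]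
      rfl
    · by_cases h1 : w = x
      · subst h1
        rw [Equiv.swap_apply_left]
        exact outBlk_congr h hsi.symm (Equiv.swap_apply_left _ _).symm _ _
      by_cases h2 : w = y
      · subst h2
        rw [Equiv.swap_apply_right]
        exact outBlk_congr h hsi.symm (Equiv.swap_apply_right _ _).symm _ _
      rw [Equiv.swap_apply_of_ne_of_ne (fun e => h1 (outBlk_injective _ _ _ _ _ _ e))
        (fun e => h2 (outBlk_injective _ _ _ _ _ _ e))]
      exact outBlk_congr h hsi.symm (Equiv.swap_apply_of_ne_of_ne h1 h2).symm _ _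
  refine ⟨rfl, outBlk h i x hxi, outBlk h i y hyi, ?_, ?_, ?_⟩
  · rw [outBlk_val, if_neg (by omega)]; omega
  · rw [outBlk_val, if_neg (by omega)]; omega
  · have := O.comp_act h i (Equiv.swap x y) 1 _ hb v f
    rw [O.act_one, hsi] at this
    exact this

/-- Filling both exchanged inputs turns the exchange into the sign of parallel composition, up to a
permutation of the inputs of the two inserted elements. -/
theorem SwapRel.comp_comp {p : ℕ} {m m' n n' l l' r r' s s' : ℕ} {u : O.obj m} {v : O.obj m'}
    (H : O.SwapRel p u v) (h₁ : r + 1 = m + n) (h₂ : s + 1 = r + l) (h₁' : r' + 1 = m' + l')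
    (h₂' : s' + 1 = r' + n') (i₁ : Fin m) (i₂ : Fin r) (i₁' : Fin m') (i₂' : Fin r')
    (hi₁ : (i₁ : ℕ) = p) (hi₂ : (i₂ : ℕ) = p + n) (hi₁' : (i₁' : ℕ) = p) (hi₂' : (i₂' : ℕ) = p + l)
    {f : O.obj n} {f' : O.obj n'} {g : O.obj l} {g' : O.obj l'} (hn : n = n') (hf : HEq f f')
    (hl : l = l') (hg : HEq g g') :
    O.Sim (p + n + l) (deg n * deg l).negOnePow (O.comp h₂ i₂ (O.comp h₁ i₁ u f) g)
      (O.comp h₂' i₂' (O.comp h₁' i₁' v g') f') := by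
  obtain ⟨rfl, x, y, hx, hy, rfl⟩ := H
  subst hn hl
  obtain rfl := eq_of_heq hf
  obtain rfl := eq_of_heq hg
  obtain rfl : x = i₁ := Fin.ext (by omega)
  obtain rfl : i₁' = x := Fin.ext (by omega)
  obtain rfl : s' = s := by omega
  have hlt : i₁' < y := Fin.lt_def.2 (by omega)
  obtain ⟨ρ, hρ, e⟩ := O.act_comp h₁ i₁' (Equiv.swap i₁' y) v f
  rw [e, Equiv.swap_apply_left]
  have hi2 : i₂ = outBlk h₁ i₁' y hlt.ne' := Fin.ext (by
    rw [outBlk_val, if_neg (by omega)]; omega)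
  have hρi : ρ i₂ = outBlk h₁ y i₁' hlt.ne := by
    rw [hi2, hρ.2 y hlt.ne']
    exact outBlk_congr h₁ (Equiv.swap_apply_left _ _) (Equiv.swap_apply_right _ _) _ _
  obtain ⟨ρ', hρ', e'⟩ := O.act_comp h₂ i₂ ρ (O.comp h₁ y v f) g
  rw [e', hρi]
  have hpar := O.comp_par h₁' h₂' h₁ h₂ i₁' y hlt v g f
  have hi2' : i₂' = outBlk h₁' i₁' y hlt.ne' := Fin.ext (by
    rw [outBlk_val, if_neg (by omega)]; omega)
  refine ⟨rfl, ρ', fun z hz => ?_, ?_⟩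
  · obtain ⟨w, hw, rfl, hw'⟩ := exists_outBlk_of_le h₂ i₂ z (by omega)
    rw [hρ'.2 w hw]
    have hρw : ρ w = w := by
      obtain ⟨c, hc, rfl, hc'⟩ := exists_outBlk_of_le h₁ i₁' w (by omega)
      have hcy : c ≠ y := fun e => by
        subst e
        exact hw hi2.symm
      have hcs : Equiv.swap i₁' y c = c := Equiv.swap_apply_of_ne_of_ne hc hcy
      have hyc : (y : ℕ) < c := by
        have : (c : ℕ) ≠ y := fun e => hcy (Fin.ext e)
        have : (c : ℕ) ≠ i₁' := fun e => hc (Fin.ext e)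
        omega
      rw [hρ.2 c hc]
      refine Fin.ext ?_
      rw [outBlk_val, outBlk_val, hcs, Equiv.swap_apply_left, if_neg (by omega), if_neg (by omega)]
    refine Fin.ext ?_
    rw [outBlk_val, outBlk_val, hρw, hρi, if_neg (by rw [outBlk_val]; split_ifs <;> omega),
      if_neg (by omega)]
  · rw [hi2', hpar, mul_comm (deg l), units_smul_linear, smul_smul, Int.units_mul_self, one_smul]

variable (O)

theorem partialSum_swap {n : ℕ} (a : Fin n → ℕ) (j : ℕ) (hj : j + 1 < n) :
    ∀ i ≤ j, partialSum (fun i => a (Equiv.swap ⟨j, by omega⟩ ⟨j + 1, hj⟩ i)) i = partialSum a i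
  | 0, _ => rfl
  | i + 1, hi => by
    rw [partialSum_succ _ _ (by omega), partialSum_succ _ _ (by omega),
      partialSum_swap a j hj i (by omega), Equiv.swap_apply_of_ne_of_ne] <;>
    · intro e
      have := congrArg Fin.val e
      simp at this
      omega

/-- Full compositions into `t (j, j + 1)`: the Koszul sign rule. -/
theorem cls_fullComp_swap {n : ℕ} (a : Fin n → ℕ) (t : O.obj n) (f : ∀ i, O.obj (a i)) (j : ℕ)
    (hj : j + 1 < n) :
    O.cls _ (O.fullComp a (O.act (Equiv.swap ⟨j, by omega⟩ ⟨j + 1, hj⟩) t) f) =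
      (deg (a ⟨j, by omega⟩) * deg (a ⟨j + 1, hj⟩)).negOnePow •
        O.cls _ (O.fullComp (fun i => a (Equiv.swap ⟨j, by omega⟩ ⟨j + 1, hj⟩ i)) t
          fun i => f (Equiv.swap ⟨j, by omega⟩ ⟨j + 1, hj⟩ i)) := by
  set s : Equiv.Perm (Fin n) := Equiv.swap ⟨j, by omega⟩ ⟨j + 1, hj⟩ with hs
  have hps : ∀ i ≤ j, partialSum (fun i => a (s i)) i = partialSum a i := partialSum_swap a j hj
  have hne : ∀ i (hi : i < n), i ≠ j → i ≠ j + 1 → s ⟨i, hi⟩ = ⟨i, hi⟩ := fun i hi h1 h2 =>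
    Equiv.swap_apply_of_ne_of_ne (fun e => h1 (congrArg Fin.val e))
      (fun e => h2 (congrArg Fin.val e))
  have hsj : s ⟨j, by omega⟩ = ⟨j + 1, hj⟩ := Equiv.swap_apply_left _ _
  have hsj' : s ⟨j + 1, hj⟩ = ⟨j, by omega⟩ := Equiv.swap_apply_right _ _
  -- Up to stage `j`, the two compositions differ by an exchange of adjacent inputs.
  have h1 : ∀ i (hi : i ≤ j), O.SwapRel (partialSum a i + (j - i))
      (O.partialComp a (O.act s t) f i (by omega))
      (O.partialComp (fun i => a (s i)) t (fun i => f (s i)) i (by omega)) := by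
    intro i
    induction i with
    | zero => exact fun _ => ⟨rfl, _, _, by simp [partialSum], by simp [partialSum], rfl⟩
    | succ i ih =>
      intro hi
      have hsi := hne i (by omega) (by omega) (by omega)
      have := (ih (by omega)).comp (r := n - (i + 1) + partialSum a (i + 1))
        (r' := n - (i + 1) + partialSum (fun i => a (s i)) (i + 1)) (n := a ⟨i, by omega⟩)
        (n' := a (s ⟨i, by omega⟩))
        (by rw [partialSum_succ _ _ (by omega)]; omega)
        (by rw [partialSum_succ _ _ (by omega)]; omega)
        ⟨partialSum a i, by omega⟩ ⟨partialSum (fun i => a (s i)) i, by omega⟩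
        (hps i (by omega)).symm (by simp only; omega) (f := f ⟨i, by omega⟩)
        (f' := f (s ⟨i, by omega⟩)) (by rw [hsi]) (by rw [hsi])
      refine SwapRel.congr_pos ?_ this
      rw [partialSum_succ a i (by omega)]
      omega
  have hP1 : partialSum a (j + 1) = partialSum a j + a ⟨j, by omega⟩ := partialSum_succ _ _ _
  have hP1' : partialSum (fun i => a (s i)) (j + 1) = partialSum a j + a ⟨j + 1, by omega⟩ := by
    rw [partialSum_succ _ _ (by omega), hps j le_rfl, hsj]
  have hP2 : partialSum a (j + 2) = partialSum a j + a ⟨j, by omega⟩ + a ⟨j + 1, hj⟩ := by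
    rw [partialSum_succ _ _ hj, hP1]
  have hP2' : partialSum (fun i => a (s i)) (j + 2) =
      partialSum a j + a ⟨j + 1, hj⟩ + a ⟨j, by omega⟩ := by
    rw [partialSum_succ _ _ hj, hP1', hsj']
  have h2 : O.Sim (partialSum a (j + 2)) (deg (a ⟨j, by omega⟩) * deg (a ⟨j + 1, hj⟩)).negOnePow
      (O.partialComp a (O.act s t) f (j + 2) (by omega))
      (O.partialComp (fun i => a (s i)) t (fun i => f (s i)) (j + 2) (by omega)) := by
    rw [partialComp_step, partialComp_step, partialComp_step, partialComp_step]
    have h0 := h1 j le_rfl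
    rw [Nat.sub_self, add_zero] at h0
    exact (h0.comp_comp _ _ _ _ _ _ _ _ rfl hP1 (hps j le_rfl) hP1' (by rw [hsj']) (by rw [hsj'])
      (by rw [hsj]) (by rw [hsj])).mono hP2.ge
  have h3 := Sim.partialComp h2 le_rfl (by rw [hP2, hP2']; omega) (fun d hd _ => by
    have := hne (j + 2 + d) hd (by omega) (by omega)
    exact ⟨by rw [this], by rw [this]⟩) (n - (j + 2)) (by omega) (by omega)
  have h4 := h3.2.2.cls_eq
  rwa [cls_partialComp_eq _ _ _ _ _ _ (by omega), cls_partialComp_eq _ _ _ _ _ _ (by omega)] at h4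

end Operad

end CohOp

namespace CohOp

open scoped TensorProduct DirectSum

variable {k : Type u} [Field k] {deg : ℕ → ℤ}

/-! ### Pure tensors in Hadamard products -/

/-- The pure tensors `p ⊗ q`, as elements of the Hadamard product `P ⊗ Q`. -/
def hadamardMk (P Q : Operad₀ k) (n : ℕ) : P.obj n →ₗ[k] Q.obj n →ₗ[k] (hadamard P Q).obj n :=
  TensorProduct.mk k (P.obj n) (Q.obj n)

theorem hadamard_act_mk (P Q : Operad₀ k) {n : ℕ} (σ : Equiv.Perm (Fin n)) (p : P.obj n)
    (q : Q.obj n) :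
    (hadamard P Q).act σ (hadamardMk P Q n p q) = hadamardMk P Q n (P.act σ p) (Q.act σ q) := rfl

theorem hadamard_comp_mk (P Q : Operad₀ k) {m n r : ℕ} (h : r + 1 = m + n) (i : Fin m)
    (p : P.obj m) (q : Q.obj m) (p' : P.obj n) (q' : Q.obj n) :
    (hadamard P Q).comp h i (hadamardMk P Q m p q) (hadamardMk P Q n p' q') =
      hadamardMk P Q r (P.comp h i p p') (Q.comp h i q q') := rfl

namespace QuadraticData

variable (D : QuadraticData k)

/-! ### The canonical element -/

/-- The map `Γ(E)(3) → P(3)` in terms of the three summands of `Γ(E)(3)`. -/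
def three : (Fin 3 → D.E ⊗[k] D.E) →ₗ[k] D.operad.obj 3 :=
  show _ →ₗ[k] ((freeOperad D.τ).quot D.relations).obj 3 from
  ((freeOperad D.τ).ideal D.relations 3).mkQ ∘ₗ freeThree D.τ

theorem three_eq_zero (t : Fin 3 → D.E ⊗[k] D.E) (ht : t ∈ D.R) : D.three t = 0 :=
  (Submodule.Quotient.mk_eq_zero _).2 (InIdeal.of _ ⟨t, ht, rfl⟩)

theorem three_single (u : Fin 3) (e e' : D.E) :
    D.three (Pi.single u (e ⊗ₜ e')) =
      D.operad.act ((finRotate 3) ^ (u : ℕ))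
        (D.operad.comp (m := 2) (n := 2) (r := 3) rfl 0 (D.gen e) (D.gen e')) := by
  have : freeThree D.τ (Pi.single u (e ⊗ₜ e')) = (freeOperad D.τ).act ((finRotate 3) ^ (u : ℕ))
      ((freeOperad D.τ).comp (m := 2) (n := 2) (r := 3) rfl 0 (freeGen D.τ e) (freeGen D.τ e')) := by
    rw [freeThree, LinearMap.sum_apply, Finset.sum_eq_single u]
    · simp
    · intro v _ hv
      simp [hv]
    · simp
  exact congrArg (Submodule.Quotient.mk (p := (freeOperad D.τ).ideal D.relations 3)) this

theorem gen_τ (e : D.E) : D.gen (D.τ e) = D.operad.act (Equiv.swap 0 1) (D.gen e) := by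
  have : freeGen D.τ (D.τ e) = (freeOperad D.τ).act (Equiv.swap 0 1) (freeGen D.τ e) :=
    Quot.sound (.gen_swap e)
  exact congrArg (Submodule.Quotient.mk (p := (freeOperad D.τ).ideal D.relations 2)) this

/-- The generators `E^# → P^!(2)` of the dual operad. -/
def dualGen : Module.Dual k D.E →ₗ[k] D.dual.operad.obj 2 := D.dual.gen

/-- The map `Γ(E^∨)(3) → P^!(3)`. -/
def dualThree : (Fin 3 → Module.Dual k D.E ⊗[k] Module.Dual k D.E) →ₗ[k] D.dual.operad.obj 3 :=
  D.dual.three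

theorem dualThree_eq_zero (s : Fin 3 → Module.Dual k D.E ⊗[k] Module.Dual k D.E)
    (hs : ∀ t ∈ D.R, D.pairing s t = 0) : D.dualThree s = 0 := D.dual.three_eq_zero s hs

theorem dualThree_single (u : Fin 3) (e e' : Module.Dual k D.E) :
    D.dualThree (Pi.single u (e ⊗ₜ e')) =
      D.dual.operad.act ((finRotate 3) ^ (u : ℕ))
        (D.dual.operad.comp (m := 2) (n := 2) (r := 3) rfl 0 (D.dualGen e) (D.dualGen e')) :=
  D.dual.three_single u e e'

theorem dualGen_τ (e : Module.Dual k D.E) :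
    D.dual.operad.act (Equiv.swap 0 1) (D.dualGen e) = -D.dualGen (D.τ.dualMap e) :=
  (D.dual.gen_τ e).symm.trans (map_neg D.dualGen (D.τ.dualMap e))

theorem sum_dualDistrib {ι : Type*} [Fintype ι] (b : Module.Basis ι k D.E) (x : D.E ⊗[k] D.E) :
    ∑ i, ∑ j, TensorProduct.dualDistrib k D.E D.E (b.coord i ⊗ₜ b.coord j) x • (b i ⊗ₜ[k] b j) =
      x := by
  induction x with
  | zero => simp
  | add x y hx hy =>
    simp only [map_add, add_smul, Finset.sum_add_distrib, hx, hy]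
  | tmul e e' =>
    conv_rhs => rw [← b.sum_repr e, ← b.sum_repr e', TensorProduct.sum_tmul]
    refine Finset.sum_congr rfl fun i _ => ?_
    rw [TensorProduct.tmul_sum]
    refine Finset.sum_congr rfl fun j _ => ?_
    rw [TensorProduct.smul_tmul_smul]
    simp

theorem sum_pairing {ι : Type*} [Fintype ι] (b : Module.Basis ι k D.E)
    (t : Fin 3 → D.E ⊗[k] D.E) :
    ∑ p : Fin 3 × ι × ι, D.pairing (Pi.single p.1 (b.coord p.2.1 ⊗ₜ b.coord p.2.2)) t •
      (Pi.single p.1 (b p.2.1 ⊗ₜ[k] b p.2.2) : Fin 3 → D.E ⊗[k] D.E) = t := by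
  have h : ∀ u x, D.pairing (Pi.single u x) t = TensorProduct.dualDistrib k D.E D.E x (t u) := by
    intro u x
    rw [pairing, Finset.sum_eq_single u]
    · simp
    · intro v _ hv
      simp [hv]
    · simp
  simp only [h, ← Pi.single_smul, Fintype.sum_prod_type]
  conv_rhs => rw [← Finset.univ_sum_single t]
  refine Finset.sum_congr rfl fun u _ => ?_
  conv_rhs => rw [← D.sum_dualDistrib b (t u)]
  exact (by simp only [map_sum, LinearMap.coe_single] :
    LinearMap.single k (fun _ : Fin 3 => D.E ⊗[k] D.E) u
    (∑ i, ∑ j, TensorProduct.dualDistrib k D.E D.E (b.coord i ⊗ₜ b.coord j) (t u) •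
      (b i ⊗ₜ[k] b j)) = _).symm

/-- The canonical element of `V ⊗ V^#`, `V = Γ(E)(3)`, vanishes in `V / R ⊗ V^# / R^⊥`. -/
theorem sum_three_dualThree {ι : Type*} [Fintype ι] (b : Module.Basis ι k D.E) :
    ∑ p : Fin 3 × ι × ι, hadamardMk D.operad D.dual.operad 3
      (D.three (Pi.single p.1 (b p.2.1 ⊗ₜ b p.2.2)))
      (D.dualThree (Pi.single p.1 (b.coord p.2.1 ⊗ₜ b.coord p.2.2))) = 0 := by
  obtain ⟨R', hR'⟩ := D.R.exists_isCompl
  -- `π` is a projection onto a complement of `R`, so it kills `R` and `id - π` has image in `R`.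
  obtain ⟨π, hπ, hπ'⟩ : ∃ π : (Fin 3 → D.E ⊗[k] D.E) →ₗ[k] (Fin 3 → D.E ⊗[k] D.E),
      (∀ t ∈ D.R, π t = 0) ∧ ∀ t, t - π t ∈ D.R := by
    refine ⟨LinearMap.id - D.R.subtype ∘ₗ D.R.projectionOnto R' hR', fun t ht => ?_, fun t => ?_⟩
    · have := Submodule.projectionOnto_apply_left hR' ⟨t, ht⟩
      simp only at this
      simp [this]
    · simp
  set B : Fin 3 × ι × ι → Fin 3 → D.E ⊗[k] D.E := fun p => Pi.single p.1 (b p.2.1 ⊗ₜ b p.2.2) with hB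
  set B' : Fin 3 × ι × ι → Fin 3 → Module.Dual k D.E ⊗[k] Module.Dual k D.E :=
    fun p => Pi.single p.1 (b.coord p.2.1 ⊗ₜ b.coord p.2.2) with hB'
  have hsum : ∀ t, ∑ p, D.pairing (B' p) t • B p = t := D.sum_pairing b
  have hpl : ∀ s (r : Fin 3 × ι × ι → k), D.pairing (∑ p, r p • B' p) s =
      ∑ p, r p * D.pairing (B' p) s := by
    intro s r
    simp only [pairing, Finset.sum_apply, Pi.smul_apply, map_sum, map_smul, LinearMap.sum_apply,
      LinearMap.smul_apply, smul_eq_mul, Finset.mul_sum]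
    exact Finset.sum_comm
  have hpr : ∀ q (r : Fin 3 × ι × ι → k) (t : Fin 3 × ι × ι → Fin 3 → D.E ⊗[k] D.E),
      D.pairing (B' q) (∑ p, r p • t p) = ∑ p, r p * D.pairing (B' q) (t p) := by
    intro s r t
    simp only [pairing, Finset.sum_apply, Pi.smul_apply, map_sum, map_smul, smul_eq_mul,
      Finset.mul_sum]
    exact Finset.sum_comm
  have h1 : ∀ p, D.three (B p) = ∑ q, D.pairing (B' q) (π (B p)) • D.three (B q) := by
    intro p
    have e : D.three (B p) = D.three (π (B p)) := by
      rw [← sub_eq_zero, ← map_sub]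
      exact D.three_eq_zero _ (hπ' _)
    rw [e, ← hsum (π (B p)), map_sum]
    simp only [map_smul]
    rw [hsum]
  have h2 : ∀ q, D.dualThree (∑ p, D.pairing (B' q) (π (B p)) • B' p) = 0 := by
    intro q
    refine D.dualThree_eq_zero _ fun t ht => ?_
    rw [hpl]
    have : D.pairing (B' q) (π (∑ p, D.pairing (B' p) t • B p)) = 0 := by
      rw [hsum, hπ t ht]
      simp [pairing]
    rw [← this, map_sum]
    simp only [map_smul]
    rw [hpr]
    exact Finset.sum_congr rfl fun p _ => mul_comm _ _
  calc ∑ p, hadamardMk D.operad D.dual.operad 3 (D.three (B p)) (D.dualThree (B' p))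
      = ∑ p, ∑ q, D.pairing (B' q) (π (B p)) •
          hadamardMk D.operad D.dual.operad 3 (D.three (B q)) (D.dualThree (B' p)) := by
        refine Finset.sum_congr rfl fun p _ => ?_
        rw [h1 p]
        simp only [map_sum, map_smul, LinearMap.sum_apply, LinearMap.smul_apply]
    _ = ∑ q, hadamardMk D.operad D.dual.operad 3 (D.three (B q))
          (D.dualThree (∑ p, D.pairing (B' q) (π (B p)) • B' p)) := by
        rw [Finset.sum_comm]
        refine Finset.sum_congr rfl fun q _ => ?_
        simp only [map_sum, map_smul]
    _ = 0 := by simp only [h2, map_zero, Finset.sum_const_zero]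

/-- The canonical element of `P ⊗ P^!`, before suspension. -/
noncomputable def canonical₀ : (hadamard D.operad D.dual.operad).obj 2 := D.canonical

theorem canonical₀_eq_sum {ι : Type*} [Fintype ι] (b : Module.Basis ι k D.E) :
    D.canonical₀ = ∑ i, hadamardMk D.operad D.dual.operad 2 (D.gen (b i)) (D.dualGen (b.coord i)) := by
  classical
  have h : (dualTensorHomEquiv k D.E D.E).symm LinearMap.id = ∑ i, b.coord i ⊗ₜ[k] b i := by
    rw [LinearEquiv.symm_apply_eq, map_sum]
    ext e
    simp [b.sum_repr]
  have h' : D.canonical₀ = TensorProduct.map D.gen D.dualGen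
      (TensorProduct.comm k (Module.Dual k D.E) D.E
        ((dualTensorHomEquiv k D.E D.E).symm LinearMap.id)) := rfl
  rw [h', h]
  simp only [map_sum, TensorProduct.comm_tmul, TensorProduct.map_tmul]
  rfl

/-- The Jacobi identity for the canonical element: its summands pair the relations `R` of `P` with
the relations `R^⊥` of `P^!`. -/
theorem canonical₀_jacobi :
    ∑ u : Fin 3, (hadamard D.operad D.dual.operad).act ((finRotate 3) ^ (u : ℕ))
      ((hadamard D.operad D.dual.operad).comp (m := 2) (n := 2) (r := 3) rfl 0
        D.canonical₀ D.canonical₀) = 0 := by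
  have b := Module.Free.chooseBasis k D.E
  rw [D.canonical₀_eq_sum b, ← D.sum_three_dualThree b, Fintype.sum_prod_type]
  refine Finset.sum_congr rfl fun u _ => ?_
  rw [Fintype.sum_prod_type]
  simp only [map_sum, LinearMap.sum_apply, three_single, dualThree_single, hadamard_comp_mk,
    hadamard_act_mk]
  rw [Finset.sum_comm]

/-- The canonical element is antisymmetric in `P ⊗ P^!`. -/
theorem canonical₀_swap :
    (hadamard D.operad D.dual.operad).act (Equiv.swap 0 1) D.canonical₀ = -D.canonical₀ := by
  classical
  have b := Module.Free.chooseBasis k D.E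
  -- The involution `τ` carries `b` to another basis, with dual basis the transposed one.
  let b' := b.map (LinearEquiv.ofInvolutive D.τ D.τ_τ)
  have hb : ∀ i, b' i = D.τ (b i) := fun i => by
    rw [Module.Basis.map_apply]; rfl
  have hc : ∀ i, b'.coord i = D.τ.dualMap (b.coord i) := fun i => by
    refine b'.ext fun j => ?_
    rw [LinearMap.dualMap_apply, hb, D.τ_τ, ← hb, Module.Basis.coord_apply, Module.Basis.coord_apply,
      b'.repr_self, b.repr_self]
  conv_rhs => rw [D.canonical₀_eq_sum b']
  rw [D.canonical₀_eq_sum b, map_sum, ← Finset.sum_neg_distrib]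
  refine Finset.sum_congr rfl fun i _ => ?_
  rw [hadamard_act_mk, dualGen_τ, ← gen_τ, ← hb, ← hc, map_neg]

end QuadraticData

end CohOp

namespace CohOp

open scoped TensorProduct DirectSum

variable {k : Type u} [Field k] {deg : ℕ → ℤ}

/-! ### Suspensions -/

/-- The identification of `P(n)` with the underlying space of its suspension. -/
def toSusp (P : Operad₀ k) (n : ℕ) : P.obj n →ₗ[k] (susp P).obj n := LinearMap.id

theorem susp_act (P : Operad₀ k) {n : ℕ} (σ : Equiv.Perm (Fin n)) (f : P.obj n) :
    (susp P).act σ (toSusp P n f) = Equiv.Perm.sign σ • toSusp P n (P.act σ f) := rfl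

theorem susp_comp (P : Operad₀ k) {m n r : ℕ} (h : r + 1 = m + n) (i : Fin m) (f : P.obj m)
    (g : P.obj n) : (susp P).comp h i (toSusp P m f) (toSusp P n g) =
      ((i : ℤ) * ((n : ℤ) - 1)).negOnePow • toSusp P r (P.comp h i f g) := rfl

theorem hadamard_induction {P Q : Operad₀ k} {n : ℕ} {C : (hadamard P Q).obj n → Prop}
    (zero : C 0) (mk : ∀ p q, C (hadamardMk P Q n p q)) (add : ∀ x y, C x → C y → C (x + y))
    (x : (hadamard P Q).obj n) : C x :=
  TensorProduct.induction_on (motive := C) x zero mk add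

namespace QuadraticData

variable (D : QuadraticData k)

/-- The sign of the suspension makes the antisymmetric canonical element symmetric. -/
theorem canonical_swap : D.suspHadamard.act (Equiv.swap 0 1) D.canonical = D.canonical := by
  have h := susp_act (hadamard D.operad D.dual.operad) (Equiv.swap 0 1) D.canonical₀
  rw [canonical₀_swap, Equiv.Perm.sign_swap (by decide), map_neg, smul_neg, Units.neg_smul,
    neg_neg, one_smul] at h
  exact h

theorem canonical_jacobi :
    ∑ u : Fin 3, D.suspHadamard.act ((finRotate 3) ^ (u : ℕ))
      (D.suspHadamard.comp (m := 2) (n := 2) (r := 3) rfl 0 D.canonical D.canonical) = 0 := by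
  have h := congrArg (toSusp _ 3) D.canonical₀_jacobi
  rw [map_zero, map_sum] at h
  refine Eq.trans (Finset.sum_congr rfl fun u _ => ?_) h
  have e := susp_comp (hadamard D.operad D.dual.operad) (m := 2) (n := 2) (r := 3) rfl 0
    D.canonical₀ D.canonical₀
  have e' := susp_act (hadamard D.operad D.dual.operad) ((finRotate 3) ^ (u : ℕ))
    ((hadamard D.operad D.dual.operad).comp (m := 2) (n := 2) (r := 3) rfl 0
        D.canonical₀ D.canonical₀)
  have hs : Equiv.Perm.sign (finRotate 3 ^ (u : ℕ)) = 1 := by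
    rw [map_pow, sign_finRotate]
    simp
  rw [hs, one_smul] at e'
  refine Eq.trans ?_ e'
  refine congrArg _ (e.trans ?_)
  simp

namespace Alg

variable {D} (X : D.Alg)

/-- The morphism `α ⊗ id : P ⊗ P^! → End_A ⊗ P^!`. -/
def structureMap₀ (n : ℕ) : (hadamard D.operad D.dual.operad).obj n →ₗ[k]
    (hadamard (endOperad k X.A) D.dual.operad).obj n :=
  TensorProduct.map (X.α.map n) LinearMap.id

theorem structureMap₀_mk {n : ℕ} (p : D.operad.obj n) (q : D.dual.operad.obj n) :
    X.structureMap₀ n (hadamardMk _ _ n p q) = hadamardMk _ _ n (X.α.map n p) q := rfl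

theorem structureMap_one : X.structureMap 1 D.suspHadamard.one = X.convOperad.one := by
  refine (X.structureMap₀_mk D.operad.one D.dual.operad.one).trans ?_
  rw [X.α.map_one]
  rfl

theorem structureMap₀_act {n : ℕ} (σ : Equiv.Perm (Fin n))
    (t : (hadamard D.operad D.dual.operad).obj n) :
    X.structureMap₀ n ((hadamard D.operad D.dual.operad).act σ t) =
      (hadamard (endOperad k X.A) D.dual.operad).act σ (X.structureMap₀ n t) := by
  induction t using hadamard_induction with
  | zero => simp only [map_zero]
  | add x y hx hy => simp only [map_add, hx, hy]
  | mk p q => rw [hadamard_act_mk, structureMap₀_mk, structureMap₀_mk, hadamard_act_mk, X.α.map_act]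

theorem structureMap₀_comp {m n r : ℕ} (h : r + 1 = m + n) (i : Fin m)
    (t : (hadamard D.operad D.dual.operad).obj m) (s : (hadamard D.operad D.dual.operad).obj n) :
    X.structureMap₀ r ((hadamard D.operad D.dual.operad).comp h i t s) =
      (hadamard (endOperad k X.A) D.dual.operad).comp h i (X.structureMap₀ m t)
        (X.structureMap₀ n s) := by
  induction t using hadamard_induction with
  | zero => simp only [map_zero, LinearMap.zero_apply]
  | add x y hx hy => simp only [map_add, LinearMap.add_apply, hx, hy]
  | mk p q =>
    induction s using hadamard_induction with
    | zero => simp only [map_zero]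
    | add x y hx hy => simp only [map_add, hx, hy]
    | mk p' q' =>
      rw [hadamard_comp_mk, structureMap₀_mk, structureMap₀_mk, structureMap₀_mk, hadamard_comp_mk,
        X.α.map_comp]

theorem structureMap_act {n : ℕ} (σ : Equiv.Perm (Fin n)) (t : D.suspHadamard.obj n) :
    X.structureMap n (D.suspHadamard.act σ t) = X.convOperad.act σ (X.structureMap n t) := by
  have h := congrArg (fun x => Equiv.Perm.sign σ • toSusp _ n x) (X.structureMap₀_act σ t)
  refine Eq.trans ?_ h
  exact Operad.units_smul_linear _ (X.structureMap n)
    (toSusp _ n ((hadamard D.operad D.dual.operad).act σ t))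

theorem structureMap_comp {m n r : ℕ} (h : r + 1 = m + n) (i : Fin m) (t : D.suspHadamard.obj m)
    (s : D.suspHadamard.obj n) :
    X.structureMap r (D.suspHadamard.comp h i t s) =
      X.convOperad.comp h i (X.structureMap m t) (X.structureMap n s) := by
  have h' := congrArg (fun x => ((i : ℤ) * ((n : ℤ) - 1)).negOnePow • toSusp _ r x)
    (X.structureMap₀_comp h i t s)
  refine Eq.trans ?_ h'
  exact Operad.units_smul_linear _ (X.structureMap r)
    (toSusp _ r ((hadamard D.operad D.dual.operad).comp h i t s))

end Alg

end QuadraticData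

/-! ### The pre-Lie identity -/

/-- A sum over the inputs of `f ∘_i g` splits into the inputs of `g` and the inputs `y ≠ i` of
`f`. -/
theorem sum_blk {M : Type*} [AddCommMonoid M] {m n r : ℕ} (h : r + 1 = m + n) (i : Fin m)
    (F : Fin r → M) :
    ∑ x, F x = ∑ z, F (inBlk h i z) + ∑ y, if hy : y ≠ i then F (outBlk h i y hy) else 0 := by
  classical
  have hb : Function.Bijective (Sum.elim (inBlk h i) fun y : {y : Fin m // y ≠ i} =>
      outBlk h i y.1 y.2) := by
    refine ⟨?_, fun x => ?_⟩
    · rintro (z | y) (z' | y') e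
      · rw [inBlk_injective h i e]
      · exact absurd e (inBlk_ne_outBlk h i z y'.1 y'.2)
      · exact absurd e.symm (inBlk_ne_outBlk h i z' y.1 y.2)
      · exact congrArg Sum.inr (Subtype.ext (outBlk_injective h i _ _ y.2 y'.2 e))
    · rcases in_or_out h i x with ⟨z, rfl⟩ | ⟨y, hy, rfl⟩
      · exact ⟨.inl z, rfl⟩
      · exact ⟨.inr ⟨y, hy⟩, rfl⟩
  rw [← (Equiv.ofBijective _ hb).sum_comp, Fintype.sum_sum_type]
  congr 1
  rw [Finset.sum_dite, Finset.sum_const_zero, add_zero]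
  refine Finset.sum_bij (fun y _ => ⟨y.1, by simpa using y.2⟩) (by simp) ?_ ?_ (fun _ _ => rfl)
  · intro a _ b _ e
    exact Subtype.ext (congrArg (fun x => x.1) e)
  · rintro ⟨y, hy⟩ _
    exact ⟨⟨y, by simpa using hy⟩, Finset.mem_univ _, rfl⟩

namespace Operad

variable (O : Operad k deg)

/-- Composites in which `g` and `h` are inserted into different inputs of `f`, with `g` first. -/
theorem comp_outBlk_swap {m n l r s t : ℕ} (h₁ : r + 1 = m + n) (h₂ : t + 1 = r + l)
    (h₃ : s + 1 = m + l) (h₄ : t + 1 = s + n) (i j : Fin m) (hij : i ≠ j) (f : O.obj m)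
    (g : O.obj n) (g' : O.obj l) :
    O.comp h₂ (outBlk h₁ i j hij.symm) (O.comp h₁ i f g) g' =
      (deg n * deg l).negOnePow • O.comp h₄ (outBlk h₃ j i hij) (O.comp h₃ j f g') g := by
  rcases lt_or_gt_of_ne hij with h | h
  · exact O.comp_par h₁ h₂ h₃ h₄ i j h f g g'
  · rw [O.comp_par h₃ h₄ h₁ h₂ j i h f g' g, smul_smul, mul_comm (deg n), Int.units_mul_self,
      one_smul]

end Operad

namespace QuadraticData

variable {D : QuadraticData k}

namespace Alg

variable (X : D.Alg)

/-- The class in the cochain complex of an element of `𝔰(End_A ⊗ P^!)`. -/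
noncomputable def cls (n : ℕ) : X.convOperad.obj n →ₗ[k] X.Complex := X.convOperad.cls n

theorem cls_comp_congr {m n r r' : ℕ} (h : r + 1 = m + n) (h' : r' + 1 = m + n) (i : Fin m)
    (f : X.convOperad.obj m) (g : X.convOperad.obj n) :
    X.cls r (X.convOperad.comp h i f g) = X.cls r' (X.convOperad.comp h' i f g) :=
  X.convOperad.cls_comp_congr h h' i f g

theorem cls_act {n : ℕ} (σ : Equiv.Perm (Fin n)) (f : X.convOperad.obj n) :
    X.cls n (X.convOperad.act σ f) = X.cls n f := X.convOperad.cls_act σ f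

theorem parity_lof {n : ℕ} (x : X.Cochain n) :
    X.parity (DirectSum.lof k ℕ (fun a => X.Cochain a) n x) =
      ((n : ℤ) - 1).negOnePow • DirectSum.lof k ℕ (fun a => X.Cochain a) n x := by
  rw [parity, DirectSum.toModule_lof]
  rfl

theorem parity_cls {n : ℕ} (f : X.convOperad.obj n) :
    X.parity (X.cls n f) = ((n : ℤ) - 1).negOnePow • X.cls n f := X.parity_lof _

/-- The composite of `f`, `g` and `h` in which `g` is inserted into the input `i` of `f` and `h` into
the input `j` of `f`; by convention it is zero if `j = i`. -/
noncomputable def parallel {a b c : ℕ} (f : X.convOperad.obj (a + 1)) (g : X.convOperad.obj b)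
    (h : X.convOperad.obj c) (i j : Fin (a + 1)) : X.Complex :=
  if hij : j ≠ i then X.cls (a + b + c - 1) (X.convOperad.comp (m := a + b) (n := c)
    (by have : (j : ℕ) ≠ i := fun e => hij (Fin.ext e)
        omega)
    (outBlk (m := a + 1) (n := b) (by omega) i j hij)
    (X.convOperad.comp (m := a + 1) (n := b) (by omega) i f g) h) else 0

theorem parallel_swap {a b c : ℕ} (f : X.convOperad.obj (a + 1)) (g : X.convOperad.obj b)
    (h : X.convOperad.obj c) (i j : Fin (a + 1)) :
    X.parallel f g h i j = (((b : ℤ) - 1) * ((c : ℤ) - 1)).negOnePow • X.parallel f h g j i := by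
  unfold parallel
  by_cases hij : j = i
  · simp [hij]
  rw [dif_pos hij, dif_pos (Ne.symm hij)]
  have hne : (j : ℕ) ≠ i := fun e => hij (Fin.ext e)
  rw [X.convOperad.comp_outBlk_swap (s := a + c) _ _ (by omega) (by omega) i j (Ne.symm hij),
    Operad.units_smul_linear]
  congr 1
  exact X.cls_comp_congr _ _ _ _ _

section

variable [CharZero k]

theorem cls_coe {n : ℕ} (x : X.Cochain n) :
    X.cls n (x : X.convOperad.obj n) = DirectSum.lof k ℕ (fun a => X.Cochain a) n x :=
  X.convOperad.cls_coe x

theorem induction {C : X.Complex → Prop} (zero : C 0)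
    (cls : ∀ n (f : X.convOperad.obj n), C (X.cls n f)) (add : ∀ x y, C x → C y → C (x + y))
    (x : X.Complex) : C x := by
  induction x using DirectSum.induction_on with
  | zero => exact zero
  | of n x => have := cls n x; rwa [cls_coe] at this
  | add x y hx hy => exact add x y hx hy

theorem parity_parity (x : X.Complex) : X.parity (X.parity x) = x := by
  induction x using X.induction with
  | zero => simp
  | add x y hx hy => rw [map_add, map_add, hx, hy]
  | cls n f => rw [parity_cls, Operad.units_smul_linear, parity_cls, smul_smul, Int.units_mul_self,
      one_smul]

/-- The pre-Lie product of two classes can be computed on any representatives, without averaging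
them first. -/
theorem preLie_cls {a b : ℕ} (f : X.convOperad.obj a) (g : X.convOperad.obj b) :
    X.preLie (X.cls a f) (X.cls b g) = ∑ i : Fin a, X.cls (a + b - 1)
      (X.convOperad.comp (by have := i.pos; omega) i f g) := by
  have h1 : ∀ f' g', X.preLie (DirectSum.lof k ℕ (fun a => X.Cochain a) a f')
      (DirectSum.lof k ℕ (fun a => X.Cochain a) b g') = ∑ i : Fin a, X.cls (a + b - 1)
      (X.convOperad.comp (by have := i.pos; omega) i f'.1 g'.1) := by
    intro f' g'
    rw [preLie, DirectSum.toModule_lof, LinearMap.flip_apply, DirectSum.toModule_lof,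
      LinearMap.flip_apply, LinearMap.compr₂_apply, preLieHom, LinearMap.compl₁₂_apply,
      LinearMap.compr₂_apply, LinearMap.sum_apply, LinearMap.sum_apply, map_sum, map_sum]
    rfl
  let L : X.convOperad.obj a →ₗ[k] X.convOperad.obj b →ₗ[k] X.Complex :=
    (∑ i : Fin a, X.convOperad.comp (r := a + b - 1) (by have := i.pos; omega) i).compr₂
      (X.cls (a + b - 1))
  have hL : ∀ f g, L f g = ∑ i : Fin a, X.cls (a + b - 1)
      (X.convOperad.comp (by have := i.pos; omega) i f g) := by
    intro f g
    simp only [L, LinearMap.compr₂_apply, LinearMap.sum_apply, map_sum]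
  refine (h1 _ _).trans ?_
  rw [← hL, ← hL]
  have e1 := X.convOperad.apply_aver (L.flip (X.convOperad.aver b g : X.convOperad.obj b))
    (fun σ f => by
      rw [LinearMap.flip_apply, LinearMap.flip_apply, hL, hL]
      rw [← Equiv.sum_comp σ fun i => X.cls (a + b - 1)
        (X.convOperad.comp (by have := i.pos; omega) i f _)]
      refine Finset.sum_congr rfl fun i _ => ?_
      obtain ⟨ρ, -, e⟩ := X.convOperad.act_comp (r := a + b - 1) (by have := i.pos; omega) i σ f
        (X.convOperad.aver b g : X.convOperad.obj b)
      rw [e, cls_act]) f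
  have e2 := X.convOperad.apply_aver (L f)
    (fun σ g => by
      rw [hL, hL]
      refine Finset.sum_congr rfl fun i _ => ?_
      obtain ⟨ρ, -, e⟩ := X.convOperad.comp_act_right (r := a + b - 1) (by have := i.pos; omega) i σ
        f g
      rw [e, cls_act]) g
  exact e1.trans e2

theorem preLie_cls' {a b r : ℕ} (h : r + 1 = a + b) (f : X.convOperad.obj a)
    (g : X.convOperad.obj b) :
    X.preLie (X.cls a f) (X.cls b g) = ∑ i : Fin a, X.cls r (X.convOperad.comp h i f g) := by
  rw [preLie_cls]
  exact Finset.sum_congr rfl fun i _ => X.cls_comp_congr _ _ _ _ _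

/-- The associator of the pre-Lie product consists of the parallel insertions. -/
theorem preLie_associator {a b c : ℕ} (f : X.convOperad.obj (a + 1))
    (g : X.convOperad.obj b) (h : X.convOperad.obj c) :
    X.preLie (X.preLie (X.cls _ f) (X.cls b g)) (X.cls c h) -
      X.preLie (X.cls _ f) (X.preLie (X.cls b g) (X.cls c h)) =
    ∑ i, ∑ j, X.parallel f g h i j := by
  have hab : a + b + 1 = (a + 1) + b := by omega
  rw [preLie_cls' X hab, X.preLie_cls g h, map_sum, map_sum, LinearMap.sum_apply]
  have hR : ∑ z : Fin b, X.preLie (X.cls _ f) (X.cls (b + c - 1)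
      (X.convOperad.comp (by have := z.pos; omega) z g h)) =
      ∑ i : Fin (a + 1), ∑ z : Fin b, X.cls (a + b + c - 1)
        (X.convOperad.comp (m := a + 1) (n := b + c - 1) (by have := z.pos; omega) i f
          (X.convOperad.comp (m := b) (n := c) (by have := z.pos; omega) z g h)) := by
    rw [Finset.sum_comm]
    exact Finset.sum_congr rfl fun z _ => X.preLie_cls' _ _ _
  rw [hR, ← Finset.sum_sub_distrib]
  refine Finset.sum_congr rfl fun i _ => ?_
  -- The insertions of `h` into `g` cancel, by sequential associativity.
  rw [X.preLie_cls, sum_blk hab i, add_comm, add_sub_assoc, add_eq_left.2]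
  · rfl
  · rw [sub_eq_zero]
    refine Finset.sum_congr rfl fun z _ => ?_
    have hz := z.pos
    rw [X.cls_comp_congr (r' := a + b + c - 1) _ (by omega), X.convOperad.comp_seq]

/-- The graded right-symmetry of the pre-Lie product, with one argument of degree one. -/
theorem preLie_right_symm (f g : X.Complex) (x : X.convOperad.obj 2) :
    X.preLie (X.preLie f g) (X.cls 2 x) - X.preLie f (X.preLie g (X.cls 2 x)) =
      X.preLie (X.preLie f (X.cls 2 x)) (X.parity g) -
        X.preLie f (X.preLie (X.cls 2 x) (X.parity g)) := by
  induction f using X.induction with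
  | zero => simp
  | add f f' hf hf' =>
    simp only [map_add, LinearMap.add_apply, add_sub_add_comm, hf, hf']
  | cls a f =>
    induction g using X.induction with
    | zero => simp
    | add g g' hg hg' => simp only [map_add, LinearMap.add_apply, add_sub_add_comm, hg, hg']
    | cls b g =>
      obtain _ | a := a
      -- A cochain of arity zero has no inputs, so its products on the left vanish.
      · have : ∀ {c : ℕ} (h : X.convOperad.obj c), X.preLie (X.cls 0 f) (X.cls c h) = 0 :=
          fun h => by rw [preLie_cls]; simp
        have h0 : X.preLie (X.cls 0 f) = 0 := by
          refine LinearMap.ext fun y => ?_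
          induction y using X.induction with
          | zero => simp
          | add y y' hy hy' => rw [map_add, hy, hy', map_add]
          | cls c h => exact this h
        simp [h0]
      · rw [parity_cls, Operad.units_smul_linear, Operad.units_smul_linear,
          Operad.units_smul_linear, preLie_associator]
        have h1 := X.preLie_associator f x g
        have h2 : ∑ i, ∑ j, X.parallel f g x i j =
            ((b : ℤ) - 1).negOnePow • ∑ i, ∑ j, X.parallel f x g i j := by
          rw [Finset.sum_comm, Finset.smul_sum]
          refine Finset.sum_congr rfl fun i _ => ?_
          rw [Finset.smul_sum]
          refine Finset.sum_congr rfl fun j _ => ?_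
          rw [parallel_swap]
          norm_num
        rw [h2, ← h1]
        exact smul_sub _ _ _

end

end Alg

end QuadraticData

end CohOp

namespace CohOp

open scoped TensorProduct DirectSum

variable {k : Type u} [Field k] {deg : ℕ → ℤ}

namespace QuadraticData

variable {D : QuadraticData k}

namespace Alg

variable (X : D.Alg)

/-! ### The differential -/

/-- The image of the canonical element in `𝔰(End_A ⊗ P^!)`. -/
noncomputable def chi : X.convOperad.obj 2 := X.structureMap 2 D.canonical

theorem complex_smul_sub (c : k) (x y : X.Complex) : c • (x - y) = c • x - c • y := smul_sub c x y

theorem structureCochain_eq : X.structureCochain = (2⁻¹ : k) • X.cls 2 X.chi := by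
  rw [structureCochain, map_smul]
  rfl

theorem d_apply (f : X.Complex) :
    X.d f = X.preLie X.structureCochain f - X.preLie (X.parity f) X.structureCochain := rfl

theorem parity_structureCochain : X.parity X.structureCochain = -X.structureCochain := by
  have h : X.parity (X.cls 2 X.chi) = -X.cls 2 X.chi := by
    rw [parity_cls]
    exact (by norm_num : (((2 : ℕ) : ℤ) - 1).negOnePow • X.cls 2 X.chi = -X.cls 2 X.chi)
  rw [structureCochain_eq, map_smul, h]
  exact smul_neg _ _

theorem chi_swap : X.convOperad.act (Equiv.swap 0 1) X.chi = X.chi := by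
  rw [chi, ← structureMap_act, canonical_swap]

/-- Insertions into the two inputs of `χ` have the same class, since `χ` is symmetric. -/
theorem cls_chi_comp_one {n : ℕ} (f : X.convOperad.obj n) :
    X.cls (n + 1) (X.convOperad.comp (m := 2) (by omega) 1 X.chi f) =
      X.cls (n + 1) (X.convOperad.comp (m := 2) (by omega) 0 X.chi f) := by
  conv_lhs => rw [← chi_swap]
  obtain ⟨ρ, -, e⟩ := X.convOperad.act_comp (m := 2) (r := n + 1) (n := n) (by omega) 1
    (Equiv.swap 0 1) X.chi f
  rw [e, cls_act, Equiv.swap_apply_right]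

variable [CharZero k]

theorem parity_preLie (f g : X.Complex) :
    X.parity (X.preLie f g) = X.preLie (X.parity f) (X.parity g) := by
  induction f using X.induction with
  | zero => simp
  | add f f' hf hf' => simp only [map_add, LinearMap.add_apply, hf, hf']
  | cls a f =>
    induction g using X.induction with
    | zero => simp
    | add g g' hg hg' => simp only [map_add, hg, hg']
    | cls b g =>
      rw [parity_cls, parity_cls, Operad.units_smul_linear₂, Operad.units_smul_linear, smul_smul,
        preLie_cls, map_sum, Finset.smul_sum]
      refine Finset.sum_congr rfl fun i _ => ?_
      have hi := i.pos
      rw [parity_cls, ← Int.negOnePow_add]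
      congr 2
      omega

/-- The master equation for the structure cochain. -/
theorem preLie_structureCochain_self : X.preLie X.structureCochain X.structureCochain = 0 := by
  -- The three summands of the Jacobi identity have the same class.
  have h3 : (3 : k) •
      X.cls 3 (X.convOperad.comp (m := 2) (n := 2) (r := 3) rfl 0 X.chi X.chi) = 0 := by
    have h := congrArg (fun t => X.cls 3 (X.structureMap 3 t)) D.canonical_jacobi
    simp only [map_zero, map_sum, structureMap_act, cls_act, structureMap_comp, Finset.sum_const,
      Finset.card_univ, Fintype.card_fin] at h
    rw [← Nat.cast_smul_eq_nsmul k] at h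
    exact_mod_cast h
  have h0 := (smul_eq_zero.1 h3).resolve_left (by norm_num)
  have e := X.preLie_cls X.chi X.chi
  rw [Fin.sum_univ_two] at e
  have e1 := X.cls_chi_comp_one X.chi
  have : X.preLie (X.cls 2 X.chi) (X.cls 2 X.chi) = 0 := by
    rw [e]
    exact (congrArg₂ (· + ·) h0 (e1.trans h0)).trans (add_zero 0)
  simp only [structureCochain_eq, map_smul, LinearMap.smul_apply, this, smul_zero]

theorem preLie_right_symm_structureCochain (f g : X.Complex) :
    X.preLie (X.preLie f g) X.structureCochain - X.preLie f (X.preLie g X.structureCochain) =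
      X.preLie (X.preLie f X.structureCochain) (X.parity g) -
        X.preLie f (X.preLie X.structureCochain (X.parity g)) := by
  simp only [structureCochain_eq, map_smul, LinearMap.smul_apply, ← complex_smul_sub]
  rw [X.preLie_right_symm]

theorem parity_d (f : X.Complex) : X.parity (X.d f) = -X.d (X.parity f) := by
  simp only [d_apply, map_sub, parity_preLie, parity_structureCochain, map_neg, LinearMap.neg_apply]
  abel

/-- `d² = 0`, from `μ ∘ μ = 0` and right symmetry of the associator. -/
theorem d_d (f : X.Complex) : X.d (X.d f) = 0 := by
  have h1 := X.preLie_right_symm_structureCochain X.structureCochain (X.parity f)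
  have h2 := X.preLie_right_symm_structureCochain f X.structureCochain
  have hself := X.preLie_structureCochain_self
  rw [parity_parity, hself, map_zero, LinearMap.zero_apply] at h1
  rw [parity_structureCochain] at h2
  simp only [map_neg, hself, map_zero, sub_zero, neg_zero] at h2
  -- As `μ` has odd degree, right symmetry says that `(f ∘ μ) ∘ μ` equals its negative.
  have h3 : X.preLie (X.preLie f X.structureCochain) X.structureCochain = 0 := by
    have h4 : (2 : k) • X.preLie (X.preLie f X.structureCochain) X.structureCochain = 0 := by
      rw [two_smul]
      nth_rewrite 1 [h2]
      exact neg_add_cancel _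
    exact (smul_eq_zero.1 h4).resolve_left two_ne_zero
  simp only [d_apply, map_sub, parity_preLie, parity_structureCochain, parity_parity, map_neg,
    LinearMap.neg_apply, h3]
  rw [zero_sub] at h1
  rw [sub_eq_iff_eq_add] at h1
  rw [h1]
  abel

end Alg

/-! ### Operations on the cochain complex -/

variable (D) in
theorem cup_lof [CharZero k] {n : ℕ} (t : D.suspHadamard.obj n) (X : D.Alg) (a : Fin n → ℕ)
    (x : ∀ i, X.Cochain (a i)) :
    D.cup t X (fun i => DirectSum.lof k ℕ (fun a => X.Cochain a) (a i) (x i)) =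
      X.cls _ (X.convOperad.fullComp a (X.structureMap n t)
        fun i => (x i : X.convOperad.obj (a i))) := by
  rw [cup, MultilinearMap.fromDirectSumEquiv_lof]
  rfl

end QuadraticData

end CohOp

namespace CohOp

open scoped TensorProduct DirectSum

variable {k : Type u} [Field k] {deg : ℕ → ℤ}

/-! ### Partial compositions and permutations -/

namespace Operad

variable (O : Operad k deg)

theorem partialComp_add_left {n : ℕ} (a : Fin n → ℕ) (t t' : O.obj n) (f : ∀ i, O.obj (a i)) :
    ∀ j (hj : j ≤ n), O.partialComp a (t + t') f j hj =
      O.partialComp a t f j hj + O.partialComp a t' f j hj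
  | 0, _ => rfl
  | j + 1, hj => by
    rw [partialComp_step, partialComp_add_left a t t' f j, map_add, LinearMap.add_apply]
    rfl

theorem partialComp_smul_left {n : ℕ} (a : Fin n → ℕ) (c : k) (t : O.obj n)
    (f : ∀ i, O.obj (a i)) :
    ∀ j (hj : j ≤ n), O.partialComp a (c • t) f j hj = c • O.partialComp a t f j hj
  | 0, _ => rfl
  | j + 1, hj => by
    rw [partialComp_step, partialComp_smul_left a c t f j, map_smul, LinearMap.smul_apply]
    rfl

/-- Every partial composition is, up to permutations of inputs, one into the first input. -/
theorem comp_eq_act_comp_zero {m n r : ℕ} (h : r + 1 = m + 1 + n) (i : Fin (m + 1))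
    (t : O.obj (m + 1)) (s : O.obj n) :
    ∃ σ ρ, O.comp h i t s = O.act ρ (O.comp h 0 (O.act σ t) s) := by
  obtain ⟨ρ, -, e⟩ := O.act_comp h i (Equiv.swap i 0) (O.act (Equiv.swap i 0) t) s
  rw [← O.act_mul, Equiv.swap_mul_self, O.act_one, Equiv.swap_apply_left] at e
  exact ⟨_, ρ, e⟩

/-- A property stable under adjacent transpositions is stable under all permutations. -/
theorem act_induction {n : ℕ} {C : O.obj n → Prop}
    (hC : ∀ j (hj : j + 1 < n) t, C t → C (O.act (Equiv.swap ⟨j, by omega⟩ ⟨j + 1, hj⟩) t))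
    (σ : Equiv.Perm (Fin n)) (t : O.obj n) (ht : C t) : C (O.act σ t) := by
  obtain _ | n := n
  · rw [Subsingleton.elim σ 1, O.act_one]
    exact ht
  have hσ : σ ∈ Submonoid.closure (Set.range fun i : Fin n => Equiv.swap i.castSucc i.succ) := by
    rw [Equiv.Perm.mclosure_swap_castSucc_succ]
    trivial
  induction hσ using Submonoid.closure_induction generalizing t with
  | mem σ h =>
    obtain ⟨i, rfl⟩ := h
    exact hC i (by omega) t ht
  | one => rwa [O.act_one]
  | mul σ τ _ _ hσ hτ =>
    rw [O.act_mul]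
    exact hτ _ (hσ _ ht)

end Operad

namespace QuadraticData

variable {D : QuadraticData k}

namespace Alg

variable (X : D.Alg)

/-! ### Homogeneous cochains and the differential of operations -/

/-- The homogeneous cochains of arity `n`. -/
def homogeneous (n : ℕ) : Submodule k X.Complex :=
  LinearMap.range (DirectSum.lof k ℕ (fun a => X.Cochain a) n)

theorem cls_mem (n : ℕ) (f : X.convOperad.obj n) : X.cls n f ∈ X.homogeneous n := ⟨_, rfl⟩

theorem parity_of_mem {n : ℕ} {f : X.Complex} (hf : f ∈ X.homogeneous n) :
    X.parity f = ((n : ℤ) - 1).negOnePow • f := by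
  obtain ⟨x, rfl⟩ := hf
  exact X.parity_lof x

theorem parity_mem {n : ℕ} {f : X.Complex} (hf : f ∈ X.homogeneous n) :
    X.parity f ∈ X.homogeneous n := by
  rw [X.parity_of_mem hf]
  exact (Operad.units_smul_mem_iff _ _).2 hf

theorem d_mem [CharZero k] {n : ℕ} {f : X.Complex} (hf : f ∈ X.homogeneous n) :
    X.d f ∈ X.homogeneous (n + 1) := by
  have h := X.parity_mem hf
  obtain ⟨x, rfl⟩ := hf
  obtain ⟨y, hy⟩ := h
  rw [d_apply, ← hy, ← cls_coe, ← cls_coe, structureCochain_eq]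
  simp only [map_smul, LinearMap.smul_apply]
  refine sub_mem (Submodule.smul_mem _ _ ?_) (Submodule.smul_mem _ _ ?_)
  · rw [X.preLie_cls' (r := n + 1) (by omega)]
    exact Submodule.sum_mem _ fun i _ => X.cls_mem _ _
  · rw [X.preLie_cls' (r := n + 1) (by omega)]
    exact Submodule.sum_mem _ fun i _ => X.cls_mem _ _

/-- The arguments `(-1)^{|f_1| + ⋯ + |f_{i-1}|} (f_1, …, d f_i, …, f_n)` in the definition of
`δ_P`. -/
noncomputable def twist {n : ℕ} (i : Fin n) (f : Fin n → X.Complex) : Fin n → X.Complex :=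
  fun j => if j < i then X.parity (f j) else if j = i then X.d (f j) else f j

end Alg

namespace Operation

theorem delta_apply {n : ℕ} (e : ℤ) (U : D.Operation n) (X : D.Alg) (f : Fin n → X.Complex) :
    delta e U X f = X.d (U X f) - e.negOnePow • ∑ i, U X (X.twist i f) := by
  have h : ∀ i : Fin n, (fun j => (if j < i then X.parity else if j = i then X.d else LinearMap.id :
      X.Complex →ₗ[k] X.Complex) (f j)) = X.twist i f := by
    intro i
    funext j
    unfold Alg.twist
    split_ifs <;> rfl
  rw [delta, sub_apply]
  congr 1
  rw [smul_apply, sum_apply]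
  congr 1
  refine Finset.sum_congr rfl fun i _ => ?_
  rw [MultilinearMap.compLinearMap_apply, ← h]

/-- Operations are determined by their values on homogeneous cochains. -/
theorem ext_homogeneous {n : ℕ} {U V : D.Operation n}
    (h : ∀ (X : D.Alg) (a : Fin n → ℕ) (f : Fin n → X.Complex),
      (∀ i, f i ∈ X.homogeneous (a i)) → U X f = V X f) : U = V := by
  funext X
  refine (MultilinearMap.fromDirectSumEquiv (R := k) (κ := fun _ : Fin n => ℕ)).symm.injective ?_
  funext a
  refine MultilinearMap.ext fun x => ?_
  rw [MultilinearMap.fromDirectSumEquiv_symm_apply, MultilinearMap.fromDirectSumEquiv_symm_apply]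
  exact h X a _ fun i => ⟨x i, rfl⟩

theorem ext_lof {n : ℕ} {U V : D.Operation n}
    (h : ∀ (X : D.Alg) (a : Fin n → ℕ) (x : ∀ i, X.Cochain (a i)),
      U X (fun i => DirectSum.lof k ℕ (fun a => X.Cochain a) (a i) (x i)) =
        V X (fun i => DirectSum.lof k ℕ (fun a => X.Cochain a) (a i) (x i))) : U = V :=
  ext_homogeneous fun X a f hf => by
    choose x hx using hf
    obtain rfl : (fun i => DirectSum.lof k ℕ (fun a => X.Cochain a) (a i) (x i)) = f := funext hx
    exact h X a x

theorem ext_apply {n : ℕ} {U V : D.Operation n}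
    (h : ∀ (X : D.Alg) (f : Fin n → X.Complex), U X f = V X f) : U = V :=
  funext fun X => MultilinearMap.ext (h X)

theorem delta_add {n : ℕ} (e : ℤ) (U V : D.Operation n) :
    delta e (U + V) = delta e U + delta e V := by
  refine ext_apply fun X f => ?_
  rw [Pi.add_apply, add_apply, delta_apply, delta_apply, delta_apply]
  simp only [Pi.add_apply, add_apply, map_add, Finset.sum_add_distrib, smul_add]
  abel

theorem delta_smul {n : ℕ} (e : ℤ) (c : k) (U : D.Operation n) :
    delta e (c • U) = c • delta e U := by
  refine ext_apply fun X f => ?_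
  rw [Pi.smul_apply, smul_apply, delta_apply, delta_apply]
  simp only [Pi.smul_apply, smul_apply, map_smul, ← Finset.smul_sum]
  rw [smul_comm]
  exact (smul_sub _ _ _).symm

theorem delta_zero {n : ℕ} (e : ℤ) : delta e (0 : D.Operation n) = 0 := by
  have := delta_smul e (0 : k) (0 : D.Operation n)
  simpa using this

/-! ### Insertion of one operation into the first argument of another -/

/-- The composite `U(V(f_1, …, f_l), f_{l+1}, …, f_{l+m})`. -/
noncomputable def compZero {l m : ℕ} (U : D.Operation (m + 1)) (V : D.Operation l) :
    D.Operation (l + m) := fun X =>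
  MultilinearMap.domDomCongr finSumFinEquiv
    (((U X).curryLeft.compMultilinearMap (V X)).uncurrySum)

theorem compZero_apply {l m : ℕ} (U : D.Operation (m + 1)) (V : D.Operation l) (X : D.Alg)
    (f : Fin (l + m) → X.Complex) :
    compZero U V X f = (U X).curryLeft (V X fun i => f (Fin.castAdd m i))
      (fun i => f (Fin.natAdd l i)) := by
  rfl

/-- `δ` is a derivation for the insertion into a `δ`-closed operation `U`; the hypothesis `hV` says
that `V` is homogeneous of degree `eV`. -/
theorem delta_compZero {l m : ℕ} {eU eV : ℤ} {U : D.Operation (m + 1)} {V : D.Operation l}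
    (hU : delta eU U = 0)
    (hV : ∀ X f, V X (fun i => X.parity (f i)) = eV.negOnePow • X.parity (V X f)) :
    delta (eU + eV) (compZero U V) = eU.negOnePow • compZero U (delta eV V) := by
  refine ext_apply fun X f => ?_
  set f' : Fin l → X.Complex := fun i => f (Fin.castAdd m i) with hf'
  set f'' : Fin m → X.Complex := fun i => f (Fin.natAdd l i) with hf''
  have hcl : ∀ i : Fin l, compZero U V X (X.twist (Fin.castAdd m i) f) =
      (U X).curryLeft (V X (X.twist i f')) f'' := by
    intro i
    rw [compZero_apply]
    congr 2
    · congr 1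
      funext j
      have h1 : Fin.castAdd m j < Fin.castAdd m i ↔ j < i := Iff.rfl
      simp [Alg.twist, hf', h1]
    funext j
    have h1 : ¬ Fin.natAdd l j < Fin.castAdd m i := by
      rw [Fin.lt_def, Fin.val_natAdd, Fin.val_castAdd]; omega
    have h2 : Fin.natAdd l j ≠ Fin.castAdd m i := by
      rw [Ne, Fin.ext_iff, Fin.val_natAdd, Fin.val_castAdd]; omega
    rw [Alg.twist, if_neg h1, if_neg h2]
  have hcr : ∀ i : Fin m, compZero U V X (X.twist (Fin.natAdd l i) f) =
      (U X).curryLeft (V X fun j => X.parity (f' j)) (X.twist i f'') := by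
    intro i
    rw [compZero_apply]
    congr 2
    · congr 1
      funext j
      have h1 : Fin.castAdd m j < Fin.natAdd l i := by
        rw [Fin.lt_def, Fin.val_natAdd, Fin.val_castAdd]; omega
      rw [Alg.twist, if_pos h1]
    · funext j
      simp [Alg.twist, hf'']
  -- Closedness of `U` at the arguments `V(f_1, …, f_l), f_{l+1}, …` expresses `d` of its value.
  have hU' := congrArg (fun W => W X (Fin.cons (V X f') f'')) hU
  simp only [delta_apply] at hU'
  have htw0 : U X (X.twist 0 (Fin.cons (V X f') f'')) = (U X).curryLeft (X.d (V X f')) f'' := by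
    rw [MultilinearMap.curryLeft_apply]
    congr 1
    funext j
    refine Fin.cases ?_ (fun j => ?_) j
    · simp [Alg.twist]
    · simp [Alg.twist]
  have htws : ∀ i : Fin m, U X (X.twist i.succ (Fin.cons (V X f') f'')) =
      (U X).curryLeft (X.parity (V X f')) (X.twist i f'') := by
    intro i
    rw [MultilinearMap.curryLeft_apply]
    congr 1
    funext j
    refine Fin.cases ?_ (fun j => ?_) j
    · simp [Alg.twist]
    · simp [Alg.twist]
  rw [Fin.sum_univ_succ, htw0] at hU'
  simp only [htws] at hU'
  have hU2 : X.d ((U X).curryLeft (V X f') f'') = eU.negOnePow •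
      ((U X).curryLeft (X.d (V X f')) f'' +
        ∑ i, (U X).curryLeft (X.parity (V X f')) (X.twist i f'')) := sub_eq_zero.1 hU'
  have hR : (eU.negOnePow • compZero U (delta eV V)) X f =
      eU.negOnePow • (U X).curryLeft (delta eV V X f') f'' := rfl
  rw [hR, delta_apply, delta_apply, Fin.sum_univ_add]
  simp only [hcl, hcr, hV]
  rw [compZero_apply, hU2, Int.negOnePow_add]
  rcases Int.units_eq_one_or eU.negOnePow with h1 | h1 <;>
  rcases Int.units_eq_one_or eV.negOnePow with h2 | h2 <;>
  · rw [h1, h2]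
    simp only [one_smul, mul_one, Units.neg_smul, mul_neg, neg_neg, map_sub, map_neg, map_sum,
      sub_apply, neg_apply, sum_apply,
      Finset.sum_neg_distrib]
    abel

end Operation

end QuadraticData

end CohOp

namespace CohOp

open scoped TensorProduct DirectSum

variable {k : Type u} [Field k] {deg : ℕ → ℤ}

/-! ### Koszul signs -/

/-- The Koszul sign of the exchange of two elements of the given parities. -/
def koszul (s t : ℤˣ) : ℤˣ := if s = -1 ∧ t = -1 then -1 else 1

theorem koszul_neg_left : ∀ s t : ℤˣ, koszul (-s) t * t = koszul s t := by decide

theorem koszul_neg_right : ∀ s t : ℤˣ, koszul s (-t) * s = koszul s t := by decide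

theorem negOnePow_mul (a b : ℤ) : (a * b).negOnePow = koszul a.negOnePow b.negOnePow := by
  rcases Int.even_or_odd a with ha | ha
  · rw [Int.negOnePow_even _ (ha.mul_right b), Int.negOnePow_even _ ha]
    simp [koszul]
  · rcases Int.even_or_odd b with hb | hb
    · rw [Int.negOnePow_even _ (hb.mul_left a), Int.negOnePow_even _ hb]
      simp [koszul]
    · rw [Int.negOnePow_odd _ (ha.mul hb), Int.negOnePow_odd _ ha, Int.negOnePow_odd _ hb]
      simp [koszul]

namespace QuadraticData

variable {D : QuadraticData k}

namespace Operation

/-! ### The Koszul exchange of adjacent arguments -/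

/-- The sign `(-1)^{a-1}` of a cochain of arity `a`. -/
def sgn (a : ℕ) : ℤˣ := ((a : ℤ) - 1).negOnePow

theorem sgn_succ (a : ℕ) : sgn (a + 1) = -sgn a := by
  rw [sgn, sgn, ← Int.negOnePow_succ]
  congr 1
  push_cast
  ring

/-- `U'` is obtained from `U` by exchanging the arguments `x` and `y`, with the Koszul sign. -/
def IsSwap {n : ℕ} (x y : Fin n) (U U' : D.Operation n) : Prop :=
  ∀ (X : D.Alg) (a : Fin n → ℕ) (f : Fin n → X.Complex), (∀ i, f i ∈ X.homogeneous (a i)) →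
    U' X f = koszul (sgn (a x)) (sgn (a y)) • U X fun i => f (Equiv.swap x y i)

theorem IsSwap.unique {n : ℕ} {x y : Fin n} {U U' U'' : D.Operation n} (h : IsSwap x y U U')
    (h' : IsSwap x y U U'') : U' = U'' :=
  ext_homogeneous fun X a f hf => (h X a f hf).trans (h' X a f hf).symm

theorem IsSwap.eq_zero {n : ℕ} {x y : Fin n} {U : D.Operation n} (h : IsSwap x y 0 U) : U = 0 :=
  ext_homogeneous fun X a f hf => (h X a f hf).trans (smul_zero _)

/-- Rescaling one argument by a sign. -/
theorem map_units_smul {n : ℕ} (U : D.Operation n) (X : D.Alg) (g g' : Fin n → X.Complex)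
    (x : Fin n) (s : ℤˣ) (h : ∀ i, i ≠ x → g' i = g i) (hx : g' x = s • g x) :
    U X g' = s • U X g := by
  have e : g' = Function.update g x (s • g x) := by
    funext i
    by_cases hi : i = x
    · subst hi; simp [hx]
    · simp [hi, h i hi]
  rw [e]
  rcases Int.units_eq_one_or s with rfl | rfl
  · simp
  · rw [Units.neg_smul, one_smul, Units.neg_smul, one_smul, MultilinearMap.map_update_neg,
      Function.update_eq_self]

/-- The differential is compatible with the exchange of adjacent arguments. -/
theorem IsSwap.delta [CharZero k] {n : ℕ} {x y : Fin n} (hxy : (y : ℕ) = x + 1) (e : ℤ)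
    {U U' : D.Operation n} (h : IsSwap x y U U') : IsSwap x y (delta e U) (delta e U') := by
  intro X a f hf
  have hne : x ≠ y := fun e => by rw [e] at hxy; omega
  have hlt : x < y := Fin.lt_def.2 (by omega)
  have htw : ∀ i j, X.twist i f j ∈ X.homogeneous (Function.update a i (a i + 1) j) := by
    intro i j
    unfold Alg.twist
    split_ifs with h1 h2
    · rw [Function.update_of_ne h1.ne]
      exact X.parity_mem (hf j)
    · subst h2
      rw [Function.update_self]
      exact X.d_mem (hf j)
    · rw [Function.update_of_ne h2]
      exact hf j
  -- The terms of `δ` are permuted among each other. For `i = x, y` the change of the degree of `f i`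
  -- in the Koszul sign is compensated by the sign that `d` acquires in passing the other argument.
  have key : ∀ i, U' X (X.twist i f) = koszul (sgn (a x)) (sgn (a y)) •
      U X (X.twist (Equiv.swap x y i) fun j => f (Equiv.swap x y j)) := by
    intro i
    rw [h X _ _ (htw i)]
    by_cases hix : i = x
    · subst hix
      rw [Function.update_self, Function.update_of_ne hne.symm, sgn_succ,
        ← koszul_neg_left (sgn (a i)), mul_smul, Equiv.swap_apply_left]
      congr 1
      have hs := map_units_smul U X (fun j => X.twist i f (Equiv.swap i y j))
        (X.twist y fun j => f (Equiv.swap i y j)) i (sgn (a y)) (fun j hj => ?_) ?_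
      · rw [hs, smul_smul, Int.units_mul_self, one_smul]
      · by_cases hjy : j = y
        · subst hjy
          simp [Alg.twist]
        · have h1 : j ≠ i := hj
          rw [Alg.twist, Alg.twist, Equiv.swap_apply_of_ne_of_ne hj hjy]
          have : (j : ℕ) ≠ i := fun e => hj (Fin.ext e)
          have : (j : ℕ) ≠ y := fun e => hjy (Fin.ext e)
          have h2 : j < y ↔ j < i := by rw [Fin.lt_def, Fin.lt_def]; omega
          simp only [h2, hjy, h1, if_false]
      · simp only [Alg.twist, hlt, if_true, Equiv.swap_apply_left, hne.symm, if_false,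
          not_lt_of_gt hlt]
        exact X.parity_of_mem (hf y)
    by_cases hiy : i = y
    · subst hiy
      rw [Function.update_self, Function.update_of_ne hne, sgn_succ,
        ← koszul_neg_right (sgn (a x)) (sgn (a i)), mul_smul, Equiv.swap_apply_right]
      congr 1
      refine map_units_smul U X (X.twist x fun j => f (Equiv.swap x i j))
        (fun j => X.twist i f (Equiv.swap x i j)) i (sgn (a x)) (fun j hj => ?_) ?_
      · by_cases hjx : j = x
        · subst hjx
          simp [Alg.twist]
        · have h1 : j ≠ i := hj
          rw [Alg.twist, Alg.twist, Equiv.swap_apply_of_ne_of_ne hjx hj]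
          have : (j : ℕ) ≠ i := fun e => hj (Fin.ext e)
          have : (j : ℕ) ≠ x := fun e => hjx (Fin.ext e)
          have h2 : j < x ↔ j < i := by rw [Fin.lt_def, Fin.lt_def]; omega
          simp only [h2, hjx, h1, if_false]
      · simp only [Alg.twist, hlt, if_true, Equiv.swap_apply_right, hne.symm, if_false,
          not_lt_of_gt hlt]
        exact X.parity_of_mem (hf x)
    rw [Function.update_of_ne (Ne.symm hix), Function.update_of_ne (Ne.symm hiy),
      Equiv.swap_apply_of_ne_of_ne hix hiy]
    congr 2
    funext j
    have : (i : ℕ) ≠ x := fun e => hix (Fin.ext e)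
    have : (i : ℕ) ≠ y := fun e => hiy (Fin.ext e)
    have h1 : Equiv.swap x y j < i ↔ j < i := by
      by_cases hjx : j = x
      · subst hjx; rw [Equiv.swap_apply_left, Fin.lt_def, Fin.lt_def]; omega
      by_cases hjy : j = y
      · subst hjy; rw [Equiv.swap_apply_right, Fin.lt_def, Fin.lt_def]; omega
      rw [Equiv.swap_apply_of_ne_of_ne hjx hjy]
    have h2 : Equiv.swap x y j = i ↔ j = i := by
      rw [← Equiv.eq_symm_apply, Equiv.symm_swap, Equiv.swap_apply_of_ne_of_ne hix hiy]
    simp only [Alg.twist, h1, h2]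
  rw [delta_apply, delta_apply, h X a f hf]
  simp only [key]
  rw [← Finset.smul_sum, Equiv.sum_comp (Equiv.swap x y)
    (fun i => U X (X.twist i fun j => f (Equiv.swap x y j))), Operad.units_smul_linear,
    smul_comm e.negOnePow]
  exact (smul_sub _ _ _).symm

/-- The exchange of two arguments of an operation. -/
noncomputable def swap {n : ℕ} (x y : Fin n) (U : D.Operation n) : D.Operation n := fun X =>
  MultilinearMap.fromDirectSumEquiv (R := k) (κ := fun _ : Fin n => ℕ) fun a =>
    koszul (sgn (a x)) (sgn (a y)) •
      ((U X).domDomCongr (Equiv.swap x y)).compLinearMap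
        fun i => DirectSum.lof k ℕ (fun a => X.Cochain a) (a i)

theorem isSwap_swap {n : ℕ} (x y : Fin n) (U : D.Operation n) : IsSwap x y U (swap x y U) := by
  intro X a f hf
  choose z hz using hf
  obtain rfl : (fun i => DirectSum.lof k ℕ (fun a => X.Cochain a) (a i) (z i)) = f := funext hz
  rw [swap, MultilinearMap.fromDirectSumEquiv_lof, smul_apply]
  rfl

end Operation

/-! ### Cup product operations -/

section Cup

open Operation

theorem totalArity_val {n : ℕ} (a : Fin n → ℕ) : (totalArity a : ℤ) = ∑ i, (a i : ℤ) := by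
  have : ∀ j (hj : j ≤ n), (partialSum a j : ℤ) = ∑ i : Fin j, (a (Fin.castLE hj i) : ℤ) := by
    intro j
    induction j with
    | zero => intro; simp [partialSum]
    | succ j ih =>
      intro hj
      rw [Operad.partialSum_succ, Nat.cast_add, ih (by omega), Fin.sum_univ_castSucc]
      rfl
  rw [totalArity, Nat.sub_self, zero_add, this n le_rfl]
  rfl

theorem cup_add [CharZero k] {n : ℕ} (t t' : D.suspHadamard.obj n) :
    D.cup (t + t') = D.cup t + D.cup t' := by
  refine ext_lof fun X a x => ?_
  rw [Pi.add_apply, add_apply, cup_lof, cup_lof, cup_lof, map_add (X.structureMap n)]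
  refine Eq.trans ?_ (map_add (X.cls _) _ _)
  exact congrArg (X.cls _) (X.convOperad.partialComp_add_left a _ _ _ n le_rfl)

theorem cup_smul [CharZero k] {n : ℕ} (c : k) (t : D.suspHadamard.obj n) :
    D.cup (c • t) = c • D.cup t := by
  refine ext_lof fun X a x => ?_
  rw [Pi.smul_apply, smul_apply, cup_lof, cup_lof, map_smul (X.structureMap n)]
  refine Eq.trans ?_ (map_smul (X.cls _) _ _)
  exact congrArg (X.cls _) (X.convOperad.partialComp_smul_left a _ _ _ n le_rfl)

/-- The two parallel insertions of `f` and `g` into `χ` have the same class, since `χ` is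
symmetric. -/
theorem parallel_chi (X : D.Alg) {b c : ℕ} (f : X.convOperad.obj b) (g : X.convOperad.obj c) :
    X.parallel (a := 1) X.chi f g 1 0 = X.parallel (a := 1) X.chi f g 0 1 := by
  unfold Alg.parallel
  rw [dif_pos (by decide), dif_pos (by decide)]
  conv_lhs => rw [← X.chi_swap]
  obtain ⟨ρ, hρ, e⟩ := X.convOperad.act_comp (m := 2) (r := 1 + b) (n := b) (by omega) 1
    (Equiv.swap 0 1) X.chi f
  rw [e]
  obtain ⟨ρ', -, e'⟩ := X.convOperad.act_comp (m := 1 + b) (r := 1 + b + c - 1) (n := c) (by omega)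
    (outBlk (m := 2) (n := b) (by omega) 1 0 (by decide)) ρ
    (X.convOperad.comp (m := 2) (n := b) (by omega) (Equiv.swap 0 1 1) X.chi f) g
  rw [e', X.cls_act, hρ.2 0 (by decide)]
  rfl

variable [CharZero k]

/-- The operation `cup(t)`, `t ∈ 𝔰(P ⊗ P^!)(n)`, has degree `n - 1`. -/
theorem cup_parity {n : ℕ} (t : D.suspHadamard.obj n) (X : D.Alg) (f : Fin n → X.Complex) :
    D.cup t X (fun i => X.parity (f i)) = ((n : ℤ) - 1).negOnePow • X.parity (D.cup t X f) := by
  let U : D.Operation n := fun X => (D.cup t X).compLinearMap fun _ => X.parity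
  let V : D.Operation n := fun X => ((n : ℤ) - 1).negOnePow • X.parity.compMultilinearMap (D.cup t X)
  suffices h : U = V from congrArg (fun W => W X f) h
  refine ext_lof fun X a x => ?_
  have h1 : ∀ (s : Finset (Fin n)), D.cup t X (fun i => if i ∈ s then
      X.parity (DirectSum.lof k ℕ (fun a => X.Cochain a) (a i) (x i)) else
      DirectSum.lof k ℕ (fun a => X.Cochain a) (a i) (x i)) =
      (∑ i ∈ s, ((a i : ℤ) - 1)).negOnePow •
        D.cup t X (fun i => DirectSum.lof k ℕ (fun a => X.Cochain a) (a i) (x i)) := by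
    intro s
    induction s using Finset.induction_on with
    | empty => simp
    | insert i s hi ih =>
      rw [Finset.sum_insert hi, Int.negOnePow_add, mul_smul, ← ih]
      refine map_units_smul (D.cup t) X _ _ i _ (fun j hj => ?_) ?_
      · simp [hj]
      · simp [hi, X.parity_lof]
  have h2 := h1 Finset.univ
  simp only [Finset.mem_univ, if_true] at h2
  have h3 : V X (fun i => DirectSum.lof k ℕ (fun a => X.Cochain a) (a i) (x i)) =
      ((n : ℤ) - 1).negOnePow • X.parity
        (D.cup t X (fun i => DirectSum.lof k ℕ (fun a => X.Cochain a) (a i) (x i))) := rfl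
  refine h2.trans ?_
  rw [h3, cup_lof, X.parity_cls, smul_smul, ← Int.negOnePow_add, totalArity_val]
  refine sign_smul_eq ?_ _
  rw [Finset.sum_sub_distrib]
  simp only [Finset.sum_const, Finset.card_univ, Fintype.card_fin, nsmul_eq_mul, mul_one]
  exact ⟨1 - n, by ring⟩

/-- The first argument of a cup product may be represented by an unsymmetrized element. -/
theorem cup_cons_cls {m N : ℕ} (t : D.suspHadamard.obj (m + 1)) (X : D.Alg)
    (g : X.convOperad.obj N) (b : Fin m → ℕ) (x : ∀ i, X.Cochain (b i)) :
    (D.cup t X).curryLeft (X.cls N g) (fun i => DirectSum.lof k ℕ (fun a => X.Cochain a) (b i) (x i)) =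
      X.cls _ (X.convOperad.fullComp (Fin.cons N b : Fin (m + 1) → ℕ) (X.structureMap _ t)
        (Fin.cons (α := fun i => X.convOperad.obj ((Fin.cons N b : Fin (m + 1) → ℕ) i)) g
          fun i => (x i : X.convOperad.obj (b i)))) := by
  set a : Fin (m + 1) → ℕ := Fin.cons N b with ha
  set z : ∀ i, X.Cochain (a i) := Fin.cons (α := fun i => X.Cochain (a i))
    (X.convOperad.aver N g) x with hz
  set F : ∀ i, X.convOperad.obj (a i) := Fin.cons (α := fun i => X.convOperad.obj (a i)) g
    fun i => (x i : X.convOperad.obj (b i)) with hF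
  have h1 : (D.cup t X).curryLeft (X.cls N g)
      (fun i => DirectSum.lof k ℕ (fun a => X.Cochain a) (b i) (x i)) =
      D.cup t X (fun i => DirectSum.lof k ℕ (fun a => X.Cochain a) (a i) (z i)) := by
    rw [MultilinearMap.curryLeft_apply]
    congr 1
    funext i
    refine Fin.cases ?_ (fun i => ?_) i <;> rfl
  have hupd : ∀ (g' : X.convOperad.obj (a 0)) (G : ∀ i, X.convOperad.obj (a i)), G 0 = g' →
      (∀ i : Fin m, G i.succ = F i.succ) → G = Function.update F 0 g' := by
    intro g' G h0 hs
    funext i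
    refine Fin.cases ?_ (fun i => ?_) i
    · rw [Function.update_self, h0]
    · rw [Function.update_of_ne (Fin.succ_ne_zero i), hs]
  have h2 := hupd (X.convOperad.aver N g : X.convOperad.obj N) (fun i => (z i : X.convOperad.obj (a i)))
    rfl fun i => rfl
  have h3 := X.convOperad.apply_aver (n := N)
    (X.cls _ ∘ₗ (X.convOperad.fullComp a (X.structureMap _ t)).toLinearMap F 0)
    (fun σ f => X.convOperad.cls_fullComp_act_zero a (X.structureMap _ t) F σ f) g
  rw [h1, cup_lof, h2]
  refine h3.trans ?_
  exact congrArg (fun G => X.cls _ (X.convOperad.fullComp a (X.structureMap _ t) G))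
    (hupd g F rfl fun i => rfl).symm

/-- Composition into the first input of `t` becomes composition of operations; no signs occur for
the first input. -/
theorem cup_comp_zero {l m : ℕ} (h : l + m + 1 = m + 1 + l) (t : D.suspHadamard.obj (m + 1))
    (s : D.suspHadamard.obj l) :
    D.cup (D.suspHadamard.comp h 0 t s) = compZero (D.cup t) (D.cup s) := by
  refine ext_lof fun X a x => ?_
  set v : X.convOperad.obj (totalArity fun i => a (Fin.castAdd m i)) :=
    X.convOperad.fullComp (fun i => a (Fin.castAdd m i)) (X.structureMap l s)
      fun i => (x (Fin.castAdd m i) : X.convOperad.obj (a (Fin.castAdd m i))) with hv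
  have h1 := cup_lof D s X (fun i => a (Fin.castAdd m i)) fun i => x (Fin.castAdd m i)
  have h2 := cup_cons_cls t X v (fun i => a (Fin.natAdd l i)) fun i => x (Fin.natAdd l i)
  have h3 := X.convOperad.cls_fullComp_comp_zero h (X.structureMap _ t) (X.structureMap _ s) a
    (fun i => (x i : X.convOperad.obj (a i)))
    (Fin.cons (totalArity fun i => a (Fin.castAdd m i)) fun i => a (Fin.natAdd l i))
    (Fin.cons (α := fun i => X.convOperad.obj ((Fin.cons (totalArity fun i => a (Fin.castAdd m i))
      (fun i => a (Fin.natAdd l i)) : Fin (m + 1) → ℕ) i)) v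
      fun i => (x (Fin.natAdd l i) : X.convOperad.obj (a (Fin.natAdd l i))))
    rfl HEq.rfl (fun _ => rfl) (fun _ => HEq.rfl)
  refine Eq.trans ?_ (Eq.trans h3 (Eq.trans h2.symm ?_))
  · refine (cup_lof D _ X a x).trans ?_
    rw [X.structureMap_comp]
    rfl
  · refine Eq.trans ?_ (compZero_apply _ _ _ _).symm
    exact congrArg (fun z => (D.cup t X).curryLeft z fun i =>
      DirectSum.lof k ℕ (fun a => X.Cochain a) (a (Fin.natAdd l i)) (x (Fin.natAdd l i))) h1.symm

/-- An adjacent transposition acts on cup products by the exchange of two arguments. -/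
theorem isSwap_cup {n : ℕ} (t : D.suspHadamard.obj n) (j : ℕ) (hj : j + 1 < n) :
    IsSwap ⟨j, by omega⟩ ⟨j + 1, hj⟩ (D.cup t)
      (D.cup (D.suspHadamard.act (Equiv.swap ⟨j, by omega⟩ ⟨j + 1, hj⟩) t)) := by
  intro X a f hf
  choose x hx using hf
  have hf : f = fun i => DirectSum.lof k ℕ (fun a => X.Cochain a) (a i) (x i) :=
    funext fun i => (hx i).symm
  rw [hf, cup_lof, X.structureMap_act]
  have h1 := X.convOperad.cls_fullComp_swap a (X.structureMap n t)
    (fun i => (x i : X.convOperad.obj (a i))) j hj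
  have h2 := cup_lof D t X (fun i => a (Equiv.swap ⟨j, by omega⟩ ⟨j + 1, hj⟩ i))
    fun i => x (Equiv.swap ⟨j, by omega⟩ ⟨j + 1, hj⟩ i)
  rw [negOnePow_mul] at h1
  exact h1.trans (congrArg (fun z : X.Complex =>
    koszul (sgn (a ⟨j, by omega⟩)) (sgn (a ⟨j + 1, hj⟩)) • z) h2.symm)

theorem cup_one (X : D.Alg) (f : Fin 1 → X.Complex) :
    D.cup D.suspHadamard.one X f = f 0 := by
  let V : D.Operation 1 := fun X => MultilinearMap.ofSubsingleton k X.Complex X.Complex 0 LinearMap.id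
  suffices h : D.cup D.suspHadamard.one = V from congrArg (fun W => W X f) h
  refine ext_lof fun X a x => ?_
  rw [cup_lof, X.structureMap_one]
  have h1 : X.convOperad.fullComp a X.convOperad.one (fun i => (x i : X.convOperad.obj (a i))) =
    X.convOperad.comp (m := 1) (n := a 0) (r := totalArity a)
      (by simp [totalArity, partialSum, Nat.add_comm]) 0 X.convOperad.one (x 0 : X.convOperad.obj (a 0)) := rfl
  rw [h1, X.cls_comp_congr (r' := a 0) _ (by omega), X.convOperad.one_comp, X.cls_coe]
  rfl

/-! ### The canonical element and the pre-Lie product -/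

/-- The cup product of the canonical element is the associator of `μ = χ / 2`: the two parallel
insertions into `χ` contribute equally, which cancels the factor `1 / 2`. -/
theorem cup_canonical (X : D.Alg) (f g : X.Complex) :
    D.cup D.canonical X ![f, g] = X.preLie (X.preLie X.structureCochain f) g -
      X.preLie X.structureCochain (X.preLie f g) := by
  let V : D.Operation 2 := fun X => MultilinearMap.mk'
    (fun f => X.preLie (X.preLie X.structureCochain (f 0)) (f 1) -
      X.preLie X.structureCochain (X.preLie (f 0) (f 1)))
    (by
      intro m i x y
      fin_cases i <;> simp <;> abel)
    (by
      intro m i c x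
      fin_cases i <;> simp [X.complex_smul_sub])
  suffices h : D.cup D.canonical = V from congrArg (fun W => W X ![f, g]) h
  refine ext_lof fun X a x => ?_
  have h1 : V X (fun i => DirectSum.lof k ℕ (fun a => X.Cochain a) (a i) (x i)) =
    X.preLie (X.preLie X.structureCochain (X.cls _ (x 0 : X.convOperad.obj (a 0))))
      (X.cls _ (x 1 : X.convOperad.obj (a 1))) -
    X.preLie X.structureCochain (X.preLie (X.cls _ (x 0 : X.convOperad.obj (a 0)))
      (X.cls _ (x 1 : X.convOperad.obj (a 1)))) := by
    rw [X.cls_coe, X.cls_coe]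
    rfl
  have h2 := X.preLie_associator (a := 1) X.chi (x 0 : X.convOperad.obj (a 0))
    (x 1 : X.convOperad.obj (a 1))
  have h3 : ∀ i, X.parallel (a := 1) X.chi (x 0 : X.convOperad.obj (a 0))
    (x 1 : X.convOperad.obj (a 1)) i i = 0 := fun i => by simp [Alg.parallel]
  rw [Fin.sum_univ_two, Fin.sum_univ_two, Fin.sum_univ_two, h3, h3, parallel_chi, zero_add,
    add_zero] at h2
  rw [h1, X.structureCochain_eq]
  simp only [map_smul, LinearMap.smul_apply, ← X.complex_smul_sub]
  refine Eq.trans ?_ (congrArg (fun z => (2⁻¹ : k) • z) h2.symm)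
  have h4 : ∀ z : X.Complex, (2⁻¹ : k) • (z + z) = z := fun z => by
    rw [← two_smul k z, smul_smul, inv_mul_cancel₀ two_ne_zero, one_smul]
  refine Eq.trans ?_ (h4 _).symm
  rw [cup_lof, Alg.parallel, dif_pos (by decide)]
  have h5 : X.convOperad.Sim 0 1 (X.convOperad.fullComp a (X.structureMap 2 D.canonical)
      fun i => (x i : X.convOperad.obj (a i)))
      (X.convOperad.comp (m := 1 + a 0) (n := a 1) (r := 1 + a 0 + a 1 - 1) (by omega)
        (outBlk (m := 2) (n := a 0) (by omega) 0 1 (by decide))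
        (X.convOperad.comp (m := 2) (n := a 0) (by omega) 0 X.chi (x 0 : X.convOperad.obj (a 0)))
        (x 1 : X.convOperad.obj (a 1))) := by
    refine Operad.Sim.comp (Operad.Sim.comp (Operad.Sim.refl 0 _) _ _ _ _ rfl (by omega) rfl HEq.rfl)
      _ _ _ _ ?_ (by omega) rfl HEq.rfl
    rw [outBlk_val]
    simp [partialSum]
  have h6 := h5.cls_eq
  rw [one_smul] at h6
  exact h6

end Cup

end QuadraticData

end CohOp

namespace CohOp

open scoped TensorProduct DirectSum

variable {k : Type u} [Field k] {deg : ℕ → ℤ}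

/-! ### The universal property of quadratic operads -/

section Lift

variable {E : Type u} (Q : Operad₀ k)

/-- The value of a formal expression in an operad, given values of the generators. -/
def OTerm.value (φ : E → Q.obj 2) : ∀ {n : ℕ}, OTerm k E n → Q.obj n
  | _, .zero _ => 0
  | _, .add x y => x.value φ + y.value φ
  | _, .smul c x => c • x.value φ
  | _, .one => Q.one
  | _, .gen e => φ e
  | _, .act σ x => Q.act σ (x.value φ)
  | _, .comp h i x y => Q.comp h i (x.value φ) (y.value φ)

variable [AddCommGroup E] [Module k E] {τ : E →ₗ[k] E} {Q}

theorem OTerm.Rel.value_eq {φ : E →ₗ[k] Q.obj 2} (hφ : ∀ e, φ (τ e) = Q.act (Equiv.swap 0 1) (φ e))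
    {n : ℕ} {x y : OTerm k E n} (h : OTerm.Rel τ x y) : x.value Q φ = y.value Q φ := by
  induction h with
  | refl => rfl
  | symm _ ih => exact ih.symm
  | trans _ _ ih ih' => exact ih.trans ih'
  | add_congr _ _ ih ih' => simp only [OTerm.value, ih, ih']
  | smul_congr c _ ih => simp only [OTerm.value, ih]
  | act_congr σ _ ih => simp only [OTerm.value, ih]
  | comp_congr h i _ _ ih ih' => simp only [OTerm.value, ih, ih']
  | add_assoc => exact _root_.add_assoc _ _ _
  | add_comm => exact _root_.add_comm _ _
  | zero_add => exact _root_.zero_add _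
  | smul_add => exact _root_.smul_add _ _ _
  | add_smul => exact _root_.add_smul _ _ _
  | mul_smul => exact SemigroupAction.mul_smul _ _ _
  | one_smul => exact _root_.one_smul _ _
  | zero_smul => exact _root_.zero_smul _ _
  | gen_add => exact map_add φ _ _
  | gen_smul => exact map_smul φ _ _
  | gen_swap e => exact hφ e
  | act_add => exact map_add _ _ _
  | act_smul => exact map_smul _ _ _
  | comp_add_left => exact LinearMap.map_add₂ _ _ _ _
  | comp_smul_left => exact LinearMap.map_smul₂ _ _ _ _
  | comp_add_right => exact map_add _ _ _
  | comp_smul_right => exact map_smul _ _ _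
  | act_one => exact Q.act_one _
  | act_mul => exact Q.act_mul _ _ _
  | one_comp h => exact Q.one_comp h _
  | comp_one h i => exact Q.comp_one h i _
  | comp_seq h₁ h₂ h₃ h₄ i j => exact Q.comp_seq h₁ h₂ h₃ h₄ i j _ _ _
  | comp_par h₁ h₂ h₃ h₄ i j hij x y z =>
    have e := Q.comp_par h₁ h₂ h₃ h₄ i j hij (x.value Q φ) (y.value Q φ) (z.value Q φ)
    simp only [mul_zero, Int.negOnePow_zero, _root_.one_smul] at e
    exact e
  | comp_act h i σ ρ π hπ => exact Q.comp_act h i σ ρ π hπ _ _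

/-- The morphism from the free operad given by the values of the generators. -/
def freeLift (φ : E →ₗ[k] Q.obj 2) (hφ : ∀ e, φ (τ e) = Q.act (Equiv.swap 0 1) (φ e)) :
    OperadHom (freeOperad τ) Q where
  map n :=
    { toFun := Quot.lift (OTerm.value Q φ) fun _ _ h => h.value_eq hφ
      map_add' := by rintro ⟨x⟩ ⟨y⟩; rfl
      map_smul' := by rintro c ⟨x⟩; rfl }
  map_one := rfl
  map_act := by rintro n σ ⟨x⟩; rfl
  map_comp := by rintro m n r h i ⟨x⟩ ⟨y⟩; rfl

end Lift

/-- A morphism that vanishes on `S` factors through the quotient by the ideal generated by `S`. -/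
def OperadHom.quotLift {P Q : Operad k deg} (F : OperadHom P Q) (S : ∀ n, Set (P.obj n))
    (hS : ∀ n, ∀ x ∈ S n, F.map n x = 0) : OperadHom (P.quot S) Q where
  map n := (P.ideal S n).liftQ (F.map n) (fun x hx => by
    change InIdeal P S n x at hx
    rw [LinearMap.mem_ker]
    induction hx with
    | of f hf => exact hS _ f hf
    | zero => exact map_zero _
    | add f g _ _ hf hg => rw [map_add, hf, hg, add_zero]
    | smul c f _ hf => rw [map_smul, hf, smul_zero]
    | act σ f _ hf => rw [F.map_act, hf, map_zero]
    | comp_left h i f g _ hf => rw [F.map_comp, hf, map_zero, LinearMap.zero_apply]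
    | comp_right h i f g _ hg => rw [F.map_comp, hg, map_zero])
  map_one := F.map_one
  map_act σ f := by
    induction f using Submodule.Quotient.induction_on with | _ f =>
    exact F.map_act σ f
  map_comp h i f g := by
    induction f using Submodule.Quotient.induction_on with | _ f =>
    induction g using Submodule.Quotient.induction_on with | _ g =>
    exact F.map_comp h i f g

/-- The suspension of a morphism of operads. -/
def OperadHom.susp {P Q : Operad₀ k} (F : OperadHom P Q) : OperadHom (susp P) (susp Q) where
  map n := F.map n
  map_one := F.map_one
  map_act σ f := (negOnePow_smul_map _ (F.map _) _).trans (congrArg _ (F.map_act σ f))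
  map_comp h i f g := (negOnePow_smul_map _ (F.map _) _).trans (congrArg _ (F.map_comp h i f g))

/-- A morphism with values in a suboperad. -/
def OperadHom.codRestrict {P Q : Operad k deg} (F : OperadHom P Q) (S : Suboperad Q)
    (hS : ∀ n x, F.map n x ∈ S.carrier n) : OperadHom P S.toOperad where
  map n := (F.map n).codRestrict (S.carrier n) (hS n)
  map_one := Subtype.ext F.map_one
  map_act σ f := Subtype.ext (F.map_act σ f)
  map_comp h i f g := Subtype.ext (F.map_comp h i f g)

namespace QuadraticData

variable {D : QuadraticData k}

/-- A quadratic operad is generated by its binary operations. -/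
theorem operad_induction {C : ∀ n, D.operad.obj n → Prop} (zero : ∀ n, C n 0)
    (add : ∀ n x y, C n x → C n y → C n (x + y)) (smul : ∀ n (c : k) x, C n x → C n (c • x))
    (one : C 1 D.operad.one) (gen : ∀ e, C 2 (D.gen e))
    (act : ∀ n σ x, C n x → C n (D.operad.act σ x))
    (comp : ∀ m n r (h : r + 1 = m + n) i x y, C m x → C n y → C r (D.operad.comp h i x y))
    (n : ℕ) (x : D.operad.obj n) : C n x := by
  obtain ⟨w, rfl⟩ := Submodule.mkQ_surjective _ x
  obtain ⟨t, rfl⟩ := Quot.exists_rep w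
  induction t with
  | zero n => exact zero n
  | add x y hx hy => exact add _ _ _ hx hy
  | smul c x hx => exact smul _ c _ hx
  | one => exact one
  | gen e => exact gen e
  | act σ x hx => exact act _ σ _ hx
  | comp h i x y hx hy => exact comp _ _ _ h i _ _ hx hy

/-- The unit, and the operations obtained by renumbering the inputs of some `y ∘_i e` with `e` a
generator. -/
inductive IsElementary : ∀ n, D.operad.obj n → Prop
  | one : IsElementary 1 D.operad.one
  | act_comp_gen {m r : ℕ} (h : r + 1 = m + 2) (i : Fin m) (σ : Equiv.Perm (Fin r))
      (y : D.operad.obj m) (e : D.E) : IsElementary r (D.operad.act σ (D.operad.comp h i y (D.gen e)))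

/-- A quadratic operad is spanned by its elementary operations: in a composite `x ∘_i (y ∘_j e)`,
sequential associativity makes the insertion of the generator `e` the last one. -/
theorem mem_span_isElementary (n : ℕ) (x : D.operad.obj n) :
    x ∈ Submodule.span k {x | IsElementary n x} := by
  have hact : ∀ n σ (x : D.operad.obj n), x ∈ Submodule.span k {x | IsElementary n x} →
      D.operad.act σ x ∈ Submodule.span k {x | IsElementary n x} := by
    intro n σ x hx
    induction hx using Submodule.span_induction with
    | zero => rw [map_zero]; exact zero_mem _
    | add x y _ _ hx hy => rw [map_add]; exact add_mem hx hy
    | smul c x _ hx => rw [map_smul]; exact Submodule.smul_mem _ _ hx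
    | mem x hx =>
      refine Submodule.subset_span ?_
      obtain _ | ⟨h, i, τ, y, e⟩ := hx
      · rw [Subsingleton.elim σ 1, D.operad.act_one]
        exact .one
      · rw [← D.operad.act_mul]
        exact .act_comp_gen h i _ y e
  induction n, x using operad_induction with
  | zero n => exact zero_mem _
  | add n x y hx hy => exact add_mem hx hy
  | smul n c x hx => exact Submodule.smul_mem _ _ hx
  | one => exact Submodule.subset_span .one
  | gen e =>
    refine Submodule.subset_span ?_
    have h := IsElementary.act_comp_gen (m := 1) (r := 2) rfl 0 1 D.operad.one e
    rw [D.operad.act_one, D.operad.one_comp] at h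
    exact h
  | act n σ x hx => exact hact n σ x hx
  | comp m n r h i x y hx hy =>
    induction hy using Submodule.span_induction with
    | zero => rw [map_zero]; exact zero_mem _
    | add x y _ _ hx hy => rw [map_add]; exact add_mem hx hy
    | smul c x _ hx => rw [map_smul]; exact Submodule.smul_mem _ _ hx
    | mem y hy =>
      obtain _ | ⟨h', j, τ, y, e⟩ := hy
      · obtain rfl : r = m := by omega
        rw [D.operad.comp_one]
        exact hx
      · have hm := i.pos
        have hn := j.pos
        obtain ⟨ρ, -, hρ⟩ := D.operad.comp_act_right h i τ x (D.operad.comp h' j y (D.gen e))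
        rw [hρ, ← D.operad.comp_seq (r := r - 1) (by omega) (by omega) h' h i j x y (D.gen e)]
        exact Submodule.subset_span (.act_comp_gen _ _ _ _ _)

end QuadraticData

end CohOp

namespace CohOp

open scoped TensorProduct DirectSum

variable {k : Type u} [Field k] {deg : ℕ → ℤ}

/-! ### The morphism from the suspended Lie operad -/

/-- If `q` satisfies the Jacobi identity, then the relations of the Lie operad, spanned by the sum
of the three composites of the bracket with itself, hold in `Q`. -/
theorem OperadHom.map_freeThree_eq_zero {E : Type u} [AddCommGroup E] [Module k E] {τ : E →ₗ[k] E}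
    {Q : Operad₀ k} (F : OperadHom (freeOperad τ) Q) (e : E) (q : Q.obj 2)
    (hq : F.map 2 (freeGen τ e) = q)
    (hJ : ∑ u : Fin 3, Q.act ((finRotate 3) ^ (u : ℕ))
      (Q.comp (m := 2) (n := 2) (r := 3) rfl 0 q q) = 0)
    (t : Fin 3 → E ⊗[k] E) (ht : t ∈ Submodule.span k {fun _ => e ⊗ₜ e}) :
    F.map 3 (freeThree τ t) = 0 := by
  obtain ⟨c, rfl⟩ := Submodule.mem_span_singleton.1 ht
  rw [map_smul, map_smul, freeThree, LinearMap.sum_apply, map_sum]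
  refine (congrArg (fun z => c • z) ?_).trans (smul_zero c)
  refine Eq.trans (Finset.sum_congr rfl fun u _ => ?_) hJ
  rw [LinearMap.comp_apply, F.map_act]
  refine congrArg _ (Eq.trans ?_ (F.map_comp (m := 2) (n := 2) (r := 3) rfl 0 (freeGen τ e)
    (freeGen τ e)) |>.trans ?_)
  · rfl
  · rw [hq]

namespace QuadraticData

section

variable (D : QuadraticData k)

/-- The morphism `Lie → P ⊗ P^!` that sends the bracket to the canonical element. -/
noncomputable def lieHom : OperadHom (lieData k).operad (hadamard D.operad D.dual.operad) :=
  (freeLift (LinearMap.toSpanSingleton k _ D.canonical₀) (fun e => by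
      change (-e) • D.canonical₀ = _
      refine Eq.trans ?_ (congrArg _ (LinearMap.toSpanSingleton_apply k _ D.canonical₀ e).symm)
      rw [map_smul, canonical₀_swap, neg_smul, smul_neg])).quotLift (lieData k).relations
    (fun n x hx => by
      by_cases hn : n = 3
      · subst hn
        obtain ⟨t, ht, rfl⟩ := hx
        exact OperadHom.map_freeThree_eq_zero _ (1 : k) _ (one_smul k D.canonical₀)
          D.canonical₀_jacobi t ht
      · have h : (lieData k).relations n = ∅ := by
          unfold relations
          split
          · exact absurd rfl hn
          · rfl
        rw [h] at hx
        exact hx.elim)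

theorem lieHom_gen_eq_smul (e : k) : D.lieHom.map 2 ((lieData k).gen e) = e • D.canonical₀ :=
  rfl

theorem lieHom_gen : D.lieHom.map 2 ((lieData k).gen (1 : k)) = D.canonical₀ :=
  one_smul k D.canonical₀

end

variable {D : QuadraticData k}

/-- Morphisms from a suspended quadratic operad are determined on the generators. -/
theorem hom_susp_ext {Q : Operad k (fun n => (n : ℤ) - 1)} (F G : OperadHom (susp D.operad) Q)
    (h : ∀ e, F.map 2 (D.gen e) = G.map 2 (D.gen e)) : F = G := by
  have key : ∀ n (x : D.operad.obj n), F.map n (toSusp _ n x) = G.map n (toSusp _ n x) := by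
    intro n x
    induction n, x using operad_induction with
    | zero n => rw [map_zero, map_zero, map_zero]
    | add n x y hx hy => rw [map_add, map_add, map_add, hx, hy]
    | smul n c x hx => rw [map_smul, map_smul, map_smul, hx]
    | one => exact F.map_one.trans G.map_one.symm
    | gen e => exact h e
    | act n σ x hx =>
      have e := congrArg (Q.act σ) hx
      rw [← F.map_act, ← G.map_act, susp_act, negOnePow_smul_map, negOnePow_smul_map] at e
      exact MulAction.injective _ e
    | comp m n r h i x y hx hy =>
      have e := congrArg₂ (fun a b => Q.comp h i a b) hx hy
      simp only [← F.map_comp, ← G.map_comp, susp_comp, negOnePow_smul_map] at e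
      exact MulAction.injective _ e
  exact OperadHom.ext (funext fun n => LinearMap.ext fun x => key n x)

theorem hom_suspLie_ext {Q : Operad k (fun n => (n : ℤ) - 1)} (F G : OperadHom (suspLie k) Q)
    (h : F.map 2 (suspBracket k) = G.map 2 (suspBracket k)) : F = G := by
  refine hom_susp_ext F G fun e => ?_
  have hF : ∀ (F : OperadHom (suspLie k) Q) (c : k),
      F.map 2 ((lieData k).gen c) = c • F.map 2 (suspBracket k) := fun F c =>
    (congrArg (fun z => F.map 2 ((lieData k).gen z)) (mul_one c).symm).trans
      ((congrArg (F.map 2) (map_smul (lieData k).gen c (1 : k))).trans (map_smul (F.map 2) c _))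
  exact (hF F e).trans ((congrArg _ h).trans (hF G e).symm)

/-- A suboperad of a suspension that contains the values of the generators under a morphism
contains all its values. -/
theorem susp_map_mem {Q : Operad₀ k} (F : OperadHom D.operad Q) (S : Suboperad (susp Q))
    (h : ∀ e, toSusp Q 2 (F.map 2 (D.gen e)) ∈ S.carrier 2) (n : ℕ) (x : D.operad.obj n) :
    toSusp Q n (F.map n x) ∈ S.carrier n := by
  induction n, x using operad_induction with
  | zero n => rw [map_zero, map_zero]; exact zero_mem _
  | add n x y hx hy => rw [map_add, map_add]; exact add_mem hx hy
  | smul n c x hx => rw [map_smul, map_smul]; exact Submodule.smul_mem _ _ hx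
  | one => rw [F.map_one]; exact S.one_mem
  | gen e => exact h e
  | act n σ x hx =>
    refine (Operad.units_smul_mem_iff _ (Equiv.Perm.sign σ)).1 ?_
    rw [F.map_act, ← susp_act]
    exact S.act_mem σ _ hx
  | comp m n r h i x y hx hy =>
    refine (Operad.units_smul_mem_iff _ ((i : ℤ) * ((n : ℤ) - 1)).negOnePow).1 ?_
    rw [F.map_comp, ← susp_comp]
    exact S.comp_mem h i _ _ hx hy

/-! ### Closed cup products -/

section Closed

open Operation

variable [CharZero k]

theorem delta_cup_act {n : ℕ} (σ : Equiv.Perm (Fin n)) (t : D.suspHadamard.obj n)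
    (ht : delta ((n : ℤ) - 1) (D.cup t) = 0) :
    delta ((n : ℤ) - 1) (D.cup (D.suspHadamard.act σ t)) = 0 := by
  refine D.suspHadamard.act_induction (C := fun t => delta ((n : ℤ) - 1) (D.cup t) = 0)
    (fun j hj t ht => ?_) σ t ht
  have h := (isSwap_cup t j hj).delta rfl ((n : ℤ) - 1)
  rw [ht] at h
  exact h.eq_zero

variable (D)

/-- The suboperad `Z_P` of the elements whose cup product is `δ_P`-closed. -/
noncomputable def closed : Suboperad D.suspHadamard where
  carrier n :=
    { carrier := {t | delta ((n : ℤ) - 1) (D.cup t) = 0}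
      zero_mem' := by
        have h : D.cup (0 : D.suspHadamard.obj n) = 0 := by
          have := cup_smul (0 : k) (0 : D.suspHadamard.obj n)
          rwa [zero_smul, zero_smul] at this
        change delta _ (D.cup 0) = 0
        rw [h, delta_zero]
      add_mem' := fun {t t'} ht ht' => by
        change delta _ (D.cup (t + t')) = 0
        rw [cup_add, delta_add, ht, ht', add_zero]
      smul_mem' := fun c t ht => by
        change delta _ (D.cup (c • t)) = 0
        rw [cup_smul, delta_smul, ht, smul_zero] }
  one_mem := by
    refine ext_apply fun X f => ?_
    rw [delta_apply, cup_one, Fin.sum_univ_one, cup_one]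
    simp [Alg.twist]
  act_mem := delta_cup_act
  -- Permutations reduce to insertion into the first input, where `δ_P` is a derivation.
  comp_mem {m n r} h i t s ht hs := by
    obtain _ | m := m
    · exact i.elim0
    obtain rfl : r = n + m := by omega
    obtain ⟨σ, ρ, e⟩ := D.suspHadamard.comp_eq_act_comp_zero h i t s
    rw [e]
    refine delta_cup_act ρ _ ?_
    have h1 := delta_compZero (V := D.cup s) (eV := (n : ℤ) - 1) (delta_cup_act σ t ht) (cup_parity s)
    change delta _ (D.cup s) = 0 at hs
    have h0 : compZero (D.cup (D.suspHadamard.act σ t)) (0 : D.Operation n) = 0 :=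
      ext_apply fun X f => by
        rw [compZero_apply]
        simp
    rw [hs, h0, smul_zero, ← cup_comp_zero h] at h1
    convert h1 using 2
    push_cast
    ring

end Closed

end QuadraticData

end CohOp

namespace CohOp

open scoped TensorProduct DirectSum

variable {k : Type u} [Field k] {deg : ℕ → ℤ}

/-! ### Substitution in trees -/

namespace NatTree

variable {P : ℕ → Type u} {n n' : ℕ} {a : Fin n' → ℕ} {N N' : ℕ}

/-- The tree obtained by replacing the leg `l` by the tree `s l` and relabelling the white vertices
along `w`. -/
def bind (w : Fin n → Fin n') (s : Fin N → NatTree P a N') :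
    NatTree P (fun i => a (w i)) N → NatTree P a N'
  | leg l => s l
  | white i c => white (w i) fun z => (c z).bind w s
  | black b hb p c => black b hb p fun z => (c z).bind w s

theorem eval_bind {A : Type u} (α : ∀ b, P b → (Fin b → A) → A) (φ : ∀ i, (Fin (a i) → A) → A)
    (x : Fin N' → A) (w : Fin n → Fin n') (s : Fin N → NatTree P a N')
    (T : NatTree P (fun i => a (w i)) N) :
    (T.bind w s).eval α φ x = T.eval α (fun i => φ (w i)) fun l => (s l).eval α φ x := by
  induction T with
  | leg l => rfl
  | white i c ih => simp only [bind, eval, ih]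
  | black b hb p c ih => simp only [bind, eval, ih]

theorem legCount_bind (l : Fin N') (w : Fin n → Fin n') (s : Fin N → NatTree P a N')
    (T : NatTree P (fun i => a (w i)) N) :
    (T.bind w s).legCount l = ∑ y, T.legCount y * (s y).legCount l := by
  induction T with
  | leg l' => simp [bind, legCount]
  | white i c ih =>
    simp only [bind, legCount, ih, Finset.sum_mul]
    exact Finset.sum_comm
  | black b hb p c ih =>
    simp only [bind, legCount, ih, Finset.sum_mul]
    exact Finset.sum_comm

theorem whiteCount_bind (j : Fin n') (w : Fin n → Fin n') (s : Fin N → NatTree P a N')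
    (T : NatTree P (fun i => a (w i)) N) :
    (T.bind w s).whiteCount j = (∑ i, if w i = j then T.whiteCount i else 0) +
      ∑ y, T.legCount y * (s y).whiteCount j := by
  induction T with
  | leg l' => simp [bind, legCount, whiteCount]
  | white i c ih =>
    have h : ∀ i', (if w i' = j then (white i c : NatTree P (fun i => a (w i)) N).whiteCount i' else 0) =
        (if i = i' then (if w i = j then 1 else 0) else 0) +
          ∑ z, if w i' = j then (c z).whiteCount i' else 0 := by
      intro i'
      simp only [whiteCount]
      by_cases h1 : w i' = j
      · by_cases h2 : i = i'
        · subst h2; simp [h1]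
        · simp [h1, h2]
      · by_cases h2 : i = i'
        · subst h2; simp [h1]
        · simp [h1, h2]
    rw [Finset.sum_congr rfl fun i' _ => h i']
    simp only [bind, whiteCount, legCount, ih, Finset.sum_mul, Finset.sum_add_distrib,
      Finset.sum_ite_eq, Finset.mem_univ, if_true]
    rw [Finset.sum_comm (s := Finset.univ (α := Fin n)), Finset.sum_comm (s := Finset.univ (α := Fin N)),
      add_assoc]
  | black b hb p c ih =>
    have h : ∀ i', (if w i' = j then (black b hb p c : NatTree P (fun i => a (w i)) N).whiteCount i'
        else 0) = ∑ z, if w i' = j then (c z).whiteCount i' else 0 := by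
      intro i'
      by_cases h1 : w i' = j <;> simp [h1, whiteCount]
    rw [Finset.sum_congr rfl fun i' _ => h i']
    simp only [bind, whiteCount, legCount, ih, Finset.sum_mul, Finset.sum_add_distrib]
    rw [Finset.sum_comm (s := Finset.univ (α := Fin n)), Finset.sum_comm (s := Finset.univ (α := Fin N))]

/-- Substitution of trees which together contain every leg and every new white vertex once. -/
theorem IsLinear.bind {w : Fin n → Fin n'} {s : Fin N → NatTree P a N'}
    {T : NatTree P (fun i => a (w i)) N} (hT : T.IsLinear)
    (hl : ∀ l, ∑ y, (s y).legCount l = 1)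
    (hw : ∀ j, (∑ i, if w i = j then 1 else 0) + ∑ y, (s y).whiteCount j = 1) :
    (T.bind w s).IsLinear := by
  refine ⟨fun l => ?_, fun j => ?_⟩
  · simpa only [legCount_bind, hT.1, one_mul] using hl l
  · simpa only [whiteCount_bind, hT.1, hT.2, one_mul] using hw j

/-- The tree that replaces the leg `y` when a new white vertex, the last one, is grafted on the
leg `p`. -/
def graft {n : ℕ} {a : Fin (n + 1) → ℕ} {m r : ℕ} (h : r + 1 = m + a (Fin.last n)) (p y : Fin m) :
    NatTree P a r :=
  if hy : y = p then white (Fin.last n) fun z => leg (inBlk h p z) else leg (outBlk h p y hy)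

theorem isLinear_graft {n : ℕ} {a : Fin (n + 1) → ℕ} {m r : ℕ} (h : r + 1 = m + a (Fin.last n))
    (p : Fin m) {T : NatTree P (fun i => a (Fin.castSucc i)) m} (hT : T.IsLinear) :
    (T.bind Fin.castSucc (graft h p)).IsLinear := by
  refine hT.bind (fun l => ?_) fun j => ?_
  · rcases in_or_out h p l with ⟨z, rfl⟩ | ⟨y, hy, rfl⟩
    · rw [Finset.sum_eq_single p]
      · simp [graft, legCount, (inBlk_injective h p).eq_iff]
      · intro y _ hy
        simp [graft, hy, legCount, (inBlk_ne_outBlk h p z y hy).symm]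
      · simp
    · rw [Finset.sum_eq_single y]
      · simp [graft, hy, legCount]
      · intro y' _ hy'
        by_cases hp : y' = p
        · simp [graft, hp, legCount, inBlk_ne_outBlk]
        · have : outBlk h p y' hp ≠ outBlk h p y hy := fun e => hy' (outBlk_injective h p _ _ _ _ e)
          simp [graft, hp, legCount, this]
      · simp
  · have hs : ∑ y, (graft (P := P) h p y).whiteCount j = if Fin.last n = j then 1 else 0 := by
      rw [Finset.sum_eq_single p]
      · simp [graft, whiteCount]
      · intro y _ hy
        simp [graft, hy, whiteCount]
      · simp
    rw [hs]
    refine Fin.lastCases ?_ (fun i => ?_) j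
    · simp [(Fin.castSucc_lt_last _).ne]
    · simp [(Fin.castSucc_lt_last i).ne', Fin.castSucc_inj]

theorem isLinear_relabel (σ : Equiv.Perm (Fin n')) {T : NatTree P (fun i => a (σ i)) N}
    (hT : T.IsLinear) : (T.bind σ (leg (a := a))).IsLinear := by
  refine hT.bind (fun l => by simp [legCount]) fun j => ?_
  simp only [whiteCount, Finset.sum_const_zero, add_zero]
  rw [Finset.sum_eq_single (σ.symm j)]
  · simp
  · intro i _ hi
    rw [if_neg]
    intro e
    exact hi (by rw [← e, Equiv.symm_apply_apply])
  · simp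

end NatTree

end CohOp

namespace CohOp

open scoped TensorProduct DirectSum

variable {k : Type u} [Field k] {deg : ℕ → ℤ}

namespace QuadraticData

variable {D : QuadraticData k}

/-! ### Unaveraged tree operations -/

theorem Alg.convOperad_comp_tmul (X : D.Alg) {m n r : ℕ} (h : r + 1 = m + n) (i : Fin m)
    (φ : MultilinearMap k (fun _ : Fin m => X.A) X.A) (q : D.dual.operad.obj m)
    (φ' : MultilinearMap k (fun _ : Fin n => X.A) X.A) (q' : D.dual.operad.obj n) :
    X.convOperad.comp h i (φ ⊗ₜ[k] q) (φ' ⊗ₜ[k] q') =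
      endComp h i φ φ' ⊗ₜ[k] (((i : ℤ) * ((n : ℤ) - 1)).negOnePow • D.dual.operad.comp h i q q') := by
  have e : ∀ (s : ℤˣ) (a : MultilinearMap k (fun _ : Fin r => X.A) X.A) (b : D.dual.operad.obj r),
      s • (a ⊗ₜ[k] b) = a ⊗ₜ[k] (s • b) := by
    intro s a b
    rcases Int.units_eq_one_or s with rfl | rfl
    · simp
    · simp [Units.neg_smul, TensorProduct.tmul_neg]
  exact e _ _ _

variable (D) in
/-- Families of multilinear maps on the operads `𝔰(End_A ⊗ P^!)`, without symmetrization. -/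
abbrev Family {n : ℕ} (a : Fin n → ℕ) (N : ℕ) : Type (u + 1) :=
  ∀ X : D.Alg, MultilinearMap k (fun i => X.convOperad.obj (a i)) (X.convOperad.obj N)

variable (D) in
/-- The unaveraged operations `φ_i ⊗ q_i ↦ T(φ_1, …, φ_n) ⊗ Φ(q_1, …, q_n)`. -/
def treeLifts {n : ℕ} (a : Fin n → ℕ) (N : ℕ) :
    Set (D.Family a N) :=
  {W | ∃ T : NatTree D.operad.obj a N, T.IsLinear ∧
    ∃ Φ : MultilinearMap k (fun i => D.dual.operad.obj (a i)) (D.dual.operad.obj N),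
    ∀ (X : D.Alg) (φ : ∀ i, MultilinearMap k (fun _ : Fin (a i) => X.A) X.A)
        (q : ∀ i, D.dual.operad.obj (a i)),
        ∃ ψ : MultilinearMap k (fun _ : Fin N => X.A) X.A,
          (∀ x, ψ x = T.eval (fun _ p => X.op p) (fun i => φ i) x) ∧
          W X (fun i => φ i ⊗ₜ[k] q i) = ψ ⊗ₜ[k] Φ q}

variable (D) in
/-- Averaging of families of multilinear maps on unsymmetrized cochains. -/
noncomputable def averaged {n : ℕ} (a : Fin n → ℕ) (N : ℕ) :
    D.Family a N →ₗ[k]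
    (∀ X : D.Alg, MultilinearMap k (fun i => X.Cochain (a i)) (X.Cochain N)) where
  toFun W X := ((X.convOperad.aver N).compMultilinearMap (W X)).compLinearMap
    fun i => (X.convOperad.invariants (a i)).subtype
  map_add' W W' := by
    funext X
    ext x : 1
    simp
  map_smul' c W := by
    funext X
    ext x : 1
    simp

theorem averaged_mem {n : ℕ} {a : Fin n → ℕ} {N : ℕ}
    {W : D.Family a N}
    (hW : W ∈ Submodule.span k (D.treeLifts a N)) :
    averaged D a N W ∈ Submodule.span k (D.treeOperations a N) := by
  have h : (Submodule.span k (D.treeLifts a N)).map (averaged D a N) ≤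
      Submodule.span k (D.treeOperations a N) := by
    rw [Submodule.map_span_le]
    rintro W ⟨T, hT, Φ, h⟩
    exact Submodule.subset_span ⟨T, hT, Φ, fun X => ⟨W X, h X, fun f => rfl⟩⟩
  exact h (Submodule.mem_map_of_mem hW)

variable (D) in
/-- The insertion of a new last argument into the input `p`. -/
noncomputable def insertLast {n : ℕ} (a : Fin (n + 1) → ℕ) {m r : ℕ} (h : r + 1 = m + a (Fin.last n))
    (p : Fin m) :
    D.Family (fun i => a (Fin.castSucc i)) m →ₗ[k]
    D.Family a r where
  toFun W X := ((X.convOperad.comp h p).compMultilinearMap (W X)).uncurryRight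
  map_add' W W' := by
    funext X
    ext x
    simp
  map_smul' c W := by
    funext X
    ext x
    simp

theorem insertLast_mem {n : ℕ} (a : Fin (n + 1) → ℕ) {m r : ℕ} (h : r + 1 = m + a (Fin.last n))
    (p : Fin m)
    {W : D.Family (fun i => a (Fin.castSucc i)) m}
    (hW : W ∈ Submodule.span k (D.treeLifts (fun i => a (Fin.castSucc i)) m)) :
    insertLast D a h p W ∈ Submodule.span k (D.treeLifts a r) := by
  have h : (Submodule.span k (D.treeLifts (fun i => a (Fin.castSucc i)) m)).map
      (insertLast D a h p) ≤ Submodule.span k (D.treeLifts a r) := by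
    rw [Submodule.map_span_le]
    rintro W ⟨T, hT, Φ, hΦ⟩
    refine Submodule.subset_span ⟨_, NatTree.isLinear_graft h p hT,
      ((((p : ℤ) * ((a (Fin.last n) : ℤ) - 1)).negOnePow •
        D.dual.operad.comp h p).compMultilinearMap Φ).uncurryRight, fun X φ q => ?_⟩
    obtain ⟨ψ, hψ, e⟩ := hΦ X (fun i => φ (Fin.castSucc i)) (fun i => q (Fin.castSucc i))
    refine ⟨endComp h p ψ (φ (Fin.last n)), fun x => ?_, ?_⟩
    · rw [NatTree.eval_bind]
      refine (hψ _).trans (congrArg (fun z => T.eval _ _ z) ?_)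
      funext y
      by_cases hy : y = p
      · subst hy
        rw [insertArg_self, NatTree.graft, dif_pos rfl]
        rfl
      · rw [insertArg_ne _ _ _ _ _ hy, NatTree.graft, dif_neg hy]
        rfl
    · refine (congrArg (fun z => X.convOperad.comp h p z (φ (Fin.last n) ⊗ₜ[k] q (Fin.last n)))
        e).trans ?_
      exact X.convOperad_comp_tmul h p ψ _ _ _
  exact h (Submodule.mem_map_of_mem hW)

variable (D) in
/-- The operation without arguments given by an element of `P ⊗ P^!`. -/
noncomputable def constant {m : ℕ} (a : Fin 0 → ℕ) : (hadamard D.operad D.dual.operad).obj m →ₗ[k]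
    D.Family a m where
  toFun y X := MultilinearMap.constOfIsEmpty k _ (X.structureMap m y)
  map_add' y y' := by
    funext X
    ext x
    exact map_add (X.structureMap m) y y'
  map_smul' c y := by
    funext X
    ext x
    exact map_smul (X.structureMap m) c y

/-- The tree of the operation `p ⊗ q` without arguments is a black vertex, or a single leg in arity
one, where `P` is spanned by the unit. -/
theorem constant_mem {m : ℕ} (a : Fin 0 → ℕ) (y : (hadamard D.operad D.dual.operad).obj (m + 1)) :
    constant D a y ∈ Submodule.span k (D.treeLifts a (m + 1)) := by
  induction y using hadamard_induction with
  | zero => rw [map_zero]; exact zero_mem _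
  | add x y hx hy => rw [map_add]; exact add_mem hx hy
  | mk p q =>
    obtain _ | m := m
    · have hp := mem_span_isElementary 1 p
      induction hp using Submodule.span_induction with
      | zero => rw [map_zero, LinearMap.zero_apply, map_zero]; exact zero_mem _
      | add x y _ _ hx hy => rw [map_add, LinearMap.add_apply, map_add]; exact add_mem hx hy
      | smul c x _ hx =>
        rw [map_smul, LinearMap.smul_apply, map_smul]
        exact Submodule.smul_mem _ _ hx
      | mem p hp =>
        obtain _ | ⟨h, i, τ, y, e⟩ := hp
        · refine Submodule.subset_span ⟨.leg 0, ⟨fun l => ?_, fun i => i.elim0⟩,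
            MultilinearMap.constOfIsEmpty k _ q, fun X φ q' => ⟨(endOperad k X.A).one, fun x => rfl,
            congrArg (fun z : MultilinearMap k (fun _ : Fin 1 => X.A) X.A => z ⊗ₜ[k] q) X.α.map_one⟩⟩
          rw [Subsingleton.elim (α := Fin 1) l 0]
          rfl
        · have := i.2
          omega
    · refine Submodule.subset_span ⟨.black (m + 2) (by omega) p .leg, ⟨fun l => ?_, fun i => i.elim0⟩,
        MultilinearMap.constOfIsEmpty k _ q, fun X φ q' => ⟨X.op p, fun x => rfl, rfl⟩⟩
      simp [NatTree.legCount]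

variable (D) in
/-- Renumbering of the arguments of a family of multilinear maps on cochains. -/
noncomputable def permuted {n : ℕ} (a : Fin n → ℕ) (N : ℕ) (σ : Equiv.Perm (Fin n)) :
    (∀ X : D.Alg, MultilinearMap k (fun i => X.Cochain (a (σ i))) (X.Cochain N)) →ₗ[k]
    (∀ X : D.Alg, MultilinearMap k (fun i => X.Cochain (a i)) (X.Cochain N)) where
  toFun V X := (MultilinearMap.domDomCongrLinearEquiv' k k (fun i => X.Cochain (a i)) (X.Cochain N)
    σ.symm).symm (V X)
  map_add' V V' := by
    funext X
    ext x
    simp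
  map_smul' c V := by
    funext X
    ext x
    simp

theorem permuted_mem {n : ℕ} {a : Fin n → ℕ} {N : ℕ} (σ : Equiv.Perm (Fin n))
    {V : ∀ X : D.Alg, MultilinearMap k (fun i => X.Cochain (a (σ i))) (X.Cochain N)}
    (hV : V ∈ Submodule.span k (D.treeOperations (fun i => a (σ i)) N)) :
    permuted D a N σ V ∈ Submodule.span k (D.treeOperations a N) := by
  have h : (Submodule.span k (D.treeOperations (fun i => a (σ i)) N)).map (permuted D a N σ) ≤
      Submodule.span k (D.treeOperations a N) := by
    rw [Submodule.map_span_le]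
    rintro V ⟨T, hT, Φ, h⟩
    refine Submodule.subset_span ⟨_, NatTree.isLinear_relabel σ hT,
      (MultilinearMap.domDomCongrLinearEquiv' k k (fun i => D.dual.operad.obj (a i))
        (D.dual.operad.obj N) σ.symm).symm Φ, fun X => ?_⟩
    obtain ⟨W, hW, hVW⟩ := h X
    refine ⟨(MultilinearMap.domDomCongrLinearEquiv' k k (fun i => X.convOperad.obj (a i))
        (X.convOperad.obj N) σ.symm).symm W, fun φ q => ?_, fun f => ?_⟩
    · obtain ⟨ψ, hψ, e⟩ := hW (fun i => φ (σ i)) (fun i => q (σ i))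
      refine ⟨ψ, fun x => ?_, e⟩
      rw [NatTree.eval_bind]
      exact hψ x
    · exact hVW fun i => f (σ i)
  exact h (Submodule.mem_map_of_mem hV)

end QuadraticData

end CohOp

namespace CohOp

open scoped TensorProduct DirectSum

variable {k : Type u} [Field k] {deg : ℕ → ℤ}

namespace QuadraticData

variable {D : QuadraticData k}

open Operation

/-! ### Naturality of insertions of the pre-Lie product -/

/-- An operation is natural if, in each multidegree of the arguments, it vanishes or is the average
of a combination of tree operations of the right degree. -/
theorem mem_naturalOperations {n : ℕ} {e : ℤ} {U : D.Operation n}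
    (hU : ∀ a : Fin n → ℕ,
      (∃ N : ℕ, (N : ℤ) - 1 = ∑ i, ((a i : ℤ) - 1) + e ∧ ∃ W ∈ Submodule.span k (D.treeLifts a N),
        ∀ (X : D.Alg) (x : ∀ i, X.Cochain (a i)),
          U X (fun i => DirectSum.lof k ℕ (fun a => X.Cochain a) (a i) (x i)) =
            X.cls N (W X fun i => (x i : X.convOperad.obj (a i)))) ∨
      ∀ (X : D.Alg) (x : ∀ i, X.Cochain (a i)),
        U X (fun i => DirectSum.lof k ℕ (fun a => X.Cochain a) (a i) (x i)) = 0) :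
    U ∈ D.naturalOperations n e := by
  rw [naturalOperations, Submodule.mem_iInf]
  intro a
  rw [Submodule.mem_iInf]
  intro N
  rw [Submodule.mem_comap]
  obtain ⟨N', hN', W, hW, h⟩ | h := hU a
  · have hc : ∀ (X : D.Alg) (x : ∀ i, X.Cochain (a i)), D.component a N U X x =
        DirectSum.component k ℕ (fun a => X.Cochain a) N
          (X.cls N' (W X fun i => (x i : X.convOperad.obj (a i)))) :=
      fun X x => congrArg (DirectSum.component k ℕ (fun a => X.Cochain a) N) (h X x)
    by_cases hN : N' = N
    · subst hN
      rw [if_pos hN']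
      have e : D.component a N' U = averaged D a N' W := by
        funext X
        ext x : 1
        exact (hc X x).trans (DirectSum.component.lof_self k N' _)
      rw [e]
      exact averaged_mem hW
    · have hN'' : ¬ ((N : ℤ) - 1 = ∑ i, ((a i : ℤ) - 1) + e) := fun h => hN (by omega)
      rw [if_neg hN'', Submodule.mem_bot]
      funext X
      ext x : 1
      exact (hc X x).trans ((DirectSum.component.of k N N' _).trans (dif_neg hN))
  · have e : D.component a N U = 0 := by
      funext X
      ext x : 1
      exact (congrArg (DirectSum.component k ℕ (fun a => X.Cochain a) N) (h X x)).trans (map_zero _)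
    rw [e]
    exact zero_mem _

theorem swap_mem_naturalOperations {n : ℕ} {e : ℤ} (x y : Fin n) {U : D.Operation n}
    (hU : U ∈ D.naturalOperations n e) : Operation.swap x y U ∈ D.naturalOperations n e := by
  rw [naturalOperations, Submodule.mem_iInf] at hU ⊢
  intro a
  rw [Submodule.mem_iInf]
  intro N
  have h := hU fun i => a (Equiv.swap x y i)
  rw [Submodule.mem_iInf] at h
  have h := h N
  rw [Submodule.mem_comap] at h ⊢
  rw [Equiv.sum_comp (Equiv.swap x y) fun i => (a i : ℤ) - 1] at h
  have hc : D.component a N (Operation.swap x y U) = koszul (sgn (a x)) (sgn (a y)) •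
      permuted D a N (Equiv.swap x y) (D.component (fun i => a (Equiv.swap x y i)) N U) := by
    funext X
    ext z : 1
    refine (congrArg (DirectSum.component k ℕ (fun a => X.Cochain a) N)
      (isSwap_swap x y U X a _ fun i => ⟨z i, rfl⟩)).trans ?_
    exact negOnePow_smul_map _ _ _
  rw [hc]
  refine (Operad.units_smul_mem_iff _ _).2 ?_
  by_cases hN : (N : ℤ) - 1 = ∑ i, ((a i : ℤ) - 1) + e
  · rw [if_pos hN] at h ⊢
    exact permuted_mem _ h
  · rw [if_neg hN, Submodule.mem_bot] at h ⊢
    rw [h, map_zero]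

/-- The full composition of `y` with `f_0 ∘ f_1, f_2, …` consists of tree operations: the arguments
are grafted one after the other. -/
theorem exists_partialComp_preLie {m : ℕ} (y : D.suspHadamard.obj (m + 1)) (a : Fin (2 + m) → ℕ)
    {r : ℕ} (hr : r + 1 = a (Fin.castAdd m 0) + a (Fin.castAdd m 1)) :
    ∀ j (hj : j ≤ m), ∃ W : D.Family (fun i : Fin (2 + j) => a (Fin.castLE (by omega) i))
        ((m + 1 - (j + 1)) +
          partialSum (Fin.cons r fun i => a (Fin.natAdd 2 i) : Fin (m + 1) → ℕ) (j + 1)),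
      W ∈ Submodule.span k (D.treeLifts _ _) ∧
      ∀ (X : D.Alg) (f : ∀ i, X.convOperad.obj (a i)), W X (fun i => f (Fin.castLE (by omega) i)) =
        X.convOperad.partialComp (Fin.cons r fun i => a (Fin.natAdd 2 i) : Fin (m + 1) → ℕ)
          (X.structureMap (m + 1) y)
          (Fin.cons (α := fun i => X.convOperad.obj
              ((Fin.cons r fun i => a (Fin.natAdd 2 i) : Fin (m + 1) → ℕ) i))
            (∑ z, X.convOperad.comp hr z (f (Fin.castAdd m 0)) (f (Fin.castAdd m 1)))
            fun i => f (Fin.natAdd 2 i)) (j + 1) (by omega) := by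
  intro j
  set c : Fin (m + 1) → ℕ := Fin.cons r fun i => a (Fin.natAdd 2 i) with hc
  induction j with
  | zero =>
    intro hj
    have h0 : partialSum c 1 = r := by
      rw [Operad.partialSum_succ c 0 (by omega)]
      exact Nat.zero_add r
    have h2 : m + 1 - (0 + 1) + partialSum c (0 + 1) + 1 =
        m + a (Fin.castAdd m 0) + a (Fin.castAdd m 1) := by
      rw [zero_add, h0]
      omega
    -- In `y ∘_0 (f_0 ∘_z f_1)` the argument `f_0` is grafted on the first leg of the black vertex
    -- `y`, then `f_1` on the leg `z` of `f_0`.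
    refine ⟨∑ z : Fin (a (Fin.castAdd m 0)), insertLast D (n := 1)
      (fun i : Fin 2 => a (Fin.castAdd m i)) (m := m + a (Fin.castAdd m 0)) h2
      (inBlk (m := m + 1) (by omega) 0 z)
      (insertLast D (n := 0) (fun i : Fin 1 => a (Fin.castAdd m (Fin.castSucc i))) (m := m + 1)
        (by rw [Nat.add_right_comm]; rfl) 0 (constant D _ y)),
      sum_mem fun z _ => insertLast_mem _ _ _ (insertLast_mem _ _ _ (constant_mem _ y)),
      fun X f => ?_⟩
    rw [Finset.sum_apply, sum_apply]
    refine Eq.trans (Finset.sum_congr rfl fun z _ => ?_) (map_sum (X.convOperad.comp (m := m + 1)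
      (n := r) (r := m + 1 - (0 + 1) + partialSum c (0 + 1)) (by rw [zero_add, h0]; omega) 0
      (X.structureMap (m + 1) y)) _ _).symm
    exact X.convOperad.comp_seq _ _ _ _ _ _ _ _ _
  | succ j ih =>
    intro hj
    obtain ⟨W, hW, h⟩ := ih (by omega)
    have hj' : partialSum c (j + 2) =
        partialSum c (j + 1) + a (Fin.castLE (by omega) (Fin.last (2 + j))) :=
      Operad.partialSum_succ c (j + 1) (by omega)
    have h2 : m + 1 - (j + 1 + 1) + partialSum c (j + 1 + 1) + 1 =
        (m + 1 - (j + 1) + partialSum c (j + 1)) +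
          a (Fin.castLE (by omega) (Fin.last (2 + j))) := by
      rw [hj']
      omega
    refine ⟨insertLast D (n := 2 + j) (fun i : Fin (2 + j + 1) => a (Fin.castLE (by omega) i))
      (m := m + 1 - (j + 1) + partialSum c (j + 1)) h2
      ⟨partialSum c (j + 1), by omega⟩ W, insertLast_mem _ _ _ hW, fun X f => ?_⟩
    rw [Operad.partialComp_step]
    exact congrArg (fun z => X.convOperad.comp h2 ⟨partialSum c (j + 1), by omega⟩ z
      (f (Fin.castLE (by omega) (Fin.last (2 + j))))) (h X f)

variable [CharZero k]

/-- Substituting the pre-Lie product into a cup product gives a natural operation. -/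
theorem compZero_preLie_mem {m : ℕ} (y : D.suspHadamard.obj (m + 1)) :
    compZero (D.cup y) D.preLieOperation ∈ D.naturalOperations (2 + m) m := by
  refine mem_naturalOperations fun a => ?_
  have hU : ∀ (X : D.Alg) (x : ∀ i, X.Cochain (a i)), compZero (D.cup y) D.preLieOperation X
      (fun i => DirectSum.lof k ℕ (fun a => X.Cochain a) (a i) (x i)) =
      (D.cup y X).curryLeft (X.preLie
        (X.cls _ (x (Fin.castAdd m 0) : X.convOperad.obj (a (Fin.castAdd m 0))))
        (X.cls _ (x (Fin.castAdd m 1) : X.convOperad.obj (a (Fin.castAdd m 1)))))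
        fun i => DirectSum.lof k ℕ (fun a => X.Cochain a) _ (x (Fin.natAdd 2 i)) := by
    intro X x
    rw [compZero_apply, X.cls_coe, X.cls_coe]
    rfl
  -- If `f_0` has no inputs, then `f_0 ∘ f_1` is an empty sum.
  by_cases h0 : a (Fin.castAdd m 0) = 0
  · refine Or.inr fun X x => ?_
    rw [hU, X.preLie_cls]
    have : IsEmpty (Fin (a (Fin.castAdd m 0))) := by rw [h0]; infer_instance
    rw [Finset.univ_eq_empty, Finset.sum_empty, map_zero, zero_apply]
  · obtain ⟨r, hr⟩ : ∃ r, r + 1 = a (Fin.castAdd m 0) + a (Fin.castAdd m 1) :=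
      ⟨a (Fin.castAdd m 0) + a (Fin.castAdd m 1) - 1, by omega⟩
    obtain ⟨W, hW, h⟩ := exists_partialComp_preLie y a hr m le_rfl
    refine Or.inl ⟨totalArity (Fin.cons r fun i => a (Fin.natAdd 2 i) : Fin (m + 1) → ℕ), ?_,
      W, hW, fun X x => ?_⟩
    · rw [totalArity_val, Fin.sum_univ_succ, Fin.sum_univ_add, Fin.sum_univ_two,
        Finset.sum_sub_distrib]
      simp only [Fin.cons_zero, Fin.cons_succ, Finset.sum_const, Finset.card_univ, Fintype.card_fin,
        nsmul_eq_mul, mul_one]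
      have : (r : ℤ) + 1 = a (Fin.castAdd m 0) + a (Fin.castAdd m 1) := by exact_mod_cast hr
      linarith
    · rw [hU, X.preLie_cls' hr, ← map_sum, cup_cons_cls]
      exact congrArg (X.cls _) (h X fun i => (x i : X.convOperad.obj (a i))).symm

end QuadraticData

end CohOp

namespace CohOp

open scoped TensorProduct DirectSum

variable {k : Type u} [Field k] {deg : ℕ → ℤ}

namespace QuadraticData

open Operation

variable {D : QuadraticData k}

/-! ### Exact cup products -/

theorem delta_two (e : ℤ) (U : D.Operation 2) (X : D.Alg) (f g : X.Complex) :
    delta e U X ![f, g] =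
      X.d (U X ![f, g]) - e.negOnePow • (U X ![X.d f, g] + U X ![X.parity f, X.d g]) := by
  have h0 : X.twist 0 ![f, g] = ![X.d f, g] := by
    funext i
    fin_cases i <;> rfl
  have h1 : X.twist 1 ![f, g] = ![X.parity f, X.d g] := by
    funext i
    fin_cases i <;> rfl
  rw [delta_apply, Fin.sum_univ_two, h0, h1]

theorem ext_two {U V : D.Operation 2}
    (h : ∀ (X : D.Alg) (f g : X.Complex), U X ![f, g] = V X ![f, g]) : U = V := by
  refine ext_apply fun X f => ?_
  rw [show f = ![f 0, f 1] by funext i; fin_cases i <;> rfl]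
  exact h X _ _

variable [CharZero k]

theorem delta_delta_two (U : D.Operation 2) : delta 1 (delta 0 U) = 0 := by
  refine ext_two fun X f g => ?_
  have hl : ∀ x, U X ![0, x] = 0 := fun x => (U X).map_coord_zero 0 rfl
  have hr : ∀ x, U X ![x, 0] = 0 := fun x => (U X).map_coord_zero 1 rfl
  have hn : ∀ x y, U X ![-x, y] = -U X ![x, y] := fun x y => by
    have h := (U X).map_update_neg ![x, y] 0 x
    have e : ∀ z w : X.Complex, Function.update ![z, y] 0 w = ![w, y] := fun z w => by
      funext i
      fin_cases i <;> rfl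
    rwa [e, e] at h
  simp only [delta_two, Int.negOnePow_zero, one_smul, Int.negOnePow_one, Units.neg_smul, map_sub,
    map_add, X.d_d, X.parity_d, hl, hr, hn]
  rw [Pi.zero_apply, zero_apply]
  abel

/-- The cup product of the canonical element is the associator of `μ` with the two arguments, and by
right symmetry of the associator this is what remains of `-δ_P(∘)`. -/
theorem cup_canonical_eq_neg_delta : D.cup D.canonical = -delta 0 D.preLieOperation := by
  refine ext_two fun X f g => ?_
  have hp : ∀ f g, D.preLieOperation X ![f, g] = X.preLie f g := fun _ _ => rfl
  have hs := X.preLie_right_symm_structureCochain (X.parity f) (X.parity g)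
  rw [X.parity_parity, sub_eq_iff_eq_add] at hs
  rw [Pi.neg_apply, neg_apply, delta_two, hp, hp, hp, Int.negOnePow_zero, one_smul, cup_canonical]
  simp only [Alg.d_apply, map_sub, LinearMap.sub_apply, X.parity_preLie]
  rw [hs]
  abel

theorem canonical_mem_closed : D.canonical ∈ D.closed.carrier 2 := by
  change delta 1 (D.cup D.canonical) = 0
  rw [cup_canonical_eq_neg_delta]
  have h := delta_smul 1 (-1 : k) (delta 0 D.preLieOperation)
  rw [delta_delta_two, smul_zero] at h
  exact (congrArg (delta 1) (neg_one_smul k (delta 0 D.preLieOperation))).symm.trans h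

variable (D) in
/-- The elements of `𝔰(P ⊗ P^!)(n)` whose cup product is the `δ_P`-boundary of a natural
operation. -/
noncomputable def exact (n : ℕ) : Submodule k (D.suspHadamard.obj n) where
  carrier := {t | ∃ U ∈ D.naturalOperations n ((n : ℤ) - 2), delta ((n : ℤ) - 2) U = D.cup t}
  zero_mem' := ⟨0, zero_mem _, by
    have := cup_smul (0 : k) (0 : D.suspHadamard.obj n)
    rw [zero_smul, zero_smul] at this
    rw [this, delta_zero]⟩
  add_mem' := by
    rintro t t' ⟨U, hU, e⟩ ⟨U', hU', e'⟩
    exact ⟨U + U', add_mem hU hU', by rw [delta_add, cup_add, e, e']⟩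
  smul_mem' := by
    rintro c t ⟨U, hU, e⟩
    exact ⟨c • U, Submodule.smul_mem _ _ hU, by rw [delta_smul, cup_smul, e]⟩

theorem act_mem_exact {n : ℕ} (σ : Equiv.Perm (Fin n)) {t : D.suspHadamard.obj n}
    (ht : t ∈ D.exact n) : D.suspHadamard.act σ t ∈ D.exact n := by
  refine D.suspHadamard.act_induction (C := fun t => t ∈ D.exact n) (fun j hj t ht => ?_) σ t ht
  obtain ⟨U, hU, e⟩ := ht
  refine ⟨Operation.swap ⟨j, by omega⟩ ⟨j + 1, hj⟩ U, swap_mem_naturalOperations _ _ hU, ?_⟩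
  have h := (isSwap_swap ⟨j, by omega⟩ ⟨j + 1, hj⟩ U).delta rfl ((n : ℤ) - 2)
  rw [e] at h
  exact h.unique (isSwap_cup t j hj)

/-- A composite `t ∘_i χ` with `t` closed is the boundary of the insertion of the pre-Lie product
into `t`. -/
theorem comp_canonical_mem_exact {m r : ℕ} (h : r + 1 = m + 2) (i : Fin m)
    {t : D.suspHadamard.obj m} (ht : t ∈ D.closed.carrier m) :
    D.suspHadamard.comp h i t D.canonical ∈ D.exact r := by
  obtain _ | m := m
  · exact i.elim0
  obtain rfl : r = 2 + m := by omega
  obtain ⟨σ, ρ, e⟩ := D.suspHadamard.comp_eq_act_comp_zero h i t D.canonical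
  rw [e]
  refine act_mem_exact ρ ?_
  have ht' : delta (((m + 1 : ℕ) : ℤ) - 1) (D.cup (D.suspHadamard.act σ t)) = 0 :=
    delta_cup_act σ t ht
  set t' := D.suspHadamard.act σ t
  set V := compZero (D.cup t') D.preLieOperation with hV
  have hd := delta_compZero (V := D.preLieOperation) (eV := 0) ht' fun X f => by
    rw [Int.negOnePow_zero, one_smul]
    exact (X.parity_preLie _ _).symm
  have hneg : compZero (D.cup t') (delta 0 D.preLieOperation) =
      (-1 : k) • D.cup (D.suspHadamard.comp h 0 t' D.canonical) := by
    rw [cup_comp_zero, cup_canonical_eq_neg_delta]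
    refine ext_apply fun X f => ?_
    rw [Pi.smul_apply, smul_apply, compZero_apply, compZero_apply, Pi.neg_apply, neg_apply, map_neg,
      neg_apply, neg_one_smul]
    exact (neg_neg _).symm
  have hdeg : ((m + 1 : ℕ) : ℤ) - 1 + 0 = ((2 + m : ℕ) : ℤ) - 2 := by push_cast; ring
  have hmem : V ∈ D.naturalOperations (2 + m) (((2 + m : ℕ) : ℤ) - 2) := by
    rw [show ((2 + m : ℕ) : ℤ) - 2 = m by push_cast; ring]
    exact compZero_preLie_mem t'
  rw [hneg, hdeg, ← hV] at hd
  -- The sign `(-1)^m` of passing `δ_P` across `t'` decides whether `V` or `-V` bounds.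
  rcases Int.units_eq_one_or (((m + 1 : ℕ) : ℤ) - 1).negOnePow with hs | hs
  · refine ⟨(-1 : k) • V, Submodule.smul_mem _ _ hmem, ?_⟩
    rw [delta_smul, hd, hs, one_smul, smul_smul, neg_one_mul, neg_neg, one_smul]
  · refine ⟨V, hmem, ?_⟩
    rw [hd, hs, neg_one_smul k (D.cup (D.suspHadamard.comp h 0 t' D.canonical))]
    refine ext_apply fun X f => ?_
    rw [Pi.smul_apply, smul_apply, Units.neg_smul, one_smul, Pi.neg_apply, neg_apply, neg_neg]

theorem lieHom_mem_closed (n : ℕ) (x : (lieData k).operad.obj n) :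
    toSusp _ n (D.lieHom.map n x) ∈ D.closed.carrier n := by
  refine susp_map_mem (Q := hadamard D.operad D.dual.operad) D.lieHom D.closed (fun e => ?_) n x
  have h : ∀ c : k, c • D.canonical ∈ D.closed.carrier 2 := fun c =>
    (D.closed.carrier 2).smul_mem c canonical_mem_closed
  have h1 : ∀ c : k, c • D.canonical = toSusp _ 2 (D.lieHom.map 2 ((lieData k).gen c)) :=
    fun c => congrArg (toSusp _ 2) (lieHom_gen_eq_smul D c).symm
  exact h1 e ▸ h e

/-- In arity `n ≠ 1` the elementary operations are the renumbered composites `y ∘_i λ`, which the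
morphism sends to composites of a closed element with the canonical element. -/
theorem lieHom_mem_exact {n : ℕ} (hn : n ≠ 1) (x : (lieData k).operad.obj n) :
    toSusp _ n (D.lieHom.map n x) ∈ D.exact n := by
  have hx := mem_span_isElementary n x
  induction hx using Submodule.span_induction with
  | zero => rw [map_zero, map_zero]; exact zero_mem _
  | add x y _ _ hx hy => rw [map_add, map_add]; exact add_mem hx hy
  | smul c x _ hx => rw [map_smul, map_smul]; exact Submodule.smul_mem _ _ hx
  | mem x hx =>
    obtain _ | ⟨h, i, σ, y, e⟩ := hx
    · exact absurd rfl hn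
    · have h1 : ∀ c : k, D.suspHadamard.comp h i (toSusp _ _ (D.lieHom.map _ y))
          (c • D.canonical) ∈ D.exact _ := fun c => by
        rw [map_smul]
        exact Submodule.smul_mem _ _ (comp_canonical_mem_exact h i (lieHom_mem_closed _ y))
      have h2 : toSusp _ _ (D.lieHom.map _ ((lieData k).operad.comp h i y ((lieData k).gen e))) ∈
          D.exact _ := by
        rw [OperadHom.map_comp]
        exact (Operad.units_smul_mem_iff _ _).1 (h1 e)
      rw [OperadHom.map_act]
      exact (Operad.units_smul_mem_iff _ (Equiv.Perm.sign σ)).1 (act_mem_exact σ h2)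

/-- The pre-Lie product is its own insertion into the cup product of the unit, the identity. -/
theorem preLieOperation_mem : D.preLieOperation ∈ D.naturalOperations 2 0 := by
  have h := compZero_preLie_mem (m := 0) D.suspHadamard.one
  have e : compZero (l := 2) (m := 0) (D.cup D.suspHadamard.one) D.preLieOperation =
      D.preLieOperation := by
    refine ext_two fun X f g => ?_
    exact cup_one X _
  exact e ▸ h

end QuadraticData

end CohOp

theorem mainTheorem5 {k : Type u} [Field k] [CharZero k] (D : CohOp.QuadraticData k) :
    ∃ Z : CohOp.Suboperad D.suspHadamard,
      (∀ (n : ℕ) (t : D.suspHadamard.obj n),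
        t ∈ Z.carrier n ↔ CohOp.QuadraticData.Operation.delta ((n : ℤ) - 1) (D.cup t) = 0) ∧
      ∃ hχ : D.canonical ∈ Z.carrier 2,
        (∃ L : CohOp.OperadHom (CohOp.suspLie k) Z.toOperad,
          L.map 2 (CohOp.suspBracket k) = ⟨D.canonical, hχ⟩ ∧
          (∀ L' : CohOp.OperadHom (CohOp.suspLie k) Z.toOperad,
            L'.map 2 (CohOp.suspBracket k) = ⟨D.canonical, hχ⟩ → L' = L) ∧
          ∀ n : ℕ, n ≠ 1 → ∀ x : (CohOp.suspLie k).obj n,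
            ∃ U ∈ D.naturalOperations n ((n : ℤ) - 2),
              CohOp.QuadraticData.Operation.delta ((n : ℤ) - 2) U =
                D.cup (L.map n x : Z.carrier n).1) ∧
        D.preLieOperation ∈ D.naturalOperations 2 0 ∧
        D.cup D.canonical = -CohOp.QuadraticData.Operation.delta 0 D.preLieOperation := by
  have hL : ∀ n x, D.lieHom.susp.map n x ∈ D.closed.carrier n := fun n x =>
    CohOp.QuadraticData.lieHom_mem_closed n x
  refine ⟨D.closed, fun n t => Iff.rfl, CohOp.QuadraticData.canonical_mem_closed,
    ⟨D.lieHom.susp.codRestrict D.closed hL, Subtype.ext D.lieHom_gen, fun L' h => ?_,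
      fun n hn x => CohOp.QuadraticData.lieHom_mem_exact hn x⟩,
    CohOp.QuadraticData.preLieOperation_mem,
    CohOp.QuadraticData.cup_canonical_eq_neg_delta⟩
  exact CohOp.QuadraticData.hom_suspLie_ext _ _ (h.trans (Subtype.ext D.lieHom_gen).symm)
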